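/- Let $n\ge 1$, let $\Omega\subset\mathbb R^n$ be a bounded Lipschitz domain (i.e. a bounded open set with Lipschitz boundary), $\Omega_e=\mathbb R^n\setminus\overline\Omega$, $T>0$, $0<s<\alpha\le 1$ and $m>1$. Put $\Phi^m(t)=|t|^{m-1}t$ and $A_T=A\times(0,T)$ for $A\subset\mathbb R^n$. Let $H^s(\mathbb R^n)$ be the space of $u\in L^2(\mathbb R^n)$ with $$\|u\|_{H^s(\mathbb R^n)}^2=\|u\|_{L^2(\mathbb R^n)}^2+\int_{\mathbb R^{2n}}\frac{|u(x)-u(y)|^2}{|x-y|^{n+2s}}\,dx\,dy<\infty ,$$ and let $\widetilde H^s(\Omega)$ be the closure of $C_c^\infty(\Omega)$ in $H^s(\mathbb R^n)$. Let $K\colon\mathbb R^n\times\mathbb R^n\to\mathbb R$ be measurable with $K(x,y)=K(y,x)$ and $\lambda\le K(x,y)\le\Lambda$ for all $x,y$, for some constants $0<\lambda\le\Lambda<\infty$, and set $$B_K(u,v)=\int_{\mathbb R^{2n}}K(x,y)\frac{(u(x)-u(y))(v(x)-v(y))}{|x-y|^{n+2s}}\,dx\,dy .$$ Let $\rho,q\in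 C^{1,\alpha}(\mathbb R^n)$ be nonnegative (bounded, with bounded and $\alpha$-Hölder continuous gradient), with $\rho$ bounded below by a positive constant. Let $u_0\in L^\infty(\Omega)\cap\widetilde H^s(\Omega)$ and let $\varphi\in C_c([0,T]\times\Omega_e)$, extended by zero, satisfy $\Phi^m(\varphi)\in L^2(0,T;H^s(\mathbb R^n))$. A function $u\colon\mathbb R^n\times(0,T)\to\mathbb R$ is called a weak solution of $$\rho\,\partial_t u+L_K(\Phi^m(u))+qu=0\ \text{ in }\Omega_T,\qquad u=\varphi\ \text{ in }(\Omega_e)_T,\qquad u(0)=u_0\ \text{ in }\Omega$$ if $\Phi^m(u)\in L^2(0,T;H^s(\mathbb R^n))$, $\Phi^m(u-\varphi)\in L^2(0,T;\widetilde H^s(\Omega))$ and $$-\int_{\Omega_T}\rho u\,\partial_t\psi\,dx\,dt+\int_0^T B_K(\Phi^m(u),\psi)\,dt+\int_{\Omega_T}qu\psi\,dx\,dt=\int_\Omega\rho u_0\,\psi(0)\,dx$$ for all $\psi\in C_c^\infty([0,T)\times\Omega)$. If $u_1$ and $u_2$ are two weak solutions of this problem (with the same $u_0$ and $\varphi$),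 then $u_1=u_2$ almost everywhere in $\mathbb R^n\times(0,T)$. -/

import Mathlib

open MeasureTheory Set
open scoped ENNReal ContDiff

noncomputable section

namespace NPME

/-- The Euclidean space `ℝⁿ`. -/
abbrev Space (n : ℕ) : Type := EuclideanSpace ℝ (Fin n)

/-- A bounded Lipschitz domain: a bounded open set which, near each boundary point and after a
rotation of the coordinates (the last coordinate axis being spanned by the unit vector `e`), is the
strict epigraph of a Lipschitz function `g` of the coordinates orthogonal to `e`. -/
structure IsBoundedLipschitzDomain {n : ℕ} (Ω : Set (Space n)) : Prop where
  isOpen : IsOpen Ω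
  isBounded : Bornology.IsBounded Ω
  lipschitz : ∀ x ∈ frontier Ω, ∃ (e : Space n) (g : Space n → ℝ) (L : NNReal) (r : ℝ),
    ‖e‖ = 1 ∧ LipschitzWith L g ∧ 0 < r ∧
      Ω ∩ Metric.ball x r =
        {y | g (y - inner ℝ e y • e) < inner ℝ e y} ∩ Metric.ball x r

/-- The exterior `Ω_e = ℝⁿ \ closure Ω`. -/
def exterior {n : ℕ} (Ω : Set (Space n)) : Set (Space n) := (closure Ω)ᶜ

/-- The nonlinearity `Φ^m(t) = |t|^(m-1) t`. -/
def Phi (m : ℝ) (t : ℝ) : ℝ := |t| ^ (m - 1) * t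

/-- The square of the `H^s(ℝⁿ)` norm, `‖u‖²_{L²} + [u]²_{H^s}`, with values in `[0, ∞]`. -/
def hsNormSq {n : ℕ} (s : ℝ) (u : Space n → ℝ) : ℝ≥0∞ :=
  (∫⁻ x, ‖u x‖ₑ ^ 2) +
    ∫⁻ p : Space n × Space n,
      ‖u p.1 - u p.2‖ₑ ^ 2 / ENNReal.ofReal (‖p.1 - p.2‖ ^ ((n : ℝ) + 2 * s))

/-- `u` belongs to the closure `H̃^s(Ω)` of `C_c^∞(Ω)` in `H^s(ℝⁿ)`. -/
def MemHsTilde {n : ℕ} (s : ℝ) (Ω : Set (Space n)) (u : Space n → ℝ) : Prop :=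
  AEStronglyMeasurable u volume ∧
    ∀ ε : ℝ≥0∞, 0 < ε → ∃ ψ : Space n → ℝ,
      ContDiff ℝ ∞ ψ ∧ HasCompactSupport ψ ∧ tsupport ψ ⊆ Ω ∧
        hsNormSq s (fun x => u x - ψ x) < ε

/-- `w ∈ L²(0,T; H^s(ℝⁿ))` for a function `w = w(t, x)` on space-time. As `H^s(ℝⁿ)` is a separable
Hilbert space, joint (Lebesgue) measurability of `w` amounts to strong measurability of
`t ↦ w(t, ·)`. -/
def MemL2Hs {n : ℕ} (T s : ℝ) (w : ℝ → Space n → ℝ) : Prop :=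
  AEStronglyMeasurable (Function.uncurry w)
      (volume.restrict (Ioo 0 T ×ˢ (univ : Set (Space n)))) ∧
    ∫⁻ t in Ioo 0 T, hsNormSq s (w t) < ⊤

/-- `w ∈ L²(0,T; H̃^s(Ω))`. -/
def MemL2HsTilde {n : ℕ} (T s : ℝ) (Ω : Set (Space n)) (w : ℝ → Space n → ℝ) : Prop :=
  MemL2Hs T s w ∧ ∀ᵐ t ∂(volume.restrict (Ioo 0 T)), MemHsTilde s Ω (w t)

/-- `K` is the (measurable) kernel of an operator of the class `𝓛₀`: it is symmetric and uniformly
elliptic. -/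
structure IsKernelL0 {n : ℕ} (K : Space n → Space n → ℝ) : Prop where
  aemeasurable : AEMeasurable (Function.uncurry K) volume
  symm : ∀ x y, K x y = K y x
  elliptic : ∃ l L : ℝ, 0 < l ∧ l ≤ L ∧ ∀ x y, l ≤ K x y ∧ K x y ≤ L

/-- The bilinear form
`B_K(u,v) = ∫∫ K(x,y) (u(x)-u(y)) (v(x)-v(y)) / |x-y|^(n+2s) dx dy` of the operator `L_K`. -/
def bilinForm {n : ℕ} (s : ℝ) (K : Space n → Space n → ℝ) (u v : Space n → ℝ) : ℝ :=
  ∫ p : Space n × Space n,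
    K p.1 p.2 * ((u p.1 - u p.2) * (v p.1 - v p.2)) / ‖p.1 - p.2‖ ^ ((n : ℝ) + 2 * s)

/-- `g ∈ C^{1,α}_+(ℝⁿ)`: `g` is nonnegative and continuously differentiable, `g` and its derivative
are bounded, and the derivative is globally `α`-Hölder continuous. -/
structure IsC1HolderNonneg {n : ℕ} (α : ℝ) (g : Space n → ℝ) : Prop where
  nonneg : ∀ x, 0 ≤ g x
  contDiff : ContDiff ℝ 1 g
  bounded : ∃ C : ℝ, ∀ x, |g x| ≤ C ∧ ‖fderiv ℝ g x‖ ≤ C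
  holder : ∃ C : ℝ, ∀ x y, ‖fderiv ℝ g x - fderiv ℝ g y‖ ≤ C * ‖x - y‖ ^ α

/-- `ρ` is uniformly elliptic, i.e. bounded between two positive constants. -/
def IsUniformlyElliptic {n : ℕ} (ρ : Space n → ℝ) : Prop :=
  ∃ l L : ℝ, 0 < l ∧ l ≤ L ∧ ∀ x, l ≤ ρ x ∧ ρ x ≤ L

/-- `φ ∈ C_c([0,T] × Ω_e)`, where `φ = φ(t, x)` is extended by zero to `[0,T] × ℝⁿ`. Values at
times outside `[0,T]` are irrelevant. -/
structure IsExteriorDatum {n : ℕ} (T : ℝ) (Ω : Set (Space n)) (φ : ℝ → Space n → ℝ) : Prop where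
  continuousOn : ContinuousOn (Function.uncurry φ) (Icc 0 T ×ˢ (univ : Set (Space n)))
  compactSupport : ∃ C : Set (ℝ × Space n), IsCompact C ∧ C ⊆ Icc 0 T ×ˢ exterior Ω ∧
    ∀ t ∈ Icc 0 T, ∀ x, (t, x) ∉ C → φ t x = 0

/-- `ψ ∈ C_c^∞([0,T) × Ω)`: the smooth functions with compact support in `[0,T) × Ω` are exactly
the restrictions to nonnegative times of the smooth functions on `ℝ × ℝⁿ` with compact support in
`(-∞,T) × Ω`. -/
structure IsTestFunction {n : ℕ} (T : ℝ) (Ω : Set (Space n)) (ψ : ℝ → Space n → ℝ) : Prop where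
  contDiff : ContDiff ℝ ∞ (Function.uncurry ψ)
  hasCompactSupport : HasCompactSupport (Function.uncurry ψ)
  tsupport_subset : tsupport (Function.uncurry ψ) ⊆ Iio T ×ˢ Ω

/-- `u = u(t, x)` is a weak solution of `ρ ∂ₜu + L_K(Φ^m(u)) + q u = 0` in `Ω_T`, `u = φ` in
`(Ω_e)_T`, `u(0) = u₀` in `Ω`. -/
structure IsWeakSolution {n : ℕ} (Ω : Set (Space n)) (T s m : ℝ) (K : Space n → Space n → ℝ)
    (ρ q : Space n → ℝ) (u₀ : Space n → ℝ) (φ : ℝ → Space n → ℝ) (u : ℝ → Space n → ℝ) :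
    Prop where
  memL2Hs : MemL2Hs T s (fun t x => Phi m (u t x))
  memL2HsTilde : MemL2HsTilde T s Ω (fun t x => Phi m (u t x - φ t x))
  weakForm : ∀ ψ : ℝ → Space n → ℝ, IsTestFunction T Ω ψ →
    -(∫ p in Ioo 0 T ×ˢ Ω, ρ p.2 * u p.1 p.2 * deriv (fun τ => ψ τ p.2) p.1)
        + (∫ t in Ioo 0 T, bilinForm s K (fun x => Phi m (u t x)) (ψ t))
        + (∫ p in Ioo 0 T ×ˢ Ω, q p.2 * u p.1 p.2 * ψ p.1 p.2)
      = ∫ x in Ω, ρ x * u₀ x * ψ 0 x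

end NPME

end

/-! ### The Gagliardo measure, radial weights and Lipschitz multipliers on `H^s`. -/

namespace NPME

variable {n : ℕ} {s : ℝ}

/-! Put `w = Φ^m(u₁) - Φ^m(u₂)`, `V = ρ (u₁ - u₂)` on `Ω`, and `a = q / ρ`. The difference of the
two equations is linear in the pair: `∂ₜV + L_K w + a V = 0` with `V(0) = 0`
(`IsWeakSolution.exists_isLinearPair`). Since `Φ^m` is increasing, `V w ≥ 0`. It therefore suffices
to find one `μ` with `∫∫ e^{-μt} V w ≤ 0`: then `V w = 0` almost everywhere, and strict monotonicity
gives `u₁ = u₂` in `Ω`, while outside `Ω` both equal `φ`.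

The sign comes from an Oleinik-type test function adapted to the zeroth-order term. Duhamel's
formula (`IsLinearPair.duhamel`) reads `V(t) = -∫₀ᵗ e^{-a(t-r)} L_K w(r) dr`. Pairing it with
`e^{-μt} w(t)` and exchanging the time integrals gives (`IsLinearPair.integral_pairing_eq`) `∫∫
e^{-μt} V w = -∫ B_K(w, ψ) dτ`, where `ψ(τ) = ∫_τ^T e^{-a(σ-τ)-μσ} w(σ) dσ`. Here `ψ(T) = 0` and `w
= e^{μτ} (aψ - ψ')`. For a fixed pair of points `x, y`, integration by parts in time
(`energy_inequality`) bounds the time integral of `(w(x)-w(y))(ψ(x)-ψ(y))` from below by that of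
`e^{μτ} ((μ-1)/2 |ψ(x)-ψ(y)|² - |a(x)-a(y)|²/2 |ψ(y)|²)`.

The negative term is the price of a variable `a`. As `a` is bounded and Lipschitz, `|a(x)-a(y)|² ≤
A² min(1,|x-y|)²`, and this weight has finite mass against `|z|^{-n-2s}` because `0 < s < 1`. So the
term is controlled by the `L²` norm of `ψ`, hence by its Gagliardo seminorm (`exists_poincare`), and
a large `μ` absorbs it (`IsLinearPair.exists_integral_nonpos`). -/

theorem enorm_sq_eq_ofReal (x : ℝ) : ‖x‖ₑ ^ 2 = ENNReal.ofReal (x ^ 2) := by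
  rw [Real.enorm_eq_ofReal_abs, ← ENNReal.ofReal_pow (abs_nonneg x), sq_abs]

/-- The increment `u(x) - u(y)`. -/
def incr (u : Space n → ℝ) (p : Space n × Space n) : ℝ := u p.1 - u p.2

/-- The measure `|x-y|^(-n-2s) dx dy`. -/
noncomputable def nu (n : ℕ) (s : ℝ) : Measure (Space n × Space n) :=
  volume.withDensity fun p => ENNReal.ofReal ((‖p.1 - p.2‖ ^ ((n : ℝ) + 2 * s))⁻¹)

instance : SigmaFinite (nu n s) := by unfold nu; infer_instance

theorem measurable_nu_density : Measurable fun p : Space n × Space n =>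
    ENNReal.ofReal ((‖p.1 - p.2‖ ^ ((n : ℝ) + 2 * s))⁻¹) := by fun_prop

theorem nu_absolutelyContinuous :
    nu n s ≪ (volume : Measure (Space n)).prod (volume : Measure (Space n)) :=
  withDensity_absolutelyContinuous _ _

theorem incr_measurable {u : Space n → ℝ} (hu : Measurable u) : Measurable (incr u) := by
  unfold incr; fun_prop

theorem ae_fst_of_ae {P : Space n → Prop} (h : ∀ᵐ x, P x) : ∀ᵐ p ∂(nu n s), P p.1 :=
  nu_absolutelyContinuous.ae_le (Measure.quasiMeasurePreserving_fst.ae h)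

theorem ae_snd_of_ae {P : Space n → Prop} (h : ∀ᵐ x, P x) : ∀ᵐ p ∂(nu n s), P p.2 :=
  nu_absolutelyContinuous.ae_le (Measure.quasiMeasurePreserving_snd.ae h)

theorem incr_ae_congr {u v : Space n → ℝ} (h : u =ᵐ[volume] v) :
    incr u =ᵐ[nu n s] incr v := by
  filter_upwards [ae_fst_of_ae h, ae_snd_of_ae h] with p h1 h2
  simp [incr, h1, h2]

theorem incr_aestronglyMeasurable {u : Space n → ℝ} (hu : AEStronglyMeasurable u volume) :
    AEStronglyMeasurable (incr u) (nu n s) := by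
  refine ⟨incr (hu.mk u), ?_, incr_ae_congr hu.ae_eq_mk⟩
  exact (incr_measurable hu.stronglyMeasurable_mk.measurable).stronglyMeasurable

theorem hsNormSq_eq (hn : 1 ≤ n) (hs : 0 < s) (u : Space n → ℝ) :
    hsNormSq s u = (∫⁻ x, ENNReal.ofReal (u x ^ 2)) +
      ∫⁻ p, ENNReal.ofReal (incr u p ^ 2) ∂(nu n s) := by
  unfold hsNormSq nu
  rw [lintegral_withDensity_eq_lintegral_mul_non_measurable _ measurable_nu_density
    (ae_of_all _ fun _ => ENNReal.ofReal_lt_top)]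
  simp only [enorm_sq_eq_ofReal]
  congr 1
  refine lintegral_congr fun p => ?_
  simp only [Pi.mul_apply, incr]
  have hpos : (0 : ℝ) < (n : ℝ) + 2 * s := by positivity
  rcases eq_or_ne p.1 p.2 with h | h
  · simp [h]
  · have : 0 < ‖p.1 - p.2‖ ^ ((n : ℝ) + 2 * s) :=
      Real.rpow_pos_of_pos (norm_pos_iff.2 (sub_ne_zero.2 h)) _
    rw [ENNReal.div_eq_inv_mul, ENNReal.ofReal_inv_of_pos this]

theorem bilinForm_eq (K : Space n → Space n → ℝ) (u v : Space n → ℝ) :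
    bilinForm s K u v = ∫ p, K p.1 p.2 * (incr u p * incr v p) ∂(nu n s) := by
  unfold bilinForm nu
  rw [integral_withDensity_eq_integral_toReal_smul measurable_nu_density
    (ae_of_all _ fun _ => ENNReal.ofReal_lt_top)]
  refine integral_congr_ae (ae_of_all _ fun p => ?_)
  simp only [incr, smul_eq_mul]
  rw [ENNReal.toReal_ofReal (by positivity), div_eq_inv_mul]

/-- The integral of a radial weight against `|z|^(-n-2s)`. -/
noncomputable def radialMass (n : ℕ) (s : ℝ) (θ : ℝ → ℝ) : ℝ≥0∞ :=
  ∫⁻ z : Space n, ENNReal.ofReal (θ ‖z‖) * ENNReal.ofReal ((‖z‖ ^ ((n : ℝ) + 2 * s))⁻¹)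

theorem lintegral_radial_fst {θ : ℝ → ℝ} (hθ : Measurable θ) {U : Space n → ℝ≥0∞}
    (hU : AEMeasurable U volume) :
    ∫⁻ p, ENNReal.ofReal (θ ‖p.1 - p.2‖) * U p.1 ∂(nu n s) =
      radialMass n s θ * ∫⁻ x, U x := by
  unfold nu
  rw [lintegral_withDensity_eq_lintegral_mul_non_measurable _ measurable_nu_density
    (ae_of_all _ fun _ => ENNReal.ofReal_lt_top), Measure.volume_eq_prod, lintegral_prod]
  · rw [← lintegral_const_mul'' _ hU]
    refine lintegral_congr fun x => ?_
    have h : ∫⁻ y : Space n, U x * (ENNReal.ofReal (θ ‖x - y‖) *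
        ENNReal.ofReal ((‖x - y‖ ^ ((n : ℝ) + 2 * s))⁻¹)) = U x * radialMass n s θ :=
      (lintegral_sub_left_eq_self (fun z => U x * (ENNReal.ofReal (θ ‖z‖) *
        ENNReal.ofReal ((‖z‖ ^ ((n : ℝ) + 2 * s))⁻¹))) x).trans
        (lintegral_const_mul _ (by fun_prop))
    rw [mul_comm (radialMass n s θ), ← h]
    refine lintegral_congr fun y => ?_
    simp only [Pi.mul_apply]
    ring
  · refine AEMeasurable.mul measurable_nu_density.aemeasurable (AEMeasurable.mul ?_ ?_)
    · fun_prop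
    · exact hU.comp_quasiMeasurePreserving Measure.quasiMeasurePreserving_fst

theorem lintegral_radial_snd {θ : ℝ → ℝ} (hθ : Measurable θ) {U : Space n → ℝ≥0∞}
    (hU : AEMeasurable U volume) :
    ∫⁻ p, ENNReal.ofReal (θ ‖p.1 - p.2‖) * U p.2 ∂(nu n s) =
      radialMass n s θ * ∫⁻ x, U x := by
  unfold nu
  rw [lintegral_withDensity_eq_lintegral_mul_non_measurable _ measurable_nu_density
    (ae_of_all _ fun _ => ENNReal.ofReal_lt_top), Measure.volume_eq_prod, lintegral_prod_symm]
  · rw [← lintegral_const_mul'' _ hU]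
    refine lintegral_congr fun x => ?_
    have h : ∫⁻ y : Space n, U x * (ENNReal.ofReal (θ ‖y - x‖) *
        ENNReal.ofReal ((‖y - x‖ ^ ((n : ℝ) + 2 * s))⁻¹)) = U x * radialMass n s θ :=
      (lintegral_sub_right_eq_self (fun z => U x * (ENNReal.ofReal (θ ‖z‖) *
        ENNReal.ofReal ((‖z‖ ^ ((n : ℝ) + 2 * s))⁻¹))) x).trans
        (lintegral_const_mul _ (by fun_prop))
    rw [mul_comm (radialMass n s θ), ← h]
    refine lintegral_congr fun y => ?_
    simp only [Pi.mul_apply]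
    ring
  · refine AEMeasurable.mul measurable_nu_density.aemeasurable (AEMeasurable.mul ?_ ?_)
    · fun_prop
    · exact hU.comp_quasiMeasurePreserving Measure.quasiMeasurePreserving_snd

/-- In polar coordinates the integrand is `r^{1-2s}` near the origin, integrable because `s < 1`,
and `r^{-1-2s}` at infinity, integrable because `s > 0`. -/
theorem integrable_radial_min (hn : 1 ≤ n) (hs : 0 < s) (hs1 : s < 1) :
    Integrable fun z : Space n => min 1 ‖z‖ ^ 2 * (‖z‖ ^ ((n : ℝ) + 2 * s))⁻¹ := by
  have : Nontrivial (Space n) := by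
    have : Nonempty (Fin n) := ⟨⟨0, hn⟩⟩
    infer_instance
  refine (integrable_fun_norm_addHaar (volume : Measure (Space n))
    (f := fun r => min 1 r ^ 2 * (r ^ ((n : ℝ) + 2 * s))⁻¹)).2 ?_
  have hfin : Module.finrank ℝ (Space n) = n := by simp
  rw [hfin, ← Ioc_union_Ioi_eq_Ioi zero_le_one]
  have key : ∀ y : ℝ, 0 < y → y ^ (n - 1) * (y ^ ((n : ℝ) + 2 * s))⁻¹ = y ^ (-1 - 2 * s) := by
    intro y hy
    rw [← Real.rpow_natCast, ← Real.rpow_neg hy.le, ← Real.rpow_add hy, Nat.cast_sub hn]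
    congr 1
    push_cast
    ring
  refine IntegrableOn.union ?_ ?_
  · have h : IntegrableOn (fun y : ℝ => y ^ (1 - 2 * s)) (Ioc 0 1) := by
      have := (intervalIntegral.intervalIntegrable_rpow' (a := 0) (b := 1)
        (r := 1 - 2 * s) (by linarith))
      rwa [intervalIntegrable_iff_integrableOn_Ioc_of_le zero_le_one] at this
    refine h.congr_fun (fun y hy => ?_) measurableSet_Ioc
    have h2 : y ^ (1 - 2 * s) = y ^ 2 * y ^ (-1 - 2 * s) := by
      rw [← Real.rpow_natCast, ← Real.rpow_add hy.1]
      congr 1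
      push_cast
      ring
    simp only [smul_eq_mul]
    rw [min_eq_right hy.2, h2, ← key y hy.1]
    ring
  · have h : IntegrableOn (fun y : ℝ => y ^ (-1 - 2 * s)) (Ioi 1) :=
      integrableOn_Ioi_rpow_of_lt (by linarith) zero_lt_one
    refine h.congr_fun (fun y hy => ?_) measurableSet_Ioi
    have hy' : (1 : ℝ) < y := hy
    simp only [smul_eq_mul]
    rw [min_eq_left hy'.le, ← key y (by linarith)]
    ring

theorem radialMass_min_lt_top (hn : 1 ≤ n) (hs : 0 < s) (hs1 : s < 1) :
    radialMass n s (fun r => min 1 r ^ 2) < ⊤ := by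
  have h := (integrable_radial_min hn hs hs1).lintegral_lt_top
  refine lt_of_le_of_lt (le_of_eq ?_) h
  refine lintegral_congr fun z => ?_
  rw [ENNReal.ofReal_mul (by positivity)]

/-- Dominated convergence, with the integrable weight for `min 1 r` as majorant. It measures the
`H^s` error of mollification at scale `ε`. -/
theorem tendsto_radialMass_min (hn : 1 ≤ n) (hs : 0 < s) (hs1 : s < 1) :
    Filter.Tendsto (fun ε : ℝ => radialMass n s (fun r => min ε (min 1 r) ^ 2))
      (nhdsWithin 0 (Ioi 0)) (nhds 0) := by
  have h0 : (0 : ℝ≥0∞) = ∫⁻ _ : Space n, 0 := by simp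
  rw [h0]
  refine tendsto_lintegral_filter_of_dominated_convergence
    (fun z => ENNReal.ofReal (min 1 ‖z‖ ^ 2) * ENNReal.ofReal ((‖z‖ ^ ((n : ℝ) + 2 * s))⁻¹))
    (Filter.Eventually.of_forall fun ε => by fun_prop) ?_
    (radialMass_min_lt_top hn hs hs1).ne ?_
  · filter_upwards [self_mem_nhdsWithin] with ε hε
    refine ae_of_all _ fun z => ?_
    have hε' : (0 : ℝ) < ε := hε
    have h1 : min ε (min 1 ‖z‖) ≤ min 1 ‖z‖ := min_le_right _ _
    have h2 : 0 ≤ min ε (min 1 ‖z‖) := by positivity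
    gcongr
  · refine ae_of_all _ fun z => ?_
    have h1 : Filter.Tendsto (fun ε : ℝ => ENNReal.ofReal (min ε (min 1 ‖z‖) ^ 2))
        (nhdsWithin 0 (Ioi 0)) (nhds 0) := by
      have : Filter.Tendsto (fun ε : ℝ => ENNReal.ofReal (min ε (min 1 ‖z‖) ^ 2))
          (nhds 0) (nhds (ENNReal.ofReal (min 0 (min 1 ‖z‖) ^ 2))) := by
        refine Continuous.tendsto ?_ 0
        exact ENNReal.continuous_ofReal.comp (by fun_prop)
      have h2 : min 0 (min 1 ‖z‖) = 0 := min_eq_left (by positivity)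
      rw [h2] at this
      simp only [ne_eq, OfNat.ofNat_ne_zero, not_false_eq_true, zero_pow,
        ENNReal.ofReal_zero] at this
      exact this.mono_left nhdsWithin_le_nhds
    have := ENNReal.Tendsto.mul_const (b := ENNReal.ofReal ((‖z‖ ^ ((n : ℝ) + 2 * s))⁻¹)) h1
      (Or.inr ENNReal.ofReal_ne_top)
    simpa using this

theorem radialMass_const_mul (c : ℝ) (θ : ℝ → ℝ) :
    radialMass n s (fun r => (c * θ r) ^ 2) =
      ENNReal.ofReal (c ^ 2) * radialMass n s (fun r => θ r ^ 2) := by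
  unfold radialMass
  rw [← lintegral_const_mul' _ _ ENNReal.ofReal_ne_top]
  refine lintegral_congr fun z => ?_
  simp only [mul_pow]
  rw [ENNReal.ofReal_mul (by positivity), mul_assoc]

theorem add_quarter_lt {ε a b : ℝ≥0∞} (ha : a < ε / 4) (hb : b < ε / 4) :
    2 * a + 2 * b < ε := by
  have h6 : ∀ a : ℝ≥0∞, a < ε / 4 → 2 * a < ε / 2 := by
    intro a ha
    have : 2 * (ε / 4) = ε / 2 := by
      rw [show (4 : ℝ≥0∞) = 2 * 2 by norm_num, ENNReal.div_eq_inv_mul, ENNReal.div_eq_inv_mul,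
        ENNReal.mul_inv (by simp) (by simp), ← mul_assoc, ← mul_assoc,
        ENNReal.mul_inv_cancel (by simp) (by simp), one_mul]
    rw [← this]
    exact ENNReal.mul_lt_mul_right (by simp) (by simp) ha
  calc _ < ε / 2 + ε / 2 := ENNReal.add_lt_add (h6 _ ha) (h6 _ hb)
    _ = ε := ENNReal.add_halves ε

/-- `b` is bounded by `A` and `|b x - b y| ≤ A min(1, |x - y|)`. -/
structure IsBddLip (A : ℝ) (b : Space n → ℝ) : Prop where
  bound : ∀ x, |b x| ≤ A
  lip : ∀ x y, |b x - b y| ≤ A * min 1 ‖x - y‖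

theorem IsBddLip.nonneg {A : ℝ} {b : Space n → ℝ} (h : IsBddLip A b) : 0 ≤ A :=
  (abs_nonneg _).trans (h.bound 0)

theorem IsBddLip.continuous {A : ℝ} {b : Space n → ℝ} (h : IsBddLip A b) : Continuous b := by
  refine (LipschitzWith.of_dist_le_mul (K := ⟨A, h.nonneg⟩) fun x y => ?_).continuous
  rw [Real.dist_eq, dist_eq_norm]
  exact (h.lip x y).trans (mul_le_mul_of_nonneg_left (min_le_right _ _) h.nonneg)

theorem incr_mul (b u : Space n → ℝ) (p : Space n × Space n) :
    incr (fun x => b x * u x) p = b p.1 * incr u p + incr b p * u p.2 := by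
  simp only [incr]; ring

theorem IsBddLip.incr_sq_le {A : ℝ} {b : Space n → ℝ} (h : IsBddLip A b)
    (p : Space n × Space n) : incr b p ^ 2 ≤ A ^ 2 * min 1 ‖p.1 - p.2‖ ^ 2 := by
  rw [← mul_pow, ← sq_abs]
  exact pow_le_pow_left₀ (abs_nonneg _) (h.lip _ _) 2

theorem IsBddLip.incr_mul_sq_le {A : ℝ} {b : Space n → ℝ} (h : IsBddLip A b) (u : Space n → ℝ)
    (p : Space n × Space n) : incr (fun x => b x * u x) p ^ 2 ≤
      2 * A ^ 2 * (incr u p ^ 2 + min 1 ‖p.1 - p.2‖ ^ 2 * u p.2 ^ 2) := by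
  rw [incr_mul]
  have h1 : b p.1 ^ 2 ≤ A ^ 2 := sq_le_sq' (by linarith [abs_le.1 (h.bound p.1)])
    (abs_le.1 (h.bound p.1)).2
  have h2 := h.incr_sq_le p
  have h3 := mul_le_mul_of_nonneg_right h1 (sq_nonneg (incr u p))
  have h4 := mul_le_mul_of_nonneg_right h2 (sq_nonneg (u p.2))
  nlinarith [sq_nonneg (b p.1 * incr u p - incr b p * u p.2)]

theorem lintegral_radial_mul_sq {u : Space n → ℝ} (hu : AEStronglyMeasurable u volume) :
    ∫⁻ p, ENNReal.ofReal (min 1 ‖p.1 - p.2‖ ^ 2 * u p.2 ^ 2) ∂(nu n s) =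
      radialMass n s (fun r => min 1 r ^ 2) * ∫⁻ x, ENNReal.ofReal (u x ^ 2) := by
  rw [← lintegral_radial_snd (by fun_prop) (by
    exact (hu.aemeasurable.pow_const 2).ennreal_ofReal)]
  refine lintegral_congr fun p => ?_
  rw [ENNReal.ofReal_mul (by positivity)]

/-- The increment of `b u` splits as `b(x) (u(x)-u(y)) + (b(x)-b(y)) u(y)`. The second part carries
the weight `min(1,|x-y|)²`, whose radial mass turns it into a multiple of the `L²` norm. -/
theorem IsBddLip.hsNormSq_mul_le (hn : 1 ≤ n) (hs : 0 < s) {A : ℝ} {b : Space n → ℝ}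
    (h : IsBddLip A b) {u : Space n → ℝ} (hu : AEStronglyMeasurable u volume) :
    hsNormSq s (fun x => b x * u x) ≤ ENNReal.ofReal (2 * A ^ 2) *
      (1 + radialMass n s (fun r => min 1 r ^ 2)) * hsNormSq s u := by
  rw [hsNormSq_eq hn hs, hsNormSq_eq hn hs]
  have h1 : ∫⁻ x, ENNReal.ofReal ((b x * u x) ^ 2) ≤
      ENNReal.ofReal (2 * A ^ 2) * ∫⁻ x, ENNReal.ofReal (u x ^ 2) := by
    rw [← lintegral_const_mul' _ _ ENNReal.ofReal_ne_top]
    refine lintegral_mono fun x => ?_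
    rw [← ENNReal.ofReal_mul (by positivity)]
    refine ENNReal.ofReal_le_ofReal ?_
    have h1 : b x ^ 2 ≤ A ^ 2 := sq_le_sq' (by linarith [abs_le.1 (h.bound x)])
      (abs_le.1 (h.bound x)).2
    nlinarith [mul_le_mul_of_nonneg_right h1 (sq_nonneg (u x)),
      mul_nonneg (sq_nonneg A) (sq_nonneg (u x))]
  have h2 : ∫⁻ p, ENNReal.ofReal (incr (fun x => b x * u x) p ^ 2) ∂(nu n s) ≤
      ENNReal.ofReal (2 * A ^ 2) * (∫⁻ p, ENNReal.ofReal (incr u p ^ 2) ∂(nu n s) +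
        radialMass n s (fun r => min 1 r ^ 2) * ∫⁻ x, ENNReal.ofReal (u x ^ 2)) := by
    rw [← lintegral_radial_mul_sq hu, ← lintegral_add_left' ((incr_aestronglyMeasurable
      hu).aemeasurable.pow_const 2).ennreal_ofReal,
      ← lintegral_const_mul' _ _ ENNReal.ofReal_ne_top]
    refine lintegral_mono fun p => ?_
    rw [← ENNReal.ofReal_add (by positivity) (by positivity),
      ← ENNReal.ofReal_mul (by positivity)]
    exact ENNReal.ofReal_le_ofReal (h.incr_mul_sq_le u p)
  refine (add_le_add h1 h2).trans ?_
  set c := ENNReal.ofReal (2 * A ^ 2)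
  set M := radialMass n s (fun r => min 1 r ^ 2)
  set X := ∫⁻ x, ENNReal.ofReal (u x ^ 2)
  set Y := ∫⁻ p, ENNReal.ofReal (incr u p ^ 2) ∂(nu n s)
  calc c * X + c * (Y + M * X) ≤ c * X + c * (Y + M * X) + c * M * Y := le_self_add
    _ = c * (1 + M) * (X + Y) := by ring

theorem hsNormSq_add_le (hn : 1 ≤ n) (hs : 0 < s) {u v : Space n → ℝ}
    (hu : AEStronglyMeasurable u volume) :
    hsNormSq s (fun x => u x + v x) ≤ 2 * hsNormSq s u + 2 * hsNormSq s v := by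
  have key : ∀ {Z : Type} [MeasurableSpace Z] (μ : Measure Z) (f g : Z → ℝ),
      AEMeasurable f μ → ∫⁻ z, ENNReal.ofReal ((f z + g z) ^ 2) ∂μ ≤
        2 * ∫⁻ z, ENNReal.ofReal (f z ^ 2) ∂μ + 2 * ∫⁻ z, ENNReal.ofReal (g z ^ 2) ∂μ := by
    intro Z _ μ f g hf
    rw [← lintegral_const_mul' _ _ ENNReal.ofNat_ne_top,
      ← lintegral_const_mul' _ _ ENNReal.ofNat_ne_top,
      ← lintegral_add_left' ((hf.pow_const 2).ennreal_ofReal.const_mul 2)]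
    refine lintegral_mono fun z => ?_
    rw [show (2 : ℝ≥0∞) = ENNReal.ofReal 2 by simp, ← ENNReal.ofReal_mul (by positivity),
      ← ENNReal.ofReal_mul (by positivity), ← ENNReal.ofReal_add (by positivity) (by positivity)]
    exact ENNReal.ofReal_le_ofReal (by nlinarith [sq_nonneg (f z - g z)])
  rw [hsNormSq_eq hn hs, hsNormSq_eq hn hs, hsNormSq_eq hn hs]
  have h1 := key volume u v hu.aemeasurable
  have h2 := key (nu n s) (incr u) (incr v) (incr_aestronglyMeasurable hu).aemeasurable
  have h3 : ∀ p, incr (fun x => u x + v x) p = incr u p + incr v p := by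
    intro p; simp only [incr]; ring
  simp only [h3]
  refine (add_le_add h1 h2).trans (le_of_eq ?_)
  ring

theorem hsNormSq_congr {u v : Space n → ℝ} (hn : 1 ≤ n) (hs : 0 < s) (h : u =ᵐ[volume] v) :
    hsNormSq s u = hsNormSq s v := by
  rw [hsNormSq_eq hn hs, hsNormSq_eq hn hs]
  congr 1
  · exact lintegral_congr_ae (h.mono fun x hx => by simp only [hx])
  · exact lintegral_congr_ae ((incr_ae_congr h).mono fun x hx => by simp only [hx])

theorem memLp_two_iff {Z : Type*} [MeasurableSpace Z] {μ : Measure Z} {f : Z → ℝ}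
    (hf : AEStronglyMeasurable f μ) :
    MemLp f 2 μ ↔ ∫⁻ z, ENNReal.ofReal (f z ^ 2) ∂μ < ⊤ := by
  rw [memLp_two_iff_integrable_sq hf, ← lintegral_ofReal_ne_top_iff_integrable (f := fun z => f z ^ 2)
    (hf.pow 2) (ae_of_all _ fun z => sq_nonneg _), lt_top_iff_ne_top]

theorem hsNormSq_lt_top_iff (hn : 1 ≤ n) (hs : 0 < s) {u : Space n → ℝ}
    (hu : AEStronglyMeasurable u volume) :
    hsNormSq s u < ⊤ ↔ MemLp u 2 volume ∧ MemLp (incr u) 2 (nu n s) := by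
  rw [hsNormSq_eq hn hs, ENNReal.add_lt_top, memLp_two_iff hu,
    memLp_two_iff (incr_aestronglyMeasurable hu)]

end NPME

/-! ### The space `H̃^s(Ω)`: mollification, multipliers and the Poincaré inequality. -/

namespace NPME

variable {n : ℕ} {s : ℝ}

theorem IsBddLip.of_lipschitz {M L : ℝ} {b : Space n → ℝ} (hM : ∀ x, |b x| ≤ M)
    (hL : ∀ x y, |b x - b y| ≤ L * ‖x - y‖) : IsBddLip (max (2 * M) L) b := by
  have hM0 : 0 ≤ M := (abs_nonneg _).trans (hM 0)
  have h0 : 0 ≤ max (2 * M) L := le_max_of_le_left (by positivity)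
  refine ⟨fun x => ?_, fun x y => ?_⟩
  · exact (hM x).trans ((by linarith : M ≤ 2 * M).trans (le_max_left _ _))
  · rcases le_total 1 ‖x - y‖ with h | h
    · rw [min_eq_left h, mul_one]
      refine le_trans ?_ (le_max_left _ _)
      have := abs_sub (b x) (b y)
      linarith [hM x, hM y]
    · rw [min_eq_right h]
      exact (hL x y).trans (mul_le_mul_of_nonneg_right (le_max_right _ _) (norm_nonneg _))

theorem IsBddLip.mul {A B : ℝ} {b c : Space n → ℝ} (hb : IsBddLip A b) (hc : IsBddLip B c) :
    IsBddLip (2 * A * B) fun x => b x * c x := by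
  have hA := hb.nonneg
  have hB := hc.nonneg
  refine ⟨fun x => ?_, fun x y => ?_⟩
  · rw [abs_mul]
    have := mul_le_mul (hb.bound x) (hc.bound x) (abs_nonneg _) hA
    nlinarith [mul_nonneg hA hB]
  · have h : b x * c x - b y * c y = b x * (c x - c y) + (b x - b y) * c y := by ring
    rw [h]
    refine (abs_add_le _ _).trans ?_
    rw [abs_mul, abs_mul]
    have h1 := mul_le_mul (hb.bound x) (hc.lip x y) (abs_nonneg _) hA
    have h2 := mul_le_mul (hb.lip x y) (hc.bound y) (abs_nonneg _) (by positivity)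
    linarith

theorem exists_isBddLip_of_contDiff {f : Space n → ℝ} (hf : ContDiff ℝ ∞ f)
    (hc : HasCompactSupport f) : ∃ A, IsBddLip A f := by
  obtain ⟨L, hL⟩ := ContDiff.lipschitzWith_of_hasCompactSupport hc hf (by simp)
  obtain ⟨M, hM⟩ := hc.exists_bound_of_continuous hf.continuous
  refine ⟨_, IsBddLip.of_lipschitz (M := M) (L := L) hM fun x y => ?_⟩
  have := hL.dist_le_mul x y
  rwa [Real.dist_eq, dist_eq_norm] at this

/-- An increment of `f` is nonzero only if one of its two points lies in `S`. Integrating the radial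
bound over the other point gives the mass of `θ²`, and the two cases account for the factor 2. -/
theorem hsNormSq_le_of_support (hn : 1 ≤ n) (hs : 0 < s) {f : Space n → ℝ} {S : Set (Space n)}
    (hS : MeasurableSet S) {M : ℝ} {θ : ℝ → ℝ} (hθ : Measurable θ)
    (hM : ∀ x, |f x| ≤ M) (hf : ∀ x ∉ S, f x = 0)
    (hincr : ∀ p, |incr f p| ≤ θ ‖p.1 - p.2‖) :
    hsNormSq s f ≤
      (ENNReal.ofReal (M ^ 2) + 2 * radialMass n s fun r => θ r ^ 2) * volume S := by
  rw [hsNormSq_eq hn hs, add_mul]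
  have hind : ∫⁻ x, S.indicator (fun _ => (1 : ℝ≥0∞)) x = volume S := by
    rw [lintegral_indicator hS]; simp
  have hm : Measurable (S.indicator fun _ => (1 : ℝ≥0∞)) := measurable_const.indicator hS
  have hθ2 : Measurable fun r => θ r ^ 2 := hθ.pow_const 2
  refine add_le_add ?_ ?_
  · rw [← hind, ← lintegral_const_mul' _ _ ENNReal.ofReal_ne_top]
    refine lintegral_mono fun x => ?_
    by_cases hx : x ∈ S
    · simp only [hx, indicator_of_mem, mul_one]
      refine ENNReal.ofReal_le_ofReal ?_
      rw [← sq_abs]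
      exact pow_le_pow_left₀ (abs_nonneg _) (hM x) 2
    · simp [hf x hx]
  · have e1 := lintegral_radial_fst (s := s) hθ2 hm.aemeasurable
    have e2 := lintegral_radial_snd (s := s) hθ2 hm.aemeasurable
    rw [hind] at e1 e2
    have e3 : 2 * ((radialMass n s fun r => θ r ^ 2) * volume S) =
        ∫⁻ p, (ENNReal.ofReal (θ ‖p.1 - p.2‖ ^ 2) * S.indicator (fun _ => (1 : ℝ≥0∞)) p.1 +
        ENNReal.ofReal (θ ‖p.1 - p.2‖ ^ 2) * S.indicator (fun _ => (1 : ℝ≥0∞)) p.2) ∂(nu n s) := by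
      rw [lintegral_add_left (by fun_prop), e1, e2, two_mul]
    rw [mul_assoc, e3]
    refine lintegral_mono fun p => ?_
    have h1 : ENNReal.ofReal (incr f p ^ 2) ≤ ENNReal.ofReal (θ ‖p.1 - p.2‖ ^ 2) := by
      refine ENNReal.ofReal_le_ofReal ?_
      rw [← sq_abs]
      exact pow_le_pow_left₀ (abs_nonneg _) (hincr p) 2
    by_cases hx : p.1 ∈ S
    · simp only [hx, indicator_of_mem, mul_one]
      exact h1.trans le_self_add
    · by_cases hy : p.2 ∈ S
      · simp only [hy, indicator_of_mem, mul_one]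
        exact h1.trans le_add_self
      · simp [incr, hf _ hx, hf _ hy]

theorem IsBddLip.hsNormSq_lt_top (hn : 1 ≤ n) (hs : 0 < s) (hs1 : s < 1) {A : ℝ}
    {f : Space n → ℝ} (hf : IsBddLip A f) (hc : HasCompactSupport f) : hsNormSq s f < ⊤ := by
  refine (hsNormSq_le_of_support hn hs (isClosed_tsupport f).measurableSet
    (θ := fun r => A * min 1 r) (by fun_prop) hf.bound
    (fun x hx => image_eq_zero_of_notMem_tsupport hx) fun p => hf.lip _ _).trans_lt ?_
  refine ENNReal.mul_lt_top (ENNReal.add_lt_top.2 ⟨ENNReal.ofReal_lt_top, ?_⟩)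
    (IsCompact.measure_lt_top hc)
  refine ENNReal.mul_lt_top (by simp) ?_
  rw [radialMass_const_mul]
  exact ENNReal.mul_lt_top ENNReal.ofReal_lt_top (radialMass_min_lt_top hn hs hs1)

open scoped Convolution in
-- Averaging against a probability density keeps the constant `A`, uniformly in `ε`. This
-- uniformity, and not only the sup-norm closeness, is what makes the `H^s` error small.
theorem IsBddLip.exists_mollification {A : ℝ} {f : Space n → ℝ} (hf : IsBddLip A f) {ε : ℝ}
    (hε : 0 < ε) : ∃ ψ : Space n → ℝ, ContDiff ℝ ∞ ψ ∧
      (∀ x, |f x - ψ x| ≤ A * ε) ∧ IsBddLip A ψ ∧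
      (∀ x, x ∉ Metric.cthickening ε (tsupport f) → ψ x = 0) := by
  let φ : ContDiffBump (0 : Space n) := ⟨ε / 2, ε, by positivity, by linarith⟩
  let ψ : Space n → ℝ := φ.normed volume ⋆[ContinuousLinearMap.lsmul ℝ ℝ, volume] f
  have hfc := hf.continuous
  have hint : ∀ x, Integrable fun t => φ.normed volume t * f (x - t) := fun x =>
    (φ.continuous_normed.mul (by fun_prop)).integrable_of_hasCompactSupport
      φ.hasCompactSupport_normed.mul_right
  have hψ : ∀ x, ψ x = ∫ t, φ.normed volume t * f (x - t) := fun x => rfl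
  refine ⟨ψ, ?_, fun x => ?_, ⟨fun x => ?_, fun x y => ?_⟩, fun x hx => ?_⟩
  · exact φ.hasCompactSupport_normed.contDiff_convolution_left _ φ.contDiff_normed
      hfc.locallyIntegrable
  · rw [abs_sub_comm, ← Real.dist_eq]
    refine φ.dist_normed_convolution_le hfc.aestronglyMeasurable fun y hy => ?_
    rw [Real.dist_eq]
    refine (hf.lip _ _).trans (mul_le_mul_of_nonneg_left ?_ hf.nonneg)
    rw [← dist_eq_norm]
    exact (min_le_right _ _).trans (Metric.mem_ball.1 hy).le
  · rw [hψ, ← Real.norm_eq_abs]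
    calc ‖∫ t, φ.normed volume t * f (x - t)‖ ≤ ∫ t, φ.normed volume t * A := by
          refine norm_integral_le_of_norm_le (μ := volume) (φ.integrable_normed.mul_const A)
            (ae_of_all _ fun t => ?_)
          rw [Real.norm_eq_abs, abs_mul, abs_of_nonneg (φ.nonneg_normed t)]
          exact mul_le_mul_of_nonneg_left (hf.bound _) (φ.nonneg_normed t)
      _ = A := by rw [integral_mul_const, φ.integral_normed, one_mul]
  · rw [hψ, hψ, ← integral_sub (hint x) (hint y), ← Real.norm_eq_abs]
    calc ‖∫ t, φ.normed volume t * f (x - t) - φ.normed volume t * f (y - t)‖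
        ≤ ∫ t, φ.normed volume t * (A * min 1 ‖x - y‖) := by
          refine norm_integral_le_of_norm_le (μ := volume) (φ.integrable_normed.mul_const _)
            (ae_of_all _ fun t => ?_)
          rw [Real.norm_eq_abs, ← mul_sub, abs_mul, abs_of_nonneg (φ.nonneg_normed t)]
          refine mul_le_mul_of_nonneg_left ?_ (φ.nonneg_normed t)
          have := hf.lip (x - t) (y - t)
          rwa [sub_sub_sub_cancel_right] at this
      _ = A * min 1 ‖x - y‖ := by rw [integral_mul_const, φ.integral_normed, one_mul]
  · have h0 : ∀ y ∈ Metric.ball x ε, f y = 0 := by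
      intro y hy
      by_contra h
      refine hx (Metric.mem_cthickening_of_dist_le x y ε _ (subset_tsupport f h) ?_)
      rw [dist_comm]; exact (Metric.mem_ball.1 hy).le
    have hfx := h0 x (Metric.mem_ball_self hε)
    have := φ.dist_normed_convolution_le (μ := volume) (x₀ := x) (ε := 0) (g := f)
      hfc.aestronglyMeasurable (fun y hy => by rw [h0 y hy, hfx, dist_self])
    rw [hfx] at this
    exact dist_le_zero.1 this

/-- Mollifications at scale `ε` are test functions once `ε` is below the distance from the support
to the complement of `Ω`, and they converge in `H^s` by `tendsto_radialMass_min`. -/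
theorem IsBddLip.memHsTilde (hn : 1 ≤ n) (hs : 0 < s) (hs1 : s < 1) {Ω : Set (Space n)}
    (hΩ : IsOpen Ω) {A : ℝ} {f : Space n → ℝ} (hf : IsBddLip A f) (hc : HasCompactSupport f)
    (hsupp : tsupport f ⊆ Ω) : MemHsTilde s Ω f := by
  refine ⟨hf.continuous.aestronglyMeasurable, fun η hη => ?_⟩
  have hc' : IsCompact (tsupport f) := hc
  obtain ⟨δ, hδ, hδΩ⟩ := hc'.exists_cthickening_subset_open hΩ hsupp
  set S := Metric.cthickening δ (tsupport f) with hS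
  have hScomp : IsCompact S := hc'.cthickening
  have hvol : volume S ≠ ⊤ := hScomp.measure_lt_top.ne
  have hlim : Filter.Tendsto (fun ε : ℝ => (ENNReal.ofReal ((A * ε) ^ 2) +
      2 * (ENNReal.ofReal ((2 * A) ^ 2) * radialMass n s (fun r => min ε (min 1 r) ^ 2))) *
        volume S) (nhdsWithin 0 (Ioi 0)) (nhds 0) := by
    have h1 : Filter.Tendsto (fun ε : ℝ => ENNReal.ofReal ((A * ε) ^ 2))
        (nhdsWithin 0 (Ioi 0)) (nhds 0) := by
      have : Continuous fun ε : ℝ => ENNReal.ofReal ((A * ε) ^ 2) :=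
        ENNReal.continuous_ofReal.comp (by fun_prop)
      have h := this.tendsto 0
      simp only [mul_zero, ne_eq, OfNat.ofNat_ne_zero, not_false_eq_true, zero_pow,
        ENNReal.ofReal_zero] at h
      exact h.mono_left nhdsWithin_le_nhds
    have h2 := ENNReal.Tendsto.const_mul (a := 2) (ENNReal.Tendsto.const_mul
      (a := ENNReal.ofReal ((2 * A) ^ 2)) (tendsto_radialMass_min hn hs hs1)
      (Or.inr ENNReal.ofReal_ne_top)) (Or.inr ENNReal.ofNat_ne_top)
    have h3 := ENNReal.Tendsto.mul_const (b := volume S) (h1.add h2) (Or.inr hvol)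
    simpa using h3
  have hev : ∀ᶠ ε : ℝ in nhdsWithin 0 (Ioi 0), ε < δ :=
    nhdsWithin_le_nhds (Iio_mem_nhds hδ)
  obtain ⟨ε, ⟨hε1, hε2⟩, hε0⟩ := ((hlim.eventually (gt_mem_nhds hη)).and hev |>.and
    self_mem_nhdsWithin).exists
  have hε0 : 0 < ε := hε0
  obtain ⟨ψ, hψ1, hψ2, hψ3, hψ4⟩ := hf.exists_mollification hε0
  have hzero : ∀ x ∉ S, ψ x = 0 := fun x hx =>
    hψ4 x fun h => hx (Metric.cthickening_mono hε2.le _ h)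
  have hts : tsupport ψ ⊆ S := closure_minimal
    (fun x hx => by by_contra h; exact hx (hzero x h)) Metric.isClosed_cthickening
  refine ⟨ψ, hψ1, hScomp.of_isClosed_subset (isClosed_tsupport _) hts, hts.trans hδΩ,
    lt_of_le_of_lt ?_ hε1⟩
  -- An increment of `f - ψ` has two bounds: `2Aε`, from closeness at both points, and `2A
  -- min(1,|x-y|)`, from the Lipschitz bounds of `f` and `ψ`. Their minimum is the radial majorant
  -- `θ`.
  refine (hsNormSq_le_of_support hn hs hScomp.measurableSet (M := A * ε)
    (θ := fun r => 2 * A * min ε (min 1 r)) (by fun_prop) hψ2 (fun x hx => ?_)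
    fun p => ?_).trans (le_of_eq ?_)
  · rw [hzero x hx, sub_zero]
    exact image_eq_zero_of_notMem_tsupport fun h =>
      hx (Metric.self_subset_cthickening _ h)
  · have h1 : incr (fun x => f x - ψ x) p = (f p.1 - f p.2) - (ψ p.1 - ψ p.2) := by
      simp only [incr]; ring
    have h2 : incr (fun x => f x - ψ x) p = (f p.1 - ψ p.1) - (f p.2 - ψ p.2) := rfl
    have hA := hf.nonneg
    rw [mul_min_of_nonneg _ _ (by positivity)]
    refine le_min ?_ ?_
    · rw [h2]
      refine (abs_sub _ _).trans ?_
      linarith [hψ2 p.1, hψ2 p.2]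
    · rw [h1]
      refine (abs_sub _ _).trans ?_
      linarith [hf.lip p.1 p.2, hψ3.lip p.1 p.2]
  · rw [radialMass_const_mul]

theorem MemHsTilde.hsNormSq_lt_top (hn : 1 ≤ n) (hs : 0 < s) (hs1 : s < 1) {Ω : Set (Space n)}
    {u : Space n → ℝ} (hu : MemHsTilde s Ω u) : hsNormSq s u < ⊤ := by
  obtain ⟨ψ, h1, h2, -, h4⟩ := hu.2 1 one_pos
  obtain ⟨A, hA⟩ := exists_isBddLip_of_contDiff h1 h2
  have h := hsNormSq_add_le (u := fun x => u x - ψ x) (v := ψ) hn hs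
    (hu.1.sub h1.continuous.aestronglyMeasurable)
  simp only [sub_add_cancel] at h
  refine h.trans_lt (ENNReal.add_lt_top.2 ⟨ENNReal.mul_lt_top (by simp) ?_,
    ENNReal.mul_lt_top (by simp) (hA.hsNormSq_lt_top hn hs hs1 h2)⟩)
  exact h4.trans (by simp)

theorem MemHsTilde.congr (hn : 1 ≤ n) (hs : 0 < s) {Ω : Set (Space n)} {u v : Space n → ℝ}
    (hu : MemHsTilde s Ω u) (h : u =ᵐ[volume] v) : MemHsTilde s Ω v := by
  refine ⟨hu.1.congr h, fun ε hε => ?_⟩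
  obtain ⟨ψ, h1, h2, h3, h4⟩ := hu.2 ε hε
  refine ⟨ψ, h1, h2, h3, ?_⟩
  have h5 : (fun x => u x - ψ x) =ᵐ[volume] fun x => v x - ψ x :=
    h.mono fun x hx => by simp only [hx]
  rwa [← hsNormSq_congr hn hs h5]

/-- A function which is approximated in `H^s` by elements of `H̃^s(Ω)` belongs to `H̃^s(Ω)`. -/
theorem MemHsTilde.of_approx (hn : 1 ≤ n) (hs : 0 < s) {Ω : Set (Space n)} {u : Space n → ℝ}
    (hu : AEStronglyMeasurable u volume)
    (h : ∀ ε : ℝ≥0∞, 0 < ε → ∃ v, MemHsTilde s Ω v ∧ hsNormSq s (fun x => u x - v x) < ε) :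
    MemHsTilde s Ω u := by
  refine ⟨hu, fun ε hε => ?_⟩
  have hε4 : 0 < ε / 4 := ENNReal.div_pos hε.ne' (by simp)
  obtain ⟨v, hv, huv⟩ := h _ hε4
  obtain ⟨ψ, h1, h2, h3, h4⟩ := hv.2 _ hε4
  refine ⟨ψ, h1, h2, h3, ?_⟩
  have h5 := hsNormSq_add_le (u := fun x => u x - v x) (v := fun x => v x - ψ x) hn hs
    (hu.sub hv.1)
  simp only [sub_add_sub_cancel] at h5
  exact h5.trans_lt (add_quarter_lt huv h4)

theorem MemHsTilde.sub (hn : 1 ≤ n) (hs : 0 < s) {Ω : Set (Space n)} {u v : Space n → ℝ}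
    (hu : MemHsTilde s Ω u) (hv : MemHsTilde s Ω v) : MemHsTilde s Ω fun x => u x - v x := by
  refine ⟨hu.1.sub hv.1, fun ε hε => ?_⟩
  have hε4 : 0 < ε / 4 := ENNReal.div_pos hε.ne' (by simp)
  obtain ⟨ψ, h1, h2, h3, h4⟩ := hu.2 _ hε4
  obtain ⟨χ, k1, k2, k3, k4⟩ := hv.2 _ hε4
  refine ⟨fun x => ψ x - χ x, h1.sub k1, h2.sub k2, (tsupport_sub _ _).trans
    (union_subset h3 k3), ?_⟩
  have h5 := hsNormSq_add_le (u := fun x => u x - ψ x) (v := fun x => -(v x - χ x)) hn hs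
    (hu.1.sub h1.continuous.aestronglyMeasurable)
  have h7 : hsNormSq s (fun x => -(v x - χ x)) = hsNormSq s (fun x => v x - χ x) := by
    rw [hsNormSq_eq hn hs, hsNormSq_eq hn hs]
    have : ∀ p, incr (fun x => -(v x - χ x)) p = - incr (fun x => v x - χ x) p := by
      intro p; simp only [incr]; ring
    simp only [this, neg_sq]
  rw [h7] at h5
  have h8 : (fun x => u x - v x - (ψ x - χ x)) = fun x => u x - ψ x + -(v x - χ x) := by
    ext x; ring
  rw [h8]
  exact h5.trans_lt (add_quarter_lt h4 k4)

/-- For a test function `ψ` close to `u`, the product `b ψ` need not be smooth, but it is Lipschitz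
with compact support in `Ω` and so lies in `H̃^s(Ω)`. Boundedness of the multiplier makes it close
to `b u`. -/
theorem MemHsTilde.mul (hn : 1 ≤ n) (hs : 0 < s) (hs1 : s < 1) {Ω : Set (Space n)}
    (hΩ : IsOpen Ω) {A : ℝ} {b : Space n → ℝ} (hb : IsBddLip A b) {u : Space n → ℝ}
    (hu : MemHsTilde s Ω u) : MemHsTilde s Ω fun x => b x * u x := by
  refine MemHsTilde.of_approx hn hs (hb.continuous.aestronglyMeasurable.mul hu.1)
    fun ε hε => ?_
  set C := ENNReal.ofReal (2 * A ^ 2) * (1 + radialMass n s (fun r => min 1 r ^ 2)) with hC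
  have hCtop : C ≠ ⊤ := ENNReal.mul_ne_top ENNReal.ofReal_ne_top
    (ENNReal.add_ne_top.2 ⟨by simp, (radialMass_min_lt_top hn hs hs1).ne⟩)
  obtain ⟨δ, hδ, hδε⟩ : ∃ δ : ℝ≥0∞, 0 < δ ∧ C * δ < ε := by
    obtain ⟨δ, hδ, h⟩ := ENNReal.exists_nnreal_pos_mul_lt hCtop hε.ne'
    exact ⟨δ, by exact_mod_cast hδ, by rwa [mul_comm]⟩
  obtain ⟨ψ, h1, h2, h3, h4⟩ := hu.2 δ hδ
  obtain ⟨B, hB⟩ := exists_isBddLip_of_contDiff h1 h2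
  refine ⟨fun x => b x * ψ x, (hb.mul hB).memHsTilde hn hs hs1 hΩ h2.mul_left
    ((tsupport_mul_subset_right).trans h3), ?_⟩
  have h5 := hb.hsNormSq_mul_le (u := fun x => u x - ψ x) hn hs
    (hu.1.sub h1.continuous.aestronglyMeasurable)
  simp only [mul_sub] at h5
  refine h5.trans_lt (lt_of_le_of_lt ?_ hδε)
  exact mul_le_mul_right h4.le C

theorem MemHsTilde.ae_eq_zero (hn : 1 ≤ n) (hs : 0 < s) {Ω : Set (Space n)}
    (hΩ : MeasurableSet Ω) {u : Space n → ℝ} (hu : MemHsTilde s Ω u) :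
    ∀ᵐ x, x ∉ Ω → u x = 0 := by
  have h0 : ∫⁻ x in Ωᶜ, ENNReal.ofReal (u x ^ 2) = 0 := by
    refine le_antisymm (le_of_forall_gt fun ε hε => ?_) bot_le
    obtain ⟨ψ, h1, h2, h3, h4⟩ := hu.2 ε hε
    refine lt_of_le_of_lt ?_ h4
    rw [hsNormSq_eq hn hs]
    refine le_trans ?_ le_self_add
    refine le_trans (le_of_eq ?_) (setLIntegral_le_lintegral Ωᶜ _)
    refine setLIntegral_congr_fun hΩ.compl fun x hx => ?_
    have : ψ x = 0 := image_eq_zero_of_notMem_tsupport fun h => hx (h3 h)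
    simp [this]
  rw [lintegral_eq_zero_iff' ((hu.1.aemeasurable.pow_const 2).ennreal_ofReal.restrict)] at h0
  rw [Filter.EventuallyEq, ae_restrict_iff' hΩ.compl] at h0
  filter_upwards [h0] with x hx hxΩ
  have := hx hxΩ
  simpa using this

/-- Poincaré inequality for functions vanishing outside a bounded set. -/
theorem exists_poincare (hn : 1 ≤ n) (hs : 0 < s) {Ω : Set (Space n)}
    (hΩ : Bornology.IsBounded Ω) : ∃ C : ℝ, 0 ≤ C ∧ ∀ u : Space n → ℝ, Measurable u →
      (∀ x ∉ Ω, u x = 0) → ∫⁻ x, ENNReal.ofReal (u x ^ 2) ≤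
        ENNReal.ofReal C * ∫⁻ p, ENNReal.ofReal (incr u p ^ 2) ∂(nu n s) := by
  have : Nontrivial (Space n) := by
    have : Nonempty (Fin n) := ⟨⟨0, hn⟩⟩
    infer_instance
  -- With `Ω` inside the ball of radius `R` about 0 and `|z| = 2R`, the ball `B(z,R)` misses `Ω`.
  -- For `x ∈ Ω` and `y ∈ B(z,R)` the increment is `u(x)` and `|x-y| ≤ 4R`, so the kernel is at
  -- least `κ` there.
  obtain ⟨R, hR0, hR⟩ := hΩ.subset_ball_lt 0 0
  obtain ⟨z, hz⟩ := exists_norm_eq (Space n) (c := 2 * R) (by positivity)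
  set κ : ℝ := ((4 * R) ^ ((n : ℝ) + 2 * s))⁻¹ with hκ
  have hκ0 : 0 < κ := by positivity
  set B := Metric.ball z R
  have hvol : volume B ≠ ⊤ := measure_ball_lt_top.ne
  have hvol0 : volume B ≠ 0 := (Metric.measure_ball_pos volume z hR0).ne'
  set c : ℝ := κ * (volume B).toReal with hc
  have hc0 : 0 < c := mul_pos hκ0 (ENNReal.toReal_pos hvol0 hvol)
  refine ⟨c⁻¹, by positivity, fun u hu hu0 => ?_⟩
  have key : ENNReal.ofReal c * ∫⁻ x, ENNReal.ofReal (u x ^ 2) ≤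
      ∫⁻ p, ENNReal.ofReal (incr u p ^ 2) ∂(nu n s) := by
    unfold nu
    rw [lintegral_withDensity_eq_lintegral_mul_non_measurable _ measurable_nu_density
      (ae_of_all _ fun _ => ENNReal.ofReal_lt_top), Measure.volume_eq_prod, lintegral_prod _
      (measurable_nu_density.mul
        ((incr_measurable hu).pow_const 2).ennreal_ofReal).aemeasurable,
      ← lintegral_const_mul' _ _ ENNReal.ofReal_ne_top]
    refine lintegral_mono fun x => ?_
    by_cases hx : x ∈ Ω
    · have hxR : ‖x‖ < R := mem_ball_zero_iff.1 (hR hx)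
      refine le_trans ?_ (setLIntegral_le_lintegral B _)
      have h1 : ENNReal.ofReal c * ENNReal.ofReal (u x ^ 2) =
          ∫⁻ _ in B, ENNReal.ofReal κ * ENNReal.ofReal (u x ^ 2) := by
        rw [setLIntegral_const, hc, ENNReal.ofReal_mul hκ0.le, ENNReal.ofReal_toReal hvol]
        ring
      rw [h1]
      refine setLIntegral_mono' measurableSet_ball fun y hy => ?_
      have hyz : ‖y - z‖ < R := by rw [← dist_eq_norm]; exact Metric.mem_ball.1 hy
      have hy1 : R < ‖y‖ := by
        have := norm_sub_norm_le z y
        rw [norm_sub_rev] at this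
        linarith
      have hy2 : ‖y‖ < 3 * R := by
        have := norm_sub_norm_le y z
        linarith
      have hyΩ : y ∉ Ω := fun h => by
        have := mem_ball_zero_iff.1 (hR h)
        linarith
      have hxy : 0 < ‖x - y‖ := norm_pos_iff.2 (sub_ne_zero.2 fun h => hyΩ (h ▸ hx))
      have hxy2 : ‖x - y‖ ≤ 4 * R := by
        have := norm_sub_le x y
        linarith
      simp only [Pi.mul_apply, incr, hu0 y hyΩ, sub_zero]
      gcongr
      rw [hκ]
      gcongr
    · simp [hu0 x hx]
  calc ∫⁻ x, ENNReal.ofReal (u x ^ 2)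
      = ENNReal.ofReal c⁻¹ * (ENNReal.ofReal c * ∫⁻ x, ENNReal.ofReal (u x ^ 2)) := by
        rw [← mul_assoc, ← ENNReal.ofReal_mul (by positivity), inv_mul_cancel₀ hc0.ne',
          ENNReal.ofReal_one, one_mul]
    _ ≤ _ := mul_le_mul_right key _

end NPME

/-! ### Weak equations in time and Fubini on a triangle. -/

namespace NPME

theorem setIntegral_Ioo_eq_indicator_left {T σ : ℝ} (hσ : σ ≤ T) (f : ℝ → ℝ) :
    ∫ τ in Ioo 0 σ, f τ = ∫ τ in Ioo 0 T, (Iio σ).indicator f τ := by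
  rw [setIntegral_indicator measurableSet_Iio]
  congr 2
  ext x
  simp only [mem_Ioo, mem_inter_iff, mem_Iio]
  grind

theorem setIntegral_Ioo_eq_indicator_right {T τ : ℝ} (hτ : 0 ≤ τ) (f : ℝ → ℝ) :
    ∫ σ in Ioo τ T, f σ = ∫ σ in Ioo 0 T, (Ioi τ).indicator f σ := by
  rw [setIntegral_indicator measurableSet_Ioi]
  congr 2
  ext x
  simp only [mem_Ioo, mem_inter_iff, mem_Ioi]
  grind

/-- Fubini's theorem on the triangle `0 < τ < σ < T`. -/
theorem integral_triangle_swap {T : ℝ} {f : ℝ → ℝ → ℝ}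
    (hf : Integrable (fun q : ℝ × ℝ => f q.1 q.2)
      ((volume.restrict (Ioo 0 T)).prod (volume.restrict (Ioo 0 T)))) :
    ∫ σ in Ioo 0 T, ∫ τ in Ioo 0 σ, f τ σ = ∫ τ in Ioo 0 T, ∫ σ in Ioo τ T, f τ σ := by
  have hS : MeasurableSet {q : ℝ × ℝ | q.1 < q.2} := measurableSet_lt measurable_fst measurable_snd
  have h1 : ∫ σ in Ioo 0 T, ∫ τ in Ioo 0 σ, f τ σ = ∫ σ in Ioo 0 T, ∫ τ in Ioo 0 T,
      {q : ℝ × ℝ | q.1 < q.2}.indicator (fun q => f q.1 q.2) (τ, σ) := by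
    refine setIntegral_congr_fun measurableSet_Ioo fun σ hσ => ?_
    exact setIntegral_Ioo_eq_indicator_left hσ.2.le _
  have h2 : ∫ τ in Ioo 0 T, ∫ σ in Ioo τ T, f τ σ = ∫ τ in Ioo 0 T, ∫ σ in Ioo 0 T,
      {q : ℝ × ℝ | q.1 < q.2}.indicator (fun q => f q.1 q.2) (τ, σ) := by
    refine setIntegral_congr_fun measurableSet_Ioo fun σ hσ => ?_
    exact setIntegral_Ioo_eq_indicator_right hσ.1.le _
  rw [h1, h2]
  exact (integral_integral_swap (f := fun τ σ =>
    {q : ℝ × ℝ | q.1 < q.2}.indicator (fun q => f q.1 q.2) (τ, σ)) (hf.indicator hS)).symm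

theorem integrable_primitive {T : ℝ} {G : ℝ → ℝ} (hG : IntegrableOn G (Ioo 0 T)) :
    IntegrableOn (fun t => ∫ r in Ioo 0 t, G r) (Ioo 0 T) := by
  have hS : MeasurableSet {q : ℝ × ℝ | q.2 < q.1} := measurableSet_lt measurable_snd measurable_fst
  have h : Integrable (fun q : ℝ × ℝ => G q.2)
      ((volume.restrict (Ioo 0 T)).prod (volume.restrict (Ioo 0 T))) := by
    simpa using (integrable_const (μ := volume.restrict (Ioo 0 T)) (1 : ℝ)).mul_prod hG
  have h2 := (h.indicator hS).integral_prod_left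
  refine h2.congr ?_
  filter_upwards [ae_restrict_mem measurableSet_Ioo] with t ht
  exact (setIntegral_Ioo_eq_indicator_left ht.2.le _).symm

/-- The primitive vanishes near `T` but need not vanish at time 0. Such tests are admissible for the
initial value problem, and they are what detects `F(0) = 0` in `ae_eq_primitive_of_weak`. -/
theorem exists_test_primitive {T : ℝ} (hT : 0 < T) {θ : ℝ → ℝ} (hθ : ContDiff ℝ ∞ θ)
    (hc : HasCompactSupport θ) (hsupp : tsupport θ ⊆ Ioo 0 T) :
    ∃ η : ℝ → ℝ, ContDiff ℝ ∞ η ∧ HasCompactSupport η ∧ tsupport η ⊆ Iio T ∧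
      (∀ t ∈ Ioo 0 T, deriv η t = θ t) ∧ ∀ t ∈ Ioo 0 T, η t = -∫ r in Ioo t T, θ r := by
  obtain ⟨t₁, ht₁, ht₁T⟩ : ∃ t₁ < T, tsupport θ ⊆ Iic t₁ := by
    rcases (tsupport θ).eq_empty_or_nonempty with h | h
    · exact ⟨T - 1, by linarith, by simp [h]⟩
    · have hm := IsCompact.sSup_mem hc h
      exact ⟨sSup (tsupport θ), (hsupp hm).2, fun x hx => le_csSup (IsCompact.bddAbove hc) hx⟩
  have hθ0 : ∀ t, t₁ < t → θ t = 0 := fun t ht =>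
    image_eq_zero_of_notMem_tsupport fun h => absurd (ht₁T h) (not_le.2 ht)
  let η₁ : ℝ → ℝ := fun t => ∫ r in T..t, θ r
  have hd : ∀ t, HasDerivAt η₁ (θ t) t := fun t =>
    intervalIntegral.integral_hasDerivAt_right (hθ.continuous.intervalIntegrable _ _)
      (hθ.continuous.stronglyMeasurableAtFilter _ _) hθ.continuous.continuousAt
  have hη₁ : ContDiff ℝ ∞ η₁ := by
    rw [contDiff_infty_iff_deriv]
    refine ⟨fun t => (hd t).differentiableAt, ?_⟩
    rwa [show deriv η₁ = θ from funext fun t => (hd t).deriv]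
  -- To the left of the support of `θ`, the primitive `η₁` is constant and possibly nonzero. The
  -- cutoff restores compact support without changing anything on `(-T, T)`.
  let ζ : ContDiffBump (0 : ℝ) := ⟨T + 1, T + 2, by linarith, by linarith⟩
  have hζ1 : ∀ t ∈ Ioo (-T) T, ζ t = 1 := fun t ht =>
    ζ.one_of_mem_closedBall (by
      rw [mem_closedBall_zero_iff, Real.norm_eq_abs]
      change |t| ≤ T + 1
      rw [abs_le]
      constructor <;> linarith [ht.1, ht.2])
  have hzero : ∀ t, t₁ < t → η₁ t = 0 := by
    intro t ht
    refine intervalIntegral.integral_zero_ae (ae_of_all _ fun r hr => hθ0 r ?_)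
    rcases mem_uIoc.1 hr with h | h
    · exact ht₁.trans h.1
    · exact ht.trans h.1
  refine ⟨fun t => ζ t * η₁ t, ζ.contDiff.mul hη₁, ζ.hasCompactSupport.mul_right, ?_,
    fun t ht => ?_, fun t ht => ?_⟩
  · refine Subset.trans (closure_minimal (t := Iic t₁) (fun t ht => ?_) isClosed_Iic)
      (fun t (ht : t ≤ t₁) => ht.trans_lt ht₁)
    by_contra h
    exact ht (by simp only [hzero t (not_le.1 h), mul_zero])
  · have : (fun t => ζ t * η₁ t) =ᶠ[nhds t] η₁ := by
      filter_upwards [Ioo_mem_nhds (a := -T) (b := T) (by linarith [ht.1]) ht.2] with r hr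
      rw [hζ1 r hr, one_mul]
    rw [this.deriv_eq, (hd t).deriv]
  · beta_reduce
    rw [hζ1 t ⟨by linarith [ht.1], ht.2⟩, one_mul]
    change ∫ r in T..t, θ r = _
    rw [intervalIntegral.integral_symm, intervalIntegral.integral_of_le ht.2.le,
      integral_Ioc_eq_integral_Ioo]

/-- A weak form of `F' = -G`, `F(0) = 0` on `(0,T)` gives the integrated equation. -/
theorem ae_eq_primitive_of_weak {T : ℝ} (hT : 0 < T) {F G : ℝ → ℝ}
    (hF : IntegrableOn F (Ioo 0 T)) (hG : IntegrableOn G (Ioo 0 T))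
    (h : ∀ η : ℝ → ℝ, ContDiff ℝ ∞ η → HasCompactSupport η → tsupport η ⊆ Iio T →
      -(∫ t in Ioo 0 T, deriv η t * F t) + ∫ t in Ioo 0 T, η t * G t = 0) :
    ∀ᵐ t ∂(volume.restrict (Ioo 0 T)), F t = -∫ r in Ioo 0 t, G r := by
  have hP := integrable_primitive hG
  rw [ae_restrict_iff' measurableSet_Ioo]
  have key := isOpen_Ioo.ae_eq_zero_of_integral_contDiff_smul_eq_zero (μ := volume)
    (U := Ioo 0 T) (f := fun t => F t + ∫ r in Ioo 0 t, G r)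
    (hF.add hP).locallyIntegrableOn ?_
  · filter_upwards [key] with t ht ht2
    linarith [ht ht2]
  intro θ hθ hc hsupp
  obtain ⟨η, h1, h2, h3, h4, h5⟩ := exists_test_primitive hT hθ hc hsupp
  have hw := h η h1 h2 h3
  obtain ⟨C, hC⟩ := hc.exists_bound_of_continuous hθ.continuous
  have e0 : ∫ t, θ t • (F t + ∫ r in Ioo 0 t, G r) =
      ∫ t in Ioo 0 T, θ t * (F t + ∫ r in Ioo 0 t, G r) := by
    refine (setIntegral_eq_integral_of_forall_compl_eq_zero fun t ht => ?_).symm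
    rw [image_eq_zero_of_notMem_tsupport fun h' => ht (hsupp h')]
    simp
  have hθF : IntegrableOn (fun t => θ t * F t) (Ioo 0 T) :=
    hF.bdd_mul hθ.continuous.aestronglyMeasurable (ae_of_all _ hC)
  have hθP : IntegrableOn (fun t => θ t * ∫ r in Ioo 0 t, G r) (Ioo 0 T) :=
    hP.bdd_mul hθ.continuous.aestronglyMeasurable (ae_of_all _ hC)
  have e1 : ∫ t in Ioo 0 T, deriv η t * F t = ∫ t in Ioo 0 T, θ t * F t :=
    setIntegral_congr_fun measurableSet_Ioo fun t ht => by simp only [h4 t ht]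
  -- Writing `η(t) = -∫_t^T θ` and exchanging the integrals moves the primitive from `θ` onto `G`.
  have e2 : ∫ t in Ioo 0 T, η t * G t = -∫ t in Ioo 0 T, ∫ r in Ioo t T, G t * θ r := by
    rw [← integral_neg]
    refine setIntegral_congr_fun measurableSet_Ioo fun t ht => ?_
    simp only [h5 t ht, integral_const_mul]
    ring
  have hθI : IntegrableOn θ (Ioo 0 T) :=
    (hθ.continuous.integrable_of_hasCompactSupport hc).integrableOn
  have e3 := integral_triangle_swap (f := fun t r => G t * θ r) (hG.mul_prod hθI)
  have e4 : ∫ r in Ioo 0 T, ∫ t in Ioo 0 r, G t * θ r =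
      ∫ r in Ioo 0 T, θ r * ∫ t in Ioo 0 r, G t := by
    refine integral_congr_ae (ae_of_all _ fun r => ?_)
    simp only [integral_mul_const]
    ring
  rw [e0]
  simp only [mul_add]
  rw [integral_add hθF hθP]
  rw [e1, e2, ← e3, e4] at hw
  linarith

end NPME

/-! ### Continuity of `L²` pairings and separability of the test functions. -/

namespace NPME

variable {n : ℕ} {s : ℝ}

theorem enorm_integral_mul_le {Z : Type*} [MeasurableSpace Z] {μ : Measure Z} {g d : Z → ℝ}
    (hg : AEStronglyMeasurable g μ) (hd : AEStronglyMeasurable d μ) :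
    ‖∫ z, g z * d z ∂μ‖ₑ ≤ (∫⁻ z, ENNReal.ofReal (g z ^ 2) ∂μ) ^ (1 / 2 : ℝ) *
      (∫⁻ z, ENNReal.ofReal (d z ^ 2) ∂μ) ^ (1 / 2 : ℝ) := by
  refine (enorm_integral_le_lintegral_enorm _).trans ?_
  have h := ENNReal.lintegral_mul_le_Lp_mul_Lq μ (Real.HolderConjugate.two_two)
    hg.enorm hd.enorm
  simp only [← enorm_sq_eq_ofReal, enorm_mul]
  simpa [Pi.mul_apply] using h

theorem integral_mul_sub_integral_mul {Z : Type*} [MeasurableSpace Z] {μ : Measure Z}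
    {g d e : Z → ℝ} (hg : MemLp g 2 μ) (hd : MemLp d 2 μ) (he : MemLp e 2 μ) :
    ∫ z, g z * d z ∂μ - ∫ z, g z * e z ∂μ = ∫ z, g z * (d z - e z) ∂μ := by
  simp only [mul_sub]
  exact (integral_sub (hg.integrable_mul hd) (hg.integrable_mul he)).symm

theorem tendsto_integral_mul {Z : Type*} [MeasurableSpace Z] {μ : Measure Z} {g : Z → ℝ}
    (hg : MemLp g 2 μ) {d : ℕ → Z → ℝ} {e : Z → ℝ} (hd : ∀ k, MemLp (d k) 2 μ)
    (he : MemLp e 2 μ)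
    (h : Filter.Tendsto (fun k => ∫⁻ z, ENNReal.ofReal ((d k z - e z) ^ 2) ∂μ) Filter.atTop
      (nhds 0)) :
    Filter.Tendsto (fun k => ∫ z, g z * d k z ∂μ) Filter.atTop (nhds (∫ z, g z * e z ∂μ)) := by
  rw [tendsto_iff_edist_tendsto_0]
  have hgtop := (memLp_two_iff hg.1).1 hg
  have hlim : Filter.Tendsto (fun k => (∫⁻ z, ENNReal.ofReal (g z ^ 2) ∂μ) ^ (1 / 2 : ℝ) *
      (∫⁻ z, ENNReal.ofReal ((d k z - e z) ^ 2) ∂μ) ^ (1 / 2 : ℝ)) Filter.atTop (nhds 0) := by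
    have h1 := h.ennrpow_const (1 / 2 : ℝ)
    rw [ENNReal.zero_rpow_of_pos (by norm_num)] at h1
    have h2 := ENNReal.Tendsto.const_mul
      (a := (∫⁻ z, ENNReal.ofReal (g z ^ 2) ∂μ) ^ (1 / 2 : ℝ)) h1
      (Or.inr (ENNReal.rpow_ne_top_of_nonneg (by norm_num) hgtop.ne))
    rwa [mul_zero] at h2
  refine tendsto_of_tendsto_of_tendsto_of_le_of_le tendsto_const_nhds hlim
    (fun _ => bot_le) fun k => ?_
  beta_reduce
  rw [edist_eq_enorm_sub, integral_mul_sub_integral_mul hg (hd k) he]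
  exact enorm_integral_mul_le hg.1 ((hd k).1.sub he.1)

theorem memLp_comp_snd {Z : Type*} [MeasurableSpace Z] {μ : Measure Z} [SFinite μ]
    {ι : Measure ℝ} [IsFiniteMeasure ι] {d : Z → ℝ} (hd : MemLp d 2 μ) :
    MemLp (fun q : ℝ × Z => d q.2) 2 (ι.prod μ) := by
  have hm : AEStronglyMeasurable (fun q : ℝ × Z => d q.2) (ι.prod μ) := hd.1.comp_snd
  rw [memLp_two_iff hm]
  have h := (memLp_two_iff hd.1).1 hd
  rw [lintegral_prod _ (hm.aemeasurable.pow_const 2).ennreal_ofReal]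
  simp only [lintegral_const]
  exact ENNReal.mul_lt_top h (measure_lt_top _ _)

theorem tendsto_integral_integral_mul {Z : Type*} [MeasurableSpace Z] {μ : Measure Z} [SFinite μ]
    {ι : Measure ℝ} [IsFiniteMeasure ι] {g : ℝ → Z → ℝ}
    (hg : MemLp (fun q : ℝ × Z => g q.1 q.2) 2 (ι.prod μ)) {d : ℕ → Z → ℝ} {e : Z → ℝ}
    (hd : ∀ k, MemLp (d k) 2 μ) (he : MemLp e 2 μ)
    (h : Filter.Tendsto (fun k => ∫⁻ z, ENNReal.ofReal ((d k z - e z) ^ 2) ∂μ) Filter.atTop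
      (nhds 0)) :
    Filter.Tendsto (fun k => ∫ t, ∫ z, g t z * d k z ∂μ ∂ι) Filter.atTop
      (nhds (∫ t, ∫ z, g t z * e z ∂μ ∂ι)) := by
  have key : ∀ d : Z → ℝ, MemLp d 2 μ → ∫ t, ∫ z, g t z * d z ∂μ ∂ι =
      ∫ q : ℝ × Z, g q.1 q.2 * d q.2 ∂(ι.prod μ) := fun d hd =>
    (integral_prod (fun q : ℝ × Z => g q.1 q.2 * d q.2)
      (hg.integrable_mul (memLp_comp_snd hd))).symm
  rw [key e he]
  simp only [key _ (hd _)]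
  refine tendsto_integral_mul hg (fun k => memLp_comp_snd (hd k)) (memLp_comp_snd he) ?_
  have h2 : ∀ k, ∫⁻ q : ℝ × Z, ENNReal.ofReal ((d k q.2 - e q.2) ^ 2) ∂(ι.prod μ) =
      (∫⁻ z, ENNReal.ofReal ((d k z - e z) ^ 2) ∂μ) * ι univ := by
    intro k
    have hm : AEMeasurable (fun q : ℝ × Z => d k q.2 - e q.2) (ι.prod μ) :=
      ((memLp_comp_snd (hd k)).1.sub (memLp_comp_snd he).1).aemeasurable
    rw [lintegral_prod _ (hm.pow_const 2).ennreal_ofReal]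
    simp
  simp only [h2]
  have h3 := ENNReal.Tendsto.mul_const (b := ι univ) h (Or.inr (measure_ne_top _ _))
  rwa [zero_mul] at h3

/-- `ψ ∈ C_c^∞(Ω)`. -/
structure IsSpaceTest (Ω : Set (Space n)) (ψ : Space n → ℝ) : Prop where
  contDiff : ContDiff ℝ ∞ ψ
  hasCompactSupport : HasCompactSupport ψ
  tsupport_subset : tsupport ψ ⊆ Ω

theorem IsSpaceTest.hsNormSq_lt_top (hn : 1 ≤ n) (hs : 0 < s) (hs1 : s < 1) {Ω : Set (Space n)}
    {ψ : Space n → ℝ} (h : IsSpaceTest Ω ψ) : hsNormSq s ψ < ⊤ := by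
  obtain ⟨A, hA⟩ := exists_isBddLip_of_contDiff h.contDiff h.hasCompactSupport
  exact hA.hsNormSq_lt_top hn hs hs1 h.hasCompactSupport

theorem lintegral_sq_eq_eLpNorm {Z : Type*} [MeasurableSpace Z] {μ : Measure Z} (f : Z → ℝ) :
    ∫⁻ z, ENNReal.ofReal (f z ^ 2) ∂μ = eLpNorm f 2 μ ^ 2 := by
  rw [eLpNorm_eq_lintegral_rpow_enorm_toReal (by simp) (by simp), ← ENNReal.rpow_natCast,
    ← ENNReal.rpow_mul]
  simp [enorm_sq_eq_ofReal]

/-- The map `ψ ↦ (ψ, incr ψ)` sends test functions into a product of two second countable `L²`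
spaces, so they are separable for the induced topology. Countability allows a single null set of
times to serve all tests in `H̃^s(Ω)`. -/
theorem exists_countable_dense_test (hn : 1 ≤ n) (hs : 0 < s) (hs1 : s < 1)
    (Ω : Set (Space n)) : ∃ D : Set (Space n → ℝ), D.Countable ∧ (∀ ψ ∈ D, IsSpaceTest Ω ψ) ∧
      ∀ χ, MemHsTilde s Ω χ → ∀ ε : ℝ≥0∞, 0 < ε →
        ∃ ψ ∈ D, hsNormSq s (fun x => χ x - ψ x) < ε := by
  have : Fact ((2 : ℝ≥0∞) ≠ ⊤) := ⟨by simp⟩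
  let S := {ψ : Space n → ℝ // IsSpaceTest Ω ψ}
  have hS : ∀ ψ : S, MemLp ψ.1 2 volume ∧ MemLp (incr ψ.1) 2 (nu n s) := fun ψ =>
    (hsNormSq_lt_top_iff hn hs ψ.2.contDiff.continuous.aestronglyMeasurable).1
      (ψ.2.hsNormSq_lt_top hn hs hs1)
  let j : S → Lp ℝ 2 (volume : Measure (Space n)) × Lp ℝ 2 (nu n s) := fun ψ =>
    ((hS ψ).1.toLp _, (hS ψ).2.toLp _)
  have i1 : SecondCountableTopology (Lp ℝ 2 (volume : Measure (Space n))) :=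
    Lp.SecondCountableTopology
  have i2 : SecondCountableTopology (Lp ℝ 2 (nu n s)) := Lp.SecondCountableTopology
  let _ : TopologicalSpace S := TopologicalSpace.induced j inferInstance
  have hj : Continuous j := continuous_induced_dom
  have : SecondCountableTopology S := TopologicalSpace.secondCountableTopology_induced _ _ j
  obtain ⟨D, hDc, hDd⟩ := TopologicalSpace.exists_countable_dense S
  refine ⟨Subtype.val '' D, hDc.image _, ?_, fun χ hχ ε hε => ?_⟩
  · rintro _ ⟨ψ, -, rfl⟩
    exact ψ.2
  have hε4 : 0 < ε / 4 := ENNReal.div_pos hε.ne' (by simp)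
  have hε16 : 0 < ε / 4 / 4 := ENNReal.div_pos hε4.ne' (by simp)
  obtain ⟨ψ₀, h1, h2, h3, h4⟩ := hχ.2 (ε / 4) hε4
  let ψ₀' : S := ⟨ψ₀, h1, h2, h3⟩
  obtain ⟨ψ, hψD, hψ⟩ := hDd.exists_mem_open
    ((Metric.isOpen_eball (x := j ψ₀') (ε := min 1 (ε / 4 / 4))).preimage hj)
    ⟨ψ₀', Metric.mem_eball_self (lt_min one_pos hε16)⟩
  refine ⟨ψ.1, ⟨ψ, hψD, rfl⟩, ?_⟩
  have hd : edist (j ψ) (j ψ₀') < min 1 (ε / 4 / 4) := hψ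
  rw [Prod.edist_eq, max_lt_iff] at hd
  -- The radius is capped at 1 so that squaring a distance does not increase it; `hsNormSq` is a
  -- squared norm.
  have hsq : ∀ a : ℝ≥0∞, a < min 1 (ε / 4 / 4) → a ^ 2 < ε / 4 / 4 := fun a ha =>
    lt_of_le_of_lt (pow_le_of_le_one bot_le (ha.le.trans (min_le_left _ _)) two_ne_zero)
      (ha.trans_le (min_le_right _ _))
  have e1 : ∫⁻ x, ENNReal.ofReal ((ψ.1 x - ψ₀ x) ^ 2) < ε / 4 / 4 := by
    have h := hsq _ hd.1
    rw [Lp.edist_toLp_toLp, ← lintegral_sq_eq_eLpNorm] at h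
    exact h
  have e2 : ∫⁻ p, ENNReal.ofReal ((incr ψ.1 p - incr ψ₀ p) ^ 2) ∂(nu n s) < ε / 4 / 4 := by
    have h := hsq _ hd.2
    rw [Lp.edist_toLp_toLp, ← lintegral_sq_eq_eLpNorm] at h
    exact h
  have h5 := hsNormSq_add_le (u := fun x => χ x - ψ₀ x) (v := fun x => ψ₀ x - ψ.1 x) hn hs
    (hχ.1.sub h1.continuous.aestronglyMeasurable)
  simp only [sub_add_sub_cancel] at h5
  refine h5.trans_lt (add_quarter_lt h4 ?_)
  rw [hsNormSq_eq hn hs]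
  have e3 : ∫⁻ x, ENNReal.ofReal ((ψ₀ x - ψ.1 x) ^ 2) < ε / 4 / 4 := by
    simpa only [sub_sq_comm] using e1
  have e4 : ∫⁻ p, ENNReal.ofReal (incr (fun x => ψ₀ x - ψ.1 x) p ^ 2) ∂(nu n s) < ε / 4 / 4 := by
    refine lt_of_le_of_lt (le_of_eq (lintegral_congr fun p => ?_)) e2
    congr 1
    simp only [incr]
    ring
  refine lt_of_le_of_lt ?_ (add_quarter_lt e3 e4)
  rw [two_mul, two_mul]
  exact add_le_add le_self_add le_self_add

end NPME

/-! ### The linear problem: its time-integrated form. -/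

namespace NPME

/-- A measurable kernel on space which takes values in `[l, L]`, where `0 < l`. -/
structure IsEllipticKernel {n : ℕ} (l L : ℝ) (K : Space n → Space n → ℝ) : Prop where
  aemeasurable : AEMeasurable (Function.uncurry K) volume
  pos : 0 < l
  bounds : ∀ x y, l ≤ K x y ∧ K x y ≤ L

/-- A pair of measurable functions `w`, `V` vanishing outside of `Ω` with
`∂ₜ V + L_K w + a V = 0` and `V(0) = 0` in the weak sense. -/
structure IsLinearPair {n : ℕ} (Ω : Set (Space n)) (T s : ℝ) (K : Space n → Space n → ℝ)
    (a : Space n → ℝ) (w V : ℝ → Space n → ℝ) : Prop where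
  measurable_w : Measurable (Function.uncurry w)
  measurable_V : Measurable (Function.uncurry V)
  w_eq_zero : ∀ t, ∀ x ∉ Ω, w t x = 0
  memLp_w : MemLp (fun q : ℝ × Space n => w q.1 q.2) 2 ((volume.restrict (Ioo 0 T)).prod volume)
  memLp_V : MemLp (fun q : ℝ × Space n => V q.1 q.2) 2 ((volume.restrict (Ioo 0 T)).prod volume)
  memLp_incr : MemLp (fun q : ℝ × Space n × Space n => incr (w q.1) q.2) 2
    ((volume.restrict (Ioo 0 T)).prod (nu n s))
  memHsTilde : ∀ᵐ t ∂(volume.restrict (Ioo 0 T)), MemHsTilde s Ω (w t)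
  weak : ∀ η : ℝ → ℝ, ContDiff ℝ ∞ η → HasCompactSupport η → tsupport η ⊆ Iio T →
    ∀ χ, IsSpaceTest Ω χ →
      -(∫ t in Ioo 0 T, deriv η t * ∫ x, V t x * χ x) + ∫ t in Ioo 0 T,
        η t * (bilinForm s K (w t) χ + ∫ x, V t x * (a x * χ x)) = 0

variable {n : ℕ} {Ω : Set (Space n)} {T s l L A : ℝ} {K : Space n → Space n → ℝ}
  {a : Space n → ℝ} {w V : ℝ → Space n → ℝ}

theorem IsEllipticKernel.aestronglyMeasurable (hK : IsEllipticKernel l L K) :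
    AEStronglyMeasurable (fun p : Space n × Space n => K p.1 p.2) (nu n s) :=
  (hK.aemeasurable.mono_ac nu_absolutelyContinuous).aestronglyMeasurable

theorem IsEllipticKernel.abs_le (hK : IsEllipticKernel l L K) (p : Space n × Space n) :
    |K p.1 p.2| ≤ L := by
  rw [abs_of_nonneg (hK.pos.le.trans (hK.bounds _ _).1)]
  exact (hK.bounds _ _).2

theorem memLp_bdd_mul {Z : Type*} [MeasurableSpace Z] {μ : Measure Z} {f g : Z → ℝ} {c : ℝ}
    (hg : MemLp g 2 μ) (hf : AEStronglyMeasurable f μ) (hc : ∀ z, |f z| ≤ c) :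
    MemLp (fun z => f z * g z) 2 μ :=
  MemLp.of_le_mul hg (hf.mul hg.1) (ae_of_all _ fun z => by
    rw [Real.norm_eq_abs, abs_mul]
    exact mul_le_mul_of_nonneg_right (hc z) (abs_nonneg _))

/-- Multiplication by an elliptic kernel preserves square integrability in space-time. -/
theorem IsEllipticKernel.memLp_mul (hK : IsEllipticKernel l L K) {ι : Measure ℝ} [SFinite ι]
    {g : ℝ × Space n × Space n → ℝ} (hg : MemLp g 2 (ι.prod (nu n s))) :
    MemLp (fun q : ℝ × Space n × Space n => K q.2.1 q.2.2 * g q) 2 (ι.prod (nu n s)) :=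
  memLp_bdd_mul hg hK.aestronglyMeasurable.comp_snd fun q => hK.abs_le q.2

theorem memLp_mono_time {Z : Type*} [MeasurableSpace Z] {μ : Measure Z} [SFinite μ] {t : ℝ}
    (ht : t ≤ T) {g : ℝ × Z → ℝ} (hg : MemLp g 2 ((volume.restrict (Ioo 0 T)).prod μ)) :
    MemLp g 2 ((volume.restrict (Ioo 0 t)).prod μ) :=
  hg.mono_measure (Measure.prod_mono (Measure.restrict_mono (Ioo_subset_Ioo_right ht) le_rfl)
    le_rfl)

theorem integrable_pairing {Z : Type*} [MeasurableSpace Z] {μ : Measure Z} [SFinite μ]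
    {ι : Measure ℝ} [IsFiniteMeasure ι] {g : ℝ → Z → ℝ}
    (hg : MemLp (fun q : ℝ × Z => g q.1 q.2) 2 (ι.prod μ)) {d : Z → ℝ} (hd : MemLp d 2 μ) :
    Integrable (fun t => ∫ z, g t z * d z ∂μ) ι :=
  (hg.integrable_mul (memLp_comp_snd hd)).integral_prod_left

theorem bilinForm_eq' (u v : Space n → ℝ) :
    bilinForm s K u v = ∫ p, K p.1 p.2 * incr u p * incr v p ∂(nu n s) := by
  rw [bilinForm_eq]
  simp only [mul_assoc]

theorem IsLinearPair.memLp_K (h : IsLinearPair Ω T s K a w V) (hK : IsEllipticKernel l L K) :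
    MemLp (fun q : ℝ × Space n × Space n => K q.2.1 q.2.2 * incr (w q.1) q.2) 2
      ((volume.restrict (Ioo 0 T)).prod (nu n s)) :=
  hK.memLp_mul h.memLp_incr

theorem IsLinearPair.integrable_bilinForm (h : IsLinearPair Ω T s K a w V)
    (hK : IsEllipticKernel l L K) {χ : Space n → ℝ} (hχ : MemLp (incr χ) 2 (nu n s)) :
    IntegrableOn (fun t => bilinForm s K (w t) χ) (Ioo 0 T) := by
  simp only [bilinForm_eq']
  exact integrable_pairing (g := fun t p => K p.1 p.2 * incr (w t) p) (h.memLp_K hK) hχ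

theorem IsBddLip.memLp_mul (ha : IsBddLip A a) {χ : Space n → ℝ} (hχ : MemLp χ 2 volume) :
    MemLp (fun x => a x * χ x) 2 volume :=
  memLp_bdd_mul hχ ha.continuous.aestronglyMeasurable ha.bound

/-- For fixed `χ` the weak equation is a scalar one in time, to which `ae_eq_primitive_of_weak`
applies. The exceptional null set still depends on `χ`. -/
theorem IsLinearPair.ae_test (h : IsLinearPair Ω T s K a w V) (hT : 0 < T) (hn : 1 ≤ n)
    (hs : 0 < s) (hs1 : s < 1) (hK : IsEllipticKernel l L K) (ha : IsBddLip A a)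
    {χ : Space n → ℝ} (hχ : IsSpaceTest Ω χ) :
    ∀ᵐ t ∂(volume.restrict (Ioo 0 T)), ∫ x, V t x * χ x =
      -((∫ r in Ioo 0 t, bilinForm s K (w r) χ) +
        ∫ r in Ioo 0 t, ∫ x, V r x * (a x * χ x)) := by
  obtain ⟨h1, h2⟩ := (hsNormSq_lt_top_iff hn hs
    hχ.contDiff.continuous.aestronglyMeasurable).1 (hχ.hsNormSq_lt_top hn hs hs1)
  have i1 := h.integrable_bilinForm hK h2
  have i2 : IntegrableOn (fun t => ∫ x, V t x * (a x * χ x)) (Ioo 0 T) :=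
    integrable_pairing h.memLp_V (ha.memLp_mul h1)
  have key := ae_eq_primitive_of_weak hT (integrable_pairing h.memLp_V h1) (i1.add i2)
    (fun η k1 k2 k3 => h.weak η k1 k2 k3 χ hχ)
  filter_upwards [key, ae_restrict_mem measurableSet_Ioo] with t ht htI
  rw [ht, neg_inj]
  have hsub : Ioo 0 t ⊆ Ioo 0 T := Ioo_subset_Ioo_right htI.2.le
  exact integral_add (i1.mono_set hsub) (i2.mono_set hsub)

/-- The null set is made independent of `χ`, so that later `χ` may depend on `t`, as it does for `χ
= e^{-μt} w(t)`. The equation holds off one null set for a countable dense family, and each of its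
terms is continuous in `χ` for the `H^s` norm. -/
theorem IsLinearPair.ae_forall (h : IsLinearPair Ω T s K a w V) (hT : 0 < T) (hn : 1 ≤ n)
    (hs : 0 < s) (hs1 : s < 1) (hK : IsEllipticKernel l L K) (ha : IsBddLip A a) :
    ∀ᵐ t ∂(volume.restrict (Ioo 0 T)), ∀ χ, MemHsTilde s Ω χ → ∫ x, V t x * χ x =
      -((∫ r in Ioo 0 t, bilinForm s K (w r) χ) +
        ∫ r in Ioo 0 t, ∫ x, V r x * (a x * χ x)) := by
  obtain ⟨D, hDc, hDt, hDd⟩ := exists_countable_dense_test hn hs hs1 Ω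
  have hall : ∀ᵐ t ∂(volume.restrict (Ioo 0 T)), ∀ ψ ∈ D, ∫ x, V t x * ψ x =
      -((∫ r in Ioo 0 t, bilinForm s K (w r) ψ) +
        ∫ r in Ioo 0 t, ∫ x, V r x * (a x * ψ x)) :=
    (ae_ball_iff hDc).2 fun ψ hψ => h.ae_test hT hn hs hs1 hK ha (hDt ψ hψ)
  have hVt : ∀ᵐ t ∂(volume.restrict (Ioo 0 T)), MemLp (V t) 2 volume := by
    have h1 := (memLp_two_iff h.memLp_V.1).1 h.memLp_V
    have hm : Measurable fun q : ℝ × Space n => V q.1 q.2 := h.measurable_V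
    rw [lintegral_prod _ (hm.pow_const 2).ennreal_ofReal.aemeasurable] at h1
    filter_upwards [ae_lt_top' ((hm.pow_const 2).ennreal_ofReal.lintegral_prod_right'.aemeasurable)
      h1.ne] with t ht
    exact (memLp_two_iff (hm.comp measurable_prodMk_left).aestronglyMeasurable).2 ht
  filter_upwards [hall, hVt, ae_restrict_mem measurableSet_Ioo] with t h1 h2 htI χ hχ
  obtain ⟨hχ1, hχ2⟩ := (hsNormSq_lt_top_iff hn hs hχ.1).1 (hχ.hsNormSq_lt_top hn hs hs1)
  choose! d hdD hd using fun k : ℕ => hDd χ hχ ((k : ℝ≥0∞) + 1)⁻¹ (by simp)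
  have hdm : ∀ k, MemLp (d k) 2 volume ∧ MemLp (incr (d k)) 2 (nu n s) := fun k =>
    (hsNormSq_lt_top_iff hn hs (hDt _ (hdD k)).contDiff.continuous.aestronglyMeasurable).1
      ((hDt _ (hdD k)).hsNormSq_lt_top hn hs hs1)
  have hlim : Filter.Tendsto (fun k : ℕ => ((k : ℝ≥0∞) + 1)⁻¹) Filter.atTop (nhds 0) := by
    have := (Filter.tendsto_add_atTop_iff_nat 1).2 ENNReal.tendsto_inv_nat_nhds_zero
    simpa using this
  have l1 : Filter.Tendsto (fun k => ∫⁻ x, ENNReal.ofReal ((d k x - χ x) ^ 2)) Filter.atTop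
      (nhds 0) := by
    refine tendsto_of_tendsto_of_tendsto_of_le_of_le tendsto_const_nhds hlim
      (fun _ => bot_le) fun k => le_trans ?_ (hd k).le
    rw [hsNormSq_eq hn hs]
    simp only [sub_sq_comm (d k _)]
    exact le_self_add
  have l2 : Filter.Tendsto (fun k => ∫⁻ p, ENNReal.ofReal ((incr (d k) p - incr χ p) ^ 2)
      ∂(nu n s)) Filter.atTop (nhds 0) := by
    refine tendsto_of_tendsto_of_tendsto_of_le_of_le tendsto_const_nhds hlim
      (fun _ => bot_le) fun k => le_trans ?_ (hd k).le
    rw [hsNormSq_eq hn hs]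
    refine le_trans (le_of_eq (lintegral_congr fun p => ?_)) le_add_self
    congr 1
    simp only [incr]
    ring
  have m1 := tendsto_integral_mul h2 (fun k => (hdm k).1) hχ1 l1
  have m2 := tendsto_integral_integral_mul (g := fun r p => K p.1 p.2 * incr (w r) p)
    (memLp_mono_time htI.2.le (h.memLp_K hK)) (fun k => (hdm k).2) hχ2 l2
  have hVa : MemLp (fun q : ℝ × Space n => V q.1 q.2 * a q.2) 2
      ((volume.restrict (Ioo 0 t)).prod volume) := by
    simp only [mul_comm (V _ _)]
    exact memLp_bdd_mul (memLp_mono_time htI.2.le h.memLp_V)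
      (ha.continuous.measurable.comp measurable_snd).aestronglyMeasurable
      fun q => ha.bound q.2
  have m3 := tendsto_integral_integral_mul (g := fun r x => V r x * a x) hVa
    (fun k => (hdm k).1) hχ1 l1
  simp only [mul_assoc, ← bilinForm_eq] at m2 m3
  refine tendsto_nhds_unique m1 ?_
  simp only [h1 _ (hdD _)]
  exact (m2.add m3).neg

end NPME

/-! ### Square-integrable pairings on the time triangle and exponential weights. -/

namespace NPME

variable {n : ℕ} {Ω : Set (Space n)} {T s l L A : ℝ} {K : Space n → Space n → ℝ}
  {a : Space n → ℝ} {w V : ℝ → Space n → ℝ}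

theorem quasiMeasurePreserving_prodMap_id {X Y Z : Type*} [MeasurableSpace X] [MeasurableSpace Y]
    [MeasurableSpace Z] {μ : Measure X} {ν : Measure Y} {ξ : Measure Z} [SFinite μ] [SFinite ν]
    [SFinite ξ] {f : X → Y} (hf : Measure.QuasiMeasurePreserving f μ ν) :
    Measure.QuasiMeasurePreserving (fun q : X × Z => (f q.1, q.2)) (μ.prod ξ) (ν.prod ξ) := by
  refine ⟨(hf.measurable.comp measurable_fst).prodMk measurable_snd, ?_⟩
  have h := Measure.map_prod_map μ ξ hf.measurable measurable_id
  rw [Measure.map_id] at h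
  change Measure.map (Prod.map f id) (μ.prod ξ) ≪ _
  rw [← h]
  exact hf.absolutelyContinuous.prod Measure.AbsolutelyContinuous.rfl

theorem memLp_lift_fst {Z : Type*} [MeasurableSpace Z] {μ : Measure Z} [SFinite μ]
    {ι : Measure ℝ} [IsFiniteMeasure ι] {g : ℝ → Z → ℝ}
    (hg : MemLp (fun q : ℝ × Z => g q.1 q.2) 2 (ι.prod μ)) :
    MemLp (fun q : (ℝ × ℝ) × Z => g q.1.1 q.2) 2 ((ι.prod ι).prod μ) := by
  have hq : Measure.QuasiMeasurePreserving (fun q : (ℝ × ℝ) × Z => (q.1.1, q.2))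
      ((ι.prod ι).prod μ) (ι.prod μ) :=
    quasiMeasurePreserving_prodMap_id Measure.quasiMeasurePreserving_fst
  have hm : AEStronglyMeasurable (fun q : (ℝ × ℝ) × Z => g q.1.1 q.2) ((ι.prod ι).prod μ) :=
    hg.1.comp_quasiMeasurePreserving hq
  rw [memLp_two_iff hm]
  have h := (memLp_two_iff hg.1).1 hg
  rw [lintegral_prod _ (hg.1.aemeasurable.pow_const 2).ennreal_ofReal] at h
  have hm2 := (hm.aemeasurable.pow_const 2).ennreal_ofReal
  rw [lintegral_prod _ hm2, lintegral_prod _ hm2.lintegral_prod_right']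
  simp only [lintegral_const]
  rw [lintegral_mul_const'' _
    (hg.1.aemeasurable.pow_const 2).ennreal_ofReal.lintegral_prod_right']
  exact ENNReal.mul_lt_top h (measure_lt_top _ _)

theorem memLp_lift_snd {Z : Type*} [MeasurableSpace Z] {μ : Measure Z} [SFinite μ]
    {ι : Measure ℝ} [IsFiniteMeasure ι] {g : ℝ → Z → ℝ}
    (hg : MemLp (fun q : ℝ × Z => g q.1 q.2) 2 (ι.prod μ)) :
    MemLp (fun q : (ℝ × ℝ) × Z => g q.1.2 q.2) 2 ((ι.prod ι).prod μ) := by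
  have hq : Measure.QuasiMeasurePreserving (fun q : (ℝ × ℝ) × Z => (q.1.2, q.2))
      ((ι.prod ι).prod μ) (ι.prod μ) :=
    quasiMeasurePreserving_prodMap_id Measure.quasiMeasurePreserving_snd
  have hm : AEStronglyMeasurable (fun q : (ℝ × ℝ) × Z => g q.1.2 q.2) ((ι.prod ι).prod μ) :=
    hg.1.comp_quasiMeasurePreserving hq
  rw [memLp_two_iff hm]
  have h := (memLp_two_iff hg.1).1 hg
  rw [lintegral_prod _ (hg.1.aemeasurable.pow_const 2).ennreal_ofReal] at h
  have hm2 := (hm.aemeasurable.pow_const 2).ennreal_ofReal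
  rw [lintegral_prod _ hm2, lintegral_prod _ hm2.lintegral_prod_right']
  simp only [lintegral_const]
  exact ENNReal.mul_lt_top h (measure_lt_top _ _)

theorem ae_memLp_slice {Z : Type*} [MeasurableSpace Z] {μ : Measure Z} [SFinite μ]
    {ι : Measure ℝ} [IsFiniteMeasure ι] {g : ℝ → Z → ℝ}
    (hg : MemLp (fun q : ℝ × Z => g q.1 q.2) 2 (ι.prod μ)) :
    ∀ᵐ t ∂ι, MemLp (g t) 2 μ := by
  have h := (memLp_two_iff hg.1).1 hg
  have hm := (hg.1.aemeasurable.pow_const 2).ennreal_ofReal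
  rw [lintegral_prod _ hm] at h
  filter_upwards [ae_lt_top' hm.lintegral_prod_right' h.ne, hg.1.prodMk_left] with t ht ht2
  exact (memLp_two_iff ht2).2 ht

section Triangle

variable {Z : Type*} [MeasurableSpace Z] {μ : Measure Z} [SFinite μ] {g H : ℝ → Z → ℝ}
  {h : ℝ → ℝ → Z → ℝ}

theorem integrable_triangle_pairing
    (hg : MemLp (fun q : ℝ × Z => g q.1 q.2) 2 ((volume.restrict (Ioo 0 T)).prod μ))
    (hH : MemLp (fun q : ℝ × Z => H q.1 q.2) 2 ((volume.restrict (Ioo 0 T)).prod μ))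
    (hh : Measurable fun q : (ℝ × ℝ) × Z => h q.1.1 q.1.2 q.2)
    (hb : ∀ τ ∈ Ioo 0 T, ∀ σ ∈ Ioo 0 T, ∀ z, |h τ σ z| ≤ |H σ z|) :
    Integrable (fun q : ℝ × ℝ => ∫ z, g q.1 z * h q.1 q.2 z ∂μ)
      ((volume.restrict (Ioo 0 T)).prod (volume.restrict (Ioo 0 T))) := by
  have h1 : MemLp (fun q : (ℝ × ℝ) × Z => h q.1.1 q.1.2 q.2) 2
      (((volume.restrict (Ioo 0 T)).prod (volume.restrict (Ioo 0 T))).prod μ) := by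
    refine (memLp_lift_snd hH).of_le hh.aestronglyMeasurable ?_
    have h2 : ∀ᵐ q : ℝ × ℝ ∂((volume.restrict (Ioo 0 T)).prod (volume.restrict (Ioo 0 T))),
        q.1 ∈ Ioo 0 T ∧ q.2 ∈ Ioo 0 T := by
      rw [Measure.prod_restrict]
      exact ae_restrict_mem (measurableSet_Ioo.prod measurableSet_Ioo)
    filter_upwards [Measure.quasiMeasurePreserving_fst.ae h2] with q hq
    exact hb _ hq.1 _ hq.2 _
  exact ((memLp_lift_fst hg).integrable_mul h1).integral_prod_left

theorem integrableOn_triangle_pairing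
    (hg : MemLp (fun q : ℝ × Z => g q.1 q.2) 2 ((volume.restrict (Ioo 0 T)).prod μ))
    (hH : MemLp (fun q : ℝ × Z => H q.1 q.2) 2 ((volume.restrict (Ioo 0 T)).prod μ))
    (hh : Measurable fun q : (ℝ × ℝ) × Z => h q.1.1 q.1.2 q.2)
    (hb : ∀ τ ∈ Ioo 0 T, ∀ σ ∈ Ioo 0 T, ∀ z, |h τ σ z| ≤ |H σ z|) :
    IntegrableOn (fun σ => ∫ τ in Ioo 0 σ, ∫ z, g τ z * h τ σ z ∂μ) (Ioo 0 T) := by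
  have hS : MeasurableSet {q : ℝ × ℝ | q.1 < q.2} := measurableSet_lt measurable_fst measurable_snd
  have h2 := ((integrable_triangle_pairing hg hH hh hb).indicator hS).integral_prod_right
  refine h2.congr ?_
  filter_upwards [ae_restrict_mem measurableSet_Ioo] with t ht
  exact (setIntegral_Ioo_eq_indicator_left ht.2.le _).symm

/-- This transfers the time integration from the solution to the test function. The majorant `H`,
independent of `τ`, supplies the integrability needed by both uses of Fubini. -/
theorem integral_triangle_pairing
    (hg : MemLp (fun q : ℝ × Z => g q.1 q.2) 2 ((volume.restrict (Ioo 0 T)).prod μ))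
    (hH : MemLp (fun q : ℝ × Z => H q.1 q.2) 2 ((volume.restrict (Ioo 0 T)).prod μ))
    (hh : Measurable fun q : (ℝ × ℝ) × Z => h q.1.1 q.1.2 q.2)
    (hb : ∀ τ ∈ Ioo 0 T, ∀ σ ∈ Ioo 0 T, ∀ z, |h τ σ z| ≤ |H σ z|) :
    ∫ σ in Ioo 0 T, ∫ τ in Ioo 0 σ, ∫ z, g τ z * h τ σ z ∂μ =
      ∫ τ in Ioo 0 T, ∫ z, g τ z * (∫ σ in Ioo τ T, h τ σ z) ∂μ := by
  rw [integral_triangle_swap (f := fun τ σ => ∫ z, g τ z * h τ σ z ∂μ)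
    (integrable_triangle_pairing hg hH hh hb)]
  refine integral_congr_ae ?_
  filter_upwards [ae_memLp_slice hg, ae_restrict_mem measurableSet_Ioo] with τ hτ hτI
  have h1 : MemLp (fun q : ℝ × Z => h τ q.1 q.2) 2 ((volume.restrict (Ioo 0 T)).prod μ) := by
    have hm : Measurable fun q : ℝ × Z => h τ q.1 q.2 :=
      hh.comp (f := fun q : ℝ × Z => ((τ, q.1), q.2)) (by fun_prop)
    refine hH.of_le hm.aestronglyMeasurable ?_
    filter_upwards [Measure.quasiMeasurePreserving_fst.ae (ae_restrict_mem measurableSet_Ioo)]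
      with q hq
    exact hb _ hτI _ hq _
  have h2 : Integrable (fun q : ℝ × Z => g τ q.2 * h τ q.1 q.2)
      ((volume.restrict (Ioo τ T)).prod μ) :=
    ((memLp_comp_snd hτ).integrable_mul h1).mono_measure (Measure.prod_mono
      (Measure.restrict_mono (Ioo_subset_Ioo_left hτI.1.le) le_rfl) le_rfl)
  rw [integral_integral_swap h2]
  simp only [integral_const_mul]

end Triangle

theorem IsBddLip.const_mul {b : Space n → ℝ} (hb : IsBddLip A b) {c : ℝ} (hc : |c| ≤ 1) :
    IsBddLip A fun x => c * b x := by
  refine ⟨fun x => ?_, fun x y => ?_⟩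
  · rw [abs_mul]
    exact (mul_le_of_le_one_left (abs_nonneg _) hc).trans (hb.bound x)
  · rw [← mul_sub, abs_mul]
    exact (mul_le_of_le_one_left (abs_nonneg _) hc).trans (hb.lip x y)

theorem abs_exp_sub_exp_le {c u v : ℝ} (hu : u ≤ c) (hv : v ≤ c) :
    |Real.exp u - Real.exp v| ≤ Real.exp c * |u - v| := by
  have := Convex.norm_image_sub_le_of_norm_deriv_le (f := Real.exp) (s := Iic c) (x := v) (y := u)
    (C := Real.exp c) (fun x _ => Real.differentiable_exp x) (fun x hx => by
      rw [Real.deriv_exp, Real.norm_eq_abs, Real.abs_exp]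
      exact Real.exp_le_exp.2 hx) (convex_Iic c) hv hu
  simpa using this

/-- All exponents lie in `(-∞, AT]`, where `exp` is Lipschitz with constant `e^{AT}`, and they vary
at most by `AT min(1,|x-y|)`. The resulting constant does not depend on `r`. -/
theorem IsBddLip.exp (ha : IsBddLip A a) {r : ℝ} (hr : |r| ≤ T) :
    IsBddLip (Real.exp (A * T) * (1 + A * T)) fun x => Real.exp (-a x * r) := by
  have hA := ha.nonneg
  have hT : 0 ≤ T := (abs_nonneg r).trans hr
  have hAT : 0 ≤ A * T := mul_nonneg hA hT
  have hle : ∀ x, -a x * r ≤ A * T := fun x => (le_abs_self _).trans (by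
    rw [abs_mul, abs_neg]
    exact mul_le_mul (ha.bound x) hr (abs_nonneg _) hA)
  refine ⟨fun x => ?_, fun x y => ?_⟩
  · rw [Real.abs_exp]
    refine (Real.exp_le_exp.2 (hle x)).trans ?_
    exact le_mul_of_one_le_right (Real.exp_pos _).le (by linarith)
  · refine (abs_exp_sub_exp_le (hle x) (hle y)).trans ?_
    rw [mul_assoc]
    refine mul_le_mul_of_nonneg_left ?_ (Real.exp_pos _).le
    have h1 : -a x * r - -a y * r = -((a x - a y) * r) := by ring
    rw [h1, abs_neg, abs_mul]
    have h2 := mul_le_mul (ha.lip x y) hr (abs_nonneg _) (by positivity)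
    have h3 : 0 ≤ min 1 ‖x - y‖ := by positivity
    nlinarith

/-- A majorant of the increments of products `b u` with `b` bounded and Lipschitz. -/
noncomputable def incrBound (u : Space n → ℝ) (p : Space n × Space n) : ℝ :=
  |incr u p| + min 1 ‖p.1 - p.2‖ * |u p.2|

theorem IsBddLip.abs_incr_mul_le {b : Space n → ℝ} (hb : IsBddLip A b) (u : Space n → ℝ)
    (p : Space n × Space n) : |incr (fun x => b x * u x) p| ≤ A * incrBound u p := by
  rw [incr_mul, incrBound]
  refine (abs_add_le _ _).trans ?_
  rw [abs_mul, abs_mul]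
  have h1 := mul_le_mul_of_nonneg_right (hb.bound p.1) (abs_nonneg (incr u p))
  have h2 := mul_le_mul_of_nonneg_right (hb.lip p.1 p.2) (abs_nonneg (u p.2))
  have h3 : |incr b p| = |b p.1 - b p.2| := rfl
  rw [h3]
  linarith

theorem memLp_weight (hn : 1 ≤ n) (hs : 0 < s) (hs1 : s < 1) {ι : Measure ℝ} [IsFiniteMeasure ι]
    {u : ℝ → Space n → ℝ} (hm : Measurable (Function.uncurry u))
    (hu : MemLp (fun q : ℝ × Space n => u q.1 q.2) 2 (ι.prod volume)) :
    MemLp (fun q : ℝ × Space n × Space n => min 1 ‖q.2.1 - q.2.2‖ * u q.1 q.2.2) 2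
        (ι.prod (nu n s)) := by
  have hm1 : Measurable fun q : ℝ × Space n × Space n => u q.1 q.2.2 :=
    hm.comp (f := fun q : ℝ × Space n × Space n => (q.1, q.2.2)) (by fun_prop)
  have hm2 : Measurable fun q : ℝ × Space n × Space n => min 1 ‖q.2.1 - q.2.2‖ * u q.1 q.2.2 := by
    fun_prop
  rw [memLp_two_iff hm2.aestronglyMeasurable, lintegral_prod _
    (hm2.pow_const 2).ennreal_ofReal.aemeasurable]
  have h := (memLp_two_iff hu.1).1 hu
  have hm3 : Measurable fun q : ℝ × Space n => u q.1 q.2 := hm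
  rw [lintegral_prod _ (hm3.pow_const 2).ennreal_ofReal.aemeasurable] at h
  simp only [mul_pow]
  have h2 : ∀ t, ∫⁻ p, ENNReal.ofReal (min 1 ‖p.1 - p.2‖ ^ 2 * u t p.2 ^ 2) ∂(nu n s) =
      radialMass n s (fun r => min 1 r ^ 2) * ∫⁻ x, ENNReal.ofReal (u t x ^ 2) := fun t =>
    lintegral_radial_mul_sq (hm.comp measurable_prodMk_left).aestronglyMeasurable
  simp only [h2]
  rw [lintegral_const_mul _ (hm3.pow_const 2).ennreal_ofReal.lintegral_prod_right']
  exact ENNReal.mul_lt_top (radialMass_min_lt_top hn hs hs1) h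

theorem memLp_incrBound (hn : 1 ≤ n) (hs : 0 < s) (hs1 : s < 1) {ι : Measure ℝ}
    [IsFiniteMeasure ι] {u : ℝ → Space n → ℝ} (hm : Measurable (Function.uncurry u))
    (hu : MemLp (fun q : ℝ × Space n => u q.1 q.2) 2 (ι.prod volume))
    (hi : MemLp (fun q : ℝ × Space n × Space n => incr (u q.1) q.2) 2 (ι.prod (nu n s))) :
    MemLp (fun q : ℝ × Space n × Space n => incrBound (u q.1) q.2) 2 (ι.prod (nu n s)) := by
  have h := hi.norm.add (memLp_weight hn hs hs1 hm hu).norm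
  refine (memLp_congr_ae (ae_of_all _ fun q => ?_)).1 h
  simp only [Pi.add_apply, incrBound, Real.norm_eq_abs, abs_mul]
  rw [abs_of_nonneg (a := min 1 ‖q.2.1 - q.2.2‖) (by positivity)]

end NPME

/-! ### Duhamel's formula and the Oleinik test function. -/

namespace NPME

variable {n : ℕ} {Ω : Set (Space n)} {T s l L A : ℝ} {K : Space n → Space n → ℝ}
  {a : Space n → ℝ} {w V : ℝ → Space n → ℝ}

/-- The integrand is an exact derivative in `σ`. Keeping the factor `α` avoids a division, so `α =
0` is covered. -/
theorem setIntegral_mul_exp (α : ℝ) {r t : ℝ} (hrt : r ≤ t) :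
    ∫ σ in Ioo r t, α * Real.exp (-α * (t - σ)) = 1 - Real.exp (-α * (t - r)) := by
  rw [← integral_Ioc_eq_integral_Ioo, ← intervalIntegral.integral_of_le hrt]
  have hd : ∀ σ ∈ uIcc r t, HasDerivAt (fun σ => Real.exp (-α * (t - σ)))
      (α * Real.exp (-α * (t - σ))) σ := fun σ _ => by
    have h1 : HasDerivAt (fun σ => -α * (t - σ)) (-α * (0 - 1)) σ :=
      ((hasDerivAt_const σ t).sub (hasDerivAt_id σ)).const_mul (-α)
    convert! h1.exp using 1
    ring
  rw [intervalIntegral.integral_eq_sub_of_hasDerivAt hd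
    ((by fun_prop : Continuous fun σ => α * Real.exp (-α * (t - σ))).intervalIntegrable _ _)]
  simp

theorem integrable_Ioo_of_continuous {f : ℝ → ℝ} (hf : Continuous f) (r t : ℝ) :
    IntegrableOn f (Ioo r t) :=
  (hf.integrableOn_Icc (a := r) (b := t)).mono_set Ioo_subset_Icc_self

/-- Variation of constants, carried out on the test function since `V` has no pointwise time
derivative. The integrated equation at time `σ` is tested with `b_σ χ`, where `b_σ = a e^{-a(t-σ)}`,
and integrated over `0 < σ < t`. As `∫_r^t b_σ dσ = 1 - e^{-a(t-r)}`, Fubini on the triangle yields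
an identity which, added to the equation at time `t`, cancels the zeroth-order terms. -/
theorem IsLinearPair.duhamel_of (h : IsLinearPair Ω T s K a w V) (hn : 1 ≤ n)
    (hs : 0 < s) (hs1 : s < 1) (hΩ : IsOpen Ω) (hK : IsEllipticKernel l L K) (ha : IsBddLip A a)
    {t : ℝ} (htI : t ∈ Ioo 0 T)
    (ht : ∀ χ, MemHsTilde s Ω χ → ∫ x, V t x * χ x =
      -((∫ r in Ioo 0 t, bilinForm s K (w r) χ) +
        ∫ r in Ioo 0 t, ∫ x, V r x * (a x * χ x)))
    (hall : ∀ᵐ σ ∂(volume.restrict (Ioo 0 t)), ∀ χ, MemHsTilde s Ω χ → ∫ x, V σ x * χ x =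
      -((∫ r in Ioo 0 σ, bilinForm s K (w r) χ) +
        ∫ r in Ioo 0 σ, ∫ x, V r x * (a x * χ x)))
    {χ : Space n → ℝ} (hχm : Measurable χ) (hχ : MemHsTilde s Ω χ) :
    ∫ x, V t x * χ x =
      -∫ r in Ioo 0 t, bilinForm s K (w r) fun x => Real.exp (-a x * (t - r)) * χ x := by
  have htT : t ≤ T := htI.2.le
  obtain ⟨hχ1, hχ2⟩ := (hsNormSq_lt_top_iff hn hs hχ.1).1 (hχ.hsNormSq_lt_top hn hs hs1)
  have ham : Measurable a := ha.continuous.measurable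
  have habs : ∀ σ ∈ Ioo 0 t, |t - σ| ≤ t := fun σ hσ => by
    rw [abs_of_nonneg] <;> linarith [hσ.1, hσ.2]
  set C := Real.exp (A * t) * (1 + A * t) with hC
  have hE : ∀ σ ∈ Ioo 0 t, IsBddLip C fun x => Real.exp (-a x * (t - σ)) := fun σ hσ =>
    ha.exp (habs σ hσ)
  have hC0 : 0 ≤ C := (hE (t / 2) ⟨by linarith [htI.1], by linarith [htI.1]⟩).nonneg
  have hA0 := ha.nonneg
  set b : ℝ → Space n → ℝ := fun σ x => a x * Real.exp (-a x * (t - σ)) with hb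
  have hbl : ∀ σ ∈ Ioo 0 t, IsBddLip (2 * A * C) (b σ) := fun σ hσ => ha.mul (hE σ hσ)
  have hB0 : 0 ≤ 2 * A * C := by positivity
  have hgK := memLp_mono_time htT (h.memLp_K hK)
  have hgV := memLp_mono_time htT h.memLp_V
  have hH1 : MemLp (fun q : ℝ × Space n × Space n => incrBound χ q.2) 2
      ((volume.restrict (Ioo 0 t)).prod (nu n s)) :=
    memLp_incrBound hn hs hs1 (u := fun _ => χ) (hχm.comp measurable_snd)
      (memLp_comp_snd hχ1) (memLp_comp_snd hχ2)
  -- the nonlocal term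
  have hm1 : Measurable fun q : (ℝ × ℝ) × Space n × Space n =>
      incr (fun x => b q.1.2 x * χ x) q.2 := by
    simp only [incr, hb]; fun_prop
  have hb1 : ∀ τ ∈ Ioo 0 t, ∀ σ ∈ Ioo 0 t, ∀ z, |incr (fun x => b σ x * χ x) z| ≤
      |2 * A * C * incrBound χ z| := fun τ _ σ hσ z =>
    ((hbl σ hσ).abs_incr_mul_le χ z).trans (le_abs_self _)
  have key1 := integral_triangle_pairing (g := fun r p => K p.1 p.2 * incr (w r) p)
    (h := fun _ σ => incr (fun x => b σ x * χ x)) (H := fun _ p => 2 * A * C * incrBound χ p)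
    hgK (hH1.const_mul _) hm1 hb1
  have int1 := integrableOn_triangle_pairing (g := fun r p => K p.1 p.2 * incr (w r) p)
    (h := fun _ σ => incr (fun x => b σ x * χ x)) (H := fun _ p => 2 * A * C * incrBound χ p)
    hgK (hH1.const_mul _) hm1 hb1
  -- the local term
  have hm2 : Measurable fun q : (ℝ × ℝ) × Space n => a q.2 * (b q.1.2 q.2 * χ q.2) := by
    simp only [hb]; fun_prop
  have hb2 : ∀ τ ∈ Ioo 0 t, ∀ σ ∈ Ioo 0 t, ∀ x, |a x * (b σ x * χ x)| ≤
      |A * (2 * A * C) * χ x| := fun τ _ σ hσ x => by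
    rw [← mul_assoc, abs_mul, abs_mul, abs_mul (A * (2 * A * C)),
      abs_of_nonneg (mul_nonneg hA0 hB0)]
    exact mul_le_mul_of_nonneg_right (mul_le_mul (ha.bound x) ((hbl σ hσ).bound x)
      (abs_nonneg _) hA0) (abs_nonneg _)
  have key2 := integral_triangle_pairing (g := V)
    (h := fun _ σ x => a x * (b σ x * χ x)) (H := fun _ x => A * (2 * A * C) * χ x)
    hgV ((memLp_comp_snd hχ1).const_mul _) hm2 hb2
  have int2 := integrableOn_triangle_pairing (g := V)
    (h := fun _ σ x => a x * (b σ x * χ x)) (H := fun _ x => A * (2 * A * C) * χ x)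
    hgV ((memLp_comp_snd hχ1).const_mul _) hm2 hb2
  have hbσ : ∀ x, ∀ r ≤ t, ∫ σ in Ioo r t, b σ x = 1 - Real.exp (-a x * (t - r)) := fun x r hr =>
    setIntegral_mul_exp (a x) hr
  have hbc : ∀ x, Continuous fun σ => b σ x := fun x => by simp only [hb]; fun_prop
  -- the test function `b σ χ` inserted into the integrated equation
  have hX : ∫ σ in Ioo 0 t, ∫ x, V σ x * (b σ x * χ x) =
      -((∫ σ in Ioo 0 t, ∫ r in Ioo 0 σ, ∫ p, K p.1 p.2 * incr (w r) p *
          incr (fun x => b σ x * χ x) p ∂(nu n s)) +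
        ∫ σ in Ioo 0 t, ∫ r in Ioo 0 σ, ∫ x, V r x * (a x * (b σ x * χ x))) := by
    rw [← integral_add int1 int2, ← integral_neg]
    refine integral_congr_ae ?_
    filter_upwards [hall, ae_restrict_mem measurableSet_Ioo] with σ hσ hσI
    rw [hσ _ (hχ.mul hn hs hs1 hΩ (hbl σ hσI))]
    simp only [bilinForm_eq']
  have hEm : ∀ r ∈ Ioo 0 t, MemLp (incr fun x => Real.exp (-a x * (t - r)) * χ x) 2 (nu n s) ∧
      MemLp (fun x => Real.exp (-a x * (t - r)) * χ x) 2 volume := fun r hr => by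
    have h1 := hχ.mul hn hs hs1 hΩ (hE r hr)
    have := (hsNormSq_lt_top_iff hn hs h1.1).1 (h1.hsNormSq_lt_top hn hs hs1)
    exact ⟨this.2, this.1⟩
  -- the two triangle integrals
  have hm3 : Measurable fun q : ℝ × Space n × Space n =>
      incr (fun x => Real.exp (-a x * (t - q.1)) * χ x) q.2 := by
    simp only [incr]; fun_prop
  have hI : ∀ᵐ q : ℝ × Space n × Space n ∂((volume.restrict (Ioo 0 t)).prod (nu n s)),
      q.1 ∈ Ioo 0 t :=
    Measure.quasiMeasurePreserving_fst.ae (ae_restrict_mem measurableSet_Ioo)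
  have hI' : ∀ᵐ q : ℝ × Space n ∂((volume.restrict (Ioo 0 t)).prod volume),
      q.1 ∈ Ioo 0 t :=
    Measure.quasiMeasurePreserving_fst.ae (ae_restrict_mem measurableSet_Ioo)
  have hL3 : MemLp (fun q : ℝ × Space n × Space n =>
      incr (fun x => Real.exp (-a x * (t - q.1)) * χ x) q.2) 2
      ((volume.restrict (Ioo 0 t)).prod (nu n s)) := by
    refine (hH1.const_mul C).of_le hm3.aestronglyMeasurable ?_
    filter_upwards [hI] with q hq
    exact ((hE _ hq).abs_incr_mul_le χ _).trans (le_abs_self _)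
  have i3 : IntegrableOn (fun r => bilinForm s K (w r) fun x => Real.exp (-a x * (t - r)) * χ x)
      (Ioo 0 t) := by
    simp only [bilinForm_eq']
    exact (hgK.integrable_mul hL3).integral_prod_left
  have i4 : IntegrableOn (fun r => bilinForm s K (w r) χ) (Ioo 0 t) :=
    (h.integrable_bilinForm hK hχ2).mono_set (Ioo_subset_Ioo_right htT)
  have e1 : ∫ r in Ioo 0 t, ∫ p, K p.1 p.2 * incr (w r) p *
      (∫ σ in Ioo r t, incr (fun x => b σ x * χ x) p) ∂(nu n s) =
      (∫ r in Ioo 0 t, bilinForm s K (w r) χ) -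
        ∫ r in Ioo 0 t, bilinForm s K (w r) fun x => Real.exp (-a x * (t - r)) * χ x := by
    rw [← integral_sub i4 i3]
    refine integral_congr_ae ?_
    filter_upwards [ae_memLp_slice (g := fun r p => K p.1 p.2 * incr (w r) p) hgK,
      ae_restrict_mem measurableSet_Ioo] with r hr hrI
    rw [bilinForm_eq', bilinForm_eq', integral_mul_sub_integral_mul hr hχ2 (hEm r hrI).1]
    refine integral_congr_ae (ae_of_all _ fun p => ?_)
    have : ∫ σ in Ioo r t, incr (fun x => b σ x * χ x) p =
        incr χ p - incr (fun x => Real.exp (-a x * (t - r)) * χ x) p := by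
      simp only [incr]
      rw [integral_sub ((integrable_Ioo_of_continuous (hbc _) _ _).mul_const _)
        ((integrable_Ioo_of_continuous (hbc _) _ _).mul_const _), integral_mul_const,
        integral_mul_const, hbσ _ _ hrI.2.le, hbσ _ _ hrI.2.le]
      ring
    beta_reduce
    rw [this]
  have hm4 : Measurable fun q : ℝ × Space n =>
      a q.2 * (Real.exp (-a q.2 * (t - q.1)) * χ q.2) := by fun_prop
  have hL4 : MemLp (fun q : ℝ × Space n => a q.2 * (Real.exp (-a q.2 * (t - q.1)) * χ q.2)) 2
      ((volume.restrict (Ioo 0 t)).prod volume) := by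
    refine ((memLp_comp_snd hχ1).const_mul (A * C)).of_le hm4.aestronglyMeasurable ?_
    filter_upwards [hI'] with q hq
    rw [← mul_assoc, norm_mul, norm_mul, norm_mul (A * C), Real.norm_of_nonneg
      (mul_nonneg hA0 hC0)]
    exact mul_le_mul_of_nonneg_right (mul_le_mul (ha.bound _) ((hE _ hq).bound _)
      (abs_nonneg _) hA0) (norm_nonneg _)
  have i5 : IntegrableOn (fun r => ∫ x, V r x * (a x * (Real.exp (-a x * (t - r)) * χ x)))
      (Ioo 0 t) := (hgV.integrable_mul hL4).integral_prod_left
  have i6 : IntegrableOn (fun r => ∫ x, V r x * (a x * χ x)) (Ioo 0 t) :=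
    integrable_pairing hgV (ha.memLp_mul hχ1)
  -- Since `a e^{-a(t-r)} = b_r`, the last integral is the left side of `hX`. It drops out, leaving
  -- `∫ B_K(w,χ) + ∫∫ V a χ = ∫ B_K(w, e^{-a(t-r)} χ)`.
  have e2 : ∫ r in Ioo 0 t, ∫ x, V r x * (∫ σ in Ioo r t, a x * (b σ x * χ x)) =
      (∫ r in Ioo 0 t, ∫ x, V r x * (a x * χ x)) -
        ∫ r in Ioo 0 t, ∫ x, V r x * (b r x * χ x) := by
    have h0 : ∫ r in Ioo 0 t, ∫ x, V r x * (b r x * χ x) =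
        ∫ r in Ioo 0 t, ∫ x, V r x * (a x * (Real.exp (-a x * (t - r)) * χ x)) := by
      simp only [hb, mul_assoc]
    rw [h0, ← integral_sub i6 i5]
    refine integral_congr_ae ?_
    filter_upwards [ae_memLp_slice hgV, ae_restrict_mem measurableSet_Ioo] with r hr hrI
    rw [integral_mul_sub_integral_mul hr (ha.memLp_mul hχ1)
      (ha.memLp_mul (hEm r hrI).2)]
    refine integral_congr_ae (ae_of_all _ fun x => ?_)
    beta_reduce
    rw [integral_const_mul, integral_mul_const, hbσ _ _ hrI.2.le]
    ring
  rw [key1, key2, e1, e2] at hX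
  rw [ht χ hχ]
  linarith

theorem IsLinearPair.duhamel (h : IsLinearPair Ω T s K a w V) (hT : 0 < T) (hn : 1 ≤ n)
    (hs : 0 < s) (hs1 : s < 1) (hΩ : IsOpen Ω) (hK : IsEllipticKernel l L K) (ha : IsBddLip A a) :
    ∀ᵐ t ∂(volume.restrict (Ioo 0 T)), ∀ χ, Measurable χ → MemHsTilde s Ω χ →
      ∫ x, V t x * χ x =
      -∫ r in Ioo 0 t, bilinForm s K (w r) fun x => Real.exp (-a x * (t - r)) * χ x := by
  have hall := h.ae_forall hT hn hs hs1 hK ha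
  filter_upwards [hall, ae_restrict_mem measurableSet_Ioo] with t ht htI χ hχm hχ
  exact h.duhamel_of hn hs hs1 hΩ hK ha htI ht
    (ae_mono (Measure.restrict_mono (Ioo_subset_Ioo_right htI.2.le) le_rfl) hall) hχm hχ

/-- Testing the equation with `∫ₜᵀ exp (-a (σ - t) - μ σ) w(σ) dσ`. -/
theorem IsLinearPair.integral_pairing_eq (h : IsLinearPair Ω T s K a w V) (hT : 0 < T)
    (hn : 1 ≤ n) (hs : 0 < s) (hs1 : s < 1) (hΩ : IsOpen Ω) (hK : IsEllipticKernel l L K)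
    (ha : IsBddLip A a) {μ : ℝ} (hμ : 0 ≤ μ) :
    ∫ t in Ioo 0 T, ∫ x, V t x * (Real.exp (-μ * t) * w t x) =
      -∫ τ in Ioo 0 T, ∫ p, K p.1 p.2 * incr (w τ) p *
        (∫ σ in Ioo τ T, incr (fun x => Real.exp (-a x * (σ - τ)) * (Real.exp (-μ * σ) * w σ x)) p)
          ∂(nu n s) := by
  have hwm := h.measurable_w
  have ham : Measurable a := ha.continuous.measurable
  have hexp : ∀ σ ∈ Ioo 0 T, |Real.exp (-μ * σ)| ≤ 1 := fun σ hσ => by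
    rw [Real.abs_exp, Real.exp_le_one_iff]
    nlinarith [hσ.1]
  set C := Real.exp (A * T) * (1 + A * T) with hC
  have hH := memLp_incrBound hn hs hs1 hwm h.memLp_w h.memLp_incr
  have hm : Measurable fun q : (ℝ × ℝ) × Space n × Space n => incr (fun x =>
      Real.exp (-a x * (q.1.2 - q.1.1)) * (Real.exp (-μ * q.1.2) * w q.1.2 x)) q.2 := by
    have e1 : Measurable fun q : (ℝ × ℝ) × Space n × Space n => w q.1.2 q.2.1 :=
      hwm.comp (f := fun q : (ℝ × ℝ) × Space n × Space n => (q.1.2, q.2.1)) (by fun_prop)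
    have e2 : Measurable fun q : (ℝ × ℝ) × Space n × Space n => w q.1.2 q.2.2 :=
      hwm.comp (f := fun q : (ℝ × ℝ) × Space n × Space n => (q.1.2, q.2.2)) (by fun_prop)
    simp only [incr]; fun_prop
  have hb : ∀ τ ∈ Ioo 0 T, ∀ σ ∈ Ioo 0 T, ∀ z, |incr (fun x =>
      Real.exp (-a x * (σ - τ)) * (Real.exp (-μ * σ) * w σ x)) z| ≤
      |C * incrBound (w σ) z| := fun τ hτ σ hσ z => by
    have h1 : IsBddLip C fun x => Real.exp (-a x * (σ - τ)) :=
      ha.exp (by rw [abs_le]; constructor <;> linarith [hτ.1, hτ.2, hσ.1, hσ.2])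
    have h2 := (h1.const_mul (hexp σ hσ)).abs_incr_mul_le (w σ) z
    refine le_trans (le_of_eq ?_) (h2.trans (le_abs_self _))
    congr 2
    ext x
    ring
  rw [← integral_triangle_pairing (g := fun τ p => K p.1 p.2 * incr (w τ) p)
    (h := fun τ σ => incr fun x => Real.exp (-a x * (σ - τ)) * (Real.exp (-μ * σ) * w σ x))
    (H := fun σ p => C * incrBound (w σ) p) (h.memLp_K hK) (hH.const_mul C) hm hb, ← integral_neg]
  refine integral_congr_ae ?_
  -- Duhamel's formula is used at time `t` with `χ = e^{-μt} w(t)`; the constant factor counts as a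
  -- Lipschitz multiplier.
  filter_upwards [h.duhamel hT hn hs hs1 hΩ hK ha, h.memHsTilde, ae_restrict_mem measurableSet_Ioo]
    with t ht ht2 htI
  have hc : IsBddLip (Real.exp (-μ * t)) fun _ : Space n => Real.exp (-μ * t) :=
    ⟨fun x => (Real.abs_exp _).le, fun x y => by rw [sub_self, abs_zero]; positivity⟩
  rw [ht _ (by
    have : Measurable (w t) := hwm.comp measurable_prodMk_left
    fun_prop) (ht2.mul hn hs hs1 hΩ hc)]
  simp only [bilinForm_eq']

end NPME

/-! ### The energy inequality for a pair of points. -/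

namespace NPME

/-- The energy identity behind the positivity of the nonlocal term, for a pair of points. -/
theorem energy_inequality {T μ α β κ : ℝ} (hT : 0 < T) (hα : 0 ≤ α)
    (hκ : (α - β) ^ 2 ≤ κ) {p r : ℝ → ℝ} (hp : IntegrableOn p (Ioo 0 T))
    (hr : IntegrableOn r (Ioo 0 T)) {P R : ℝ → ℝ}
    (hP : ∀ τ ∈ Ioo 0 T, P τ = ∫ σ in Ioo τ T, Real.exp (-α * (σ - τ)) *
      (Real.exp (-μ * σ) * p σ))
    (hR : ∀ τ ∈ Ioo 0 T, R τ = ∫ σ in Ioo τ T, Real.exp (-β * (σ - τ)) *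
      (Real.exp (-μ * σ) * r σ)) :
    ∫ τ in Ioo 0 T, Real.exp (μ * τ) * ((μ - 1) / 2 * (P τ - R τ) ^ 2 - κ / 2 * R τ ^ 2) ≤
      ∫ τ in Ioo 0 T, (p τ - r τ) * (P τ - R τ) := by
  have aux : ∀ (γ : ℝ) (f : ℝ → ℝ), IntegrableOn f (Ioo 0 T) → ∃ F : ℝ → ℝ,
      AbsolutelyContinuousOnInterval F 0 T ∧ F T = 0 ∧
      (∀ τ ∈ Ioo 0 T, F τ = ∫ σ in Ioo τ T, Real.exp (-γ * (σ - τ)) *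
        (Real.exp (-μ * σ) * f σ)) ∧
      ∀ᵐ τ, τ ∈ Ioo 0 T → HasDerivAt F (γ * F τ - Real.exp (-μ * τ) * f τ) τ := by
    intro γ f hf
    have hi : IntervalIntegrable (fun σ => Real.exp (-(γ + μ) * σ) * f σ) volume 0 T := by
      refine IntervalIntegrable.continuousOn_mul ?_ (by fun_prop)
      rwa [intervalIntegrable_iff_integrableOn_Ioo_of_le hT.le]
    have hac := hi.absolutelyContinuousOnInterval_intervalIntegral (c := T) (by simp)
    have hexp : AbsolutelyContinuousOnInterval (fun τ => -Real.exp (γ * τ)) 0 T :=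
      ContDiffOn.absolutelyContinuousOnInterval
        (by fun_prop : ContDiff ℝ 1 fun τ => -Real.exp (γ * τ)).contDiffOn
    refine ⟨_, hexp.mul hac, by simp, fun τ hτ => ?_, ?_⟩
    · rw [Pi.mul_apply, intervalIntegral.integral_symm, intervalIntegral.integral_of_le hτ.2.le,
        integral_Ioc_eq_integral_Ioo, neg_mul_neg, ← integral_const_mul]
      refine setIntegral_congr_fun measurableSet_Ioo fun σ _ => ?_
      rw [← mul_assoc, ← mul_assoc, ← Real.exp_add, ← Real.exp_add]
      ring_nf
    · filter_upwards [hi.ae_hasDerivAt_integral] with τ h1 hτ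
      have hτ' : τ ∈ uIcc 0 T := by
        rw [uIcc_of_le hT.le]; exact Ioo_subset_Icc_self hτ
      have h2 := h1 hτ' T (by simp)
      have h3 : HasDerivAt (fun τ => -Real.exp (γ * τ)) (-(Real.exp (γ * τ) * (γ * 1))) τ :=
        (((hasDerivAt_id τ).const_mul γ).exp).neg
      convert! h3.mul h2 using 1
      simp only [Pi.mul_apply]
      have h4 : Real.exp (-μ * τ) = Real.exp (γ * τ) * Real.exp (-(γ + μ) * τ) := by
        rw [← Real.exp_add]; ring_nf
      rw [h4]
      ring
  obtain ⟨F, hF1, hF2, hF3, hF4⟩ := aux α p hp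
  obtain ⟨G, hG1, hG2, hG3, hG4⟩ := aux β r hr
  have eP : ∀ τ ∈ Ioo 0 T, P τ = F τ := fun τ hτ => (hP τ hτ).trans (hF3 τ hτ).symm
  have eR : ∀ τ ∈ Ioo 0 T, R τ = G τ := fun τ hτ => (hR τ hτ).trans (hG3 τ hτ).symm
  have hexp : AbsolutelyContinuousOnInterval (fun τ => Real.exp (μ * τ) / 2) 0 T :=
    ContDiffOn.absolutelyContinuousOnInterval
      (by fun_prop : ContDiff ℝ 1 fun τ => Real.exp (μ * τ) / 2).contDiffOn
  -- The energy is `e^{μτ} (F-G)²/2`. Its derivative is `e^{μτ} (μ/2 (F-G)² + (αF-βG)(F-G)) -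
  -- (p-r)(F-G)`; it vanishes at `T` and is nonnegative at 0.
  have hE := hexp.mul ((hF1.sub hG1).mul (hF1.sub hG1))
  have hFTC := hE.integral_deriv_eq_sub
  have hcF : ContinuousOn F (Icc 0 T) := by
    have := hF1.continuousOn; rwa [uIcc_of_le hT.le] at this
  have hcG : ContinuousOn G (Icc 0 T) := by
    have := hG1.continuousOn; rwa [uIcc_of_le hT.le] at this
  have i1 : IntegrableOn (fun τ => (p τ - r τ) * (F τ - G τ)) (Ioo 0 T) := by
    have hpr : IntegrableOn (fun τ => p τ - r τ) (Icc 0 T) := by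
      rw [integrableOn_Icc_iff_integrableOn_Ioo]
      exact hp.sub hr
    exact (hpr.mul_continuousOn (hcF.sub hcG) isCompact_Icc).mono_set Ioo_subset_Icc_self
  have i2 : IntegrableOn (fun τ => Real.exp (μ * τ) * (μ / 2 * (F τ - G τ) ^ 2 +
      (α * F τ - β * G τ) * (F τ - G τ))) (Ioo 0 T) := by
    refine (ContinuousOn.integrableOn_Icc ?_).mono_set Ioo_subset_Icc_self
    fun_prop
  have i3 : IntegrableOn (fun τ => Real.exp (μ * τ) *
      ((μ - 1) / 2 * (F τ - G τ) ^ 2 - κ / 2 * G τ ^ 2)) (Ioo 0 T) := by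
    refine (ContinuousOn.integrableOn_Icc ?_).mono_set Ioo_subset_Icc_self
    fun_prop
  have e1 : ∫ τ in (0 : ℝ)..T, deriv ((fun τ => Real.exp (μ * τ) / 2) *
      ((F - G) * (F - G))) τ = (∫ τ in Ioo 0 T, Real.exp (μ * τ) * (μ / 2 * (F τ - G τ) ^ 2 +
      (α * F τ - β * G τ) * (F τ - G τ))) - ∫ τ in Ioo 0 T, (p τ - r τ) * (F τ - G τ) := by
    rw [← integral_sub i2 i1, intervalIntegral.integral_of_le hT.le,
      integral_Ioc_eq_integral_Ioo]
    refine setIntegral_congr_ae measurableSet_Ioo ?_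
    filter_upwards [hF4, hG4] with τ h1 h2 hτ
    have h3 : HasDerivAt (fun τ => Real.exp (μ * τ) / 2) (Real.exp (μ * τ) * (μ * 1) / 2) τ :=
      (((hasDerivAt_id τ).const_mul μ).exp).div_const 2
    have h4 := (h1 hτ).sub (h2 hτ)
    rw [(h3.mul (h4.mul h4)).deriv]
    simp only [Pi.sub_apply, Pi.mul_apply]
    have h5 : Real.exp (μ * τ) * Real.exp (-μ * τ) = 1 := by
      rw [← Real.exp_add]; simp
    linear_combination (-(p τ - r τ) * (F τ - G τ)) * h5
  have e2 : 0 ≤ Real.exp (μ * 0) / 2 * ((F 0 - G 0) * (F 0 - G 0)) :=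
    mul_nonneg (by positivity) (mul_self_nonneg _)
  rw [e1] at hFTC
  simp only [Pi.mul_apply, Pi.sub_apply, hF2, hG2, sub_zero, mul_zero, zero_sub] at hFTC e2
  have e3 : ∫ τ in Ioo 0 T, Real.exp (μ * τ) *
      ((μ - 1) / 2 * (F τ - G τ) ^ 2 - κ / 2 * G τ ^ 2) ≤
      ∫ τ in Ioo 0 T, Real.exp (μ * τ) * (μ / 2 * (F τ - G τ) ^ 2 +
      (α * F τ - β * G τ) * (F τ - G τ)) := by
    refine setIntegral_mono i3 i2 fun τ => mul_le_mul_of_nonneg_left ?_ (Real.exp_pos _).le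
    -- From `αF - βG = α(F-G) + (α-β)G`: the `α` term has a good sign, and Young's inequality on the
    -- cross term costs half of `(F-G)²` and half of `κ G²`.
    nlinarith [sq_nonneg ((F τ - G τ) + (α - β) * G τ), mul_nonneg hα (sq_nonneg (F τ - G τ)),
      mul_le_mul_of_nonneg_right hκ (sq_nonneg (G τ))]
  have e4 : ∫ τ in Ioo 0 T, Real.exp (μ * τ) * ((μ - 1) / 2 * (P τ - R τ) ^ 2 -
      κ / 2 * R τ ^ 2) = ∫ τ in Ioo 0 T, Real.exp (μ * τ) *
      ((μ - 1) / 2 * (F τ - G τ) ^ 2 - κ / 2 * G τ ^ 2) :=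
    setIntegral_congr_fun measurableSet_Ioo fun τ hτ => by simp only [eP τ hτ, eR τ hτ]
  have e5 : ∫ τ in Ioo 0 T, (p τ - r τ) * (P τ - R τ) =
      ∫ τ in Ioo 0 T, (p τ - r τ) * (F τ - G τ) :=
    setIntegral_congr_fun measurableSet_Ioo fun τ hτ => by simp only [eP τ hτ, eR τ hτ]
  rw [e4, e5]
  linarith

/-! ### Tail integrals in time as square-integrable functions. -/

section Tail

variable {Z : Type*} {T : ℝ}

/-- `∫ₜᵀ h(τ, σ, z) dσ`, written so as to be jointly measurable in `τ` and `z`. -/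
noncomputable def tailInt (T : ℝ) (h : ℝ → ℝ → Z → ℝ) (τ : ℝ) (z : Z) : ℝ :=
  ∫ σ in Ioo 0 T, (Ioi τ).indicator (fun σ => h τ σ z) σ

theorem tailInt_eq {h : ℝ → ℝ → Z → ℝ} {τ : ℝ} (hτ : 0 ≤ τ) (z : Z) :
    tailInt T h τ z = ∫ σ in Ioo τ T, h τ σ z :=
  (setIntegral_Ioo_eq_indicator_right hτ _).symm

variable [MeasurableSpace Z]

theorem measurable_tailInt_integrand {h : ℝ → ℝ → Z → ℝ}
    (hh : Measurable fun q : (ℝ × ℝ) × Z => h q.1.1 q.1.2 q.2) :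
    Measurable fun q : (ℝ × Z) × ℝ => (Ioi q.1.1).indicator (fun σ => h q.1.1 σ q.1.2) q.2 := by
  have h1 : Measurable fun q : (ℝ × Z) × ℝ => h q.1.1 q.2 q.1.2 :=
    hh.comp (f := fun q : (ℝ × Z) × ℝ => ((q.1.1, q.2), q.1.2)) (by fun_prop)
  have hS : MeasurableSet {q : (ℝ × Z) × ℝ | q.1.1 < q.2} :=
    measurableSet_lt (by fun_prop) (by fun_prop)
  exact h1.indicator hS

theorem measurable_tailInt {h : ℝ → ℝ → Z → ℝ}
    (hh : Measurable fun q : (ℝ × ℝ) × Z => h q.1.1 q.1.2 q.2) :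
    Measurable fun q : ℝ × Z => tailInt T h q.1 q.2 :=
  ((measurable_tailInt_integrand hh).stronglyMeasurable.integral_prod_right').measurable

theorem memLp_tailInt {μ : Measure Z} [SFinite μ] {h : ℝ → ℝ → Z → ℝ} {H : ℝ → Z → ℝ}
    (hH : MemLp (fun q : ℝ × Z => H q.1 q.2) 2 ((volume.restrict (Ioo 0 T)).prod μ))
    (hh : Measurable fun q : (ℝ × ℝ) × Z => h q.1.1 q.1.2 q.2)
    (hb : ∀ τ ∈ Ioo 0 T, ∀ σ ∈ Ioo 0 T, ∀ z, |h τ σ z| ≤ |H σ z|) :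
    MemLp (fun q : ℝ × Z => tailInt T h q.1 q.2) 2 ((volume.restrict (Ioo 0 T)).prod μ) := by
  have hm := measurable_tailInt (T := T) hh
  rw [memLp_two_iff hm.aestronglyMeasurable]
  have hHl := (memLp_two_iff hH.1).1 hH
  rw [lintegral_prod_symm _ (hH.1.aemeasurable.pow_const 2).ennreal_ofReal] at hHl
  have hbound : ∀ τ ∈ Ioo 0 T, ∀ z, ENNReal.ofReal (tailInt T h τ z ^ 2) ≤
      volume (Ioo 0 T) * ∫⁻ σ in Ioo 0 T, ENNReal.ofReal (H σ z ^ 2) := by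
    intro τ hτ z
    have hmz : Measurable fun σ => (Ioi τ).indicator (fun σ => h τ σ z) σ :=
      (measurable_tailInt_integrand hh).comp (f := fun σ => ((τ, z), σ)) (by fun_prop)
    have h1 := enorm_integral_mul_le (μ := volume.restrict (Ioo 0 T)) (g := fun _ => (1 : ℝ))
      (d := fun σ => (Ioi τ).indicator (fun σ => h τ σ z) σ) aestronglyMeasurable_const
      hmz.aestronglyMeasurable
    simp only [one_mul, one_pow, ENNReal.ofReal_one, lintegral_const, Measure.restrict_apply,
      MeasurableSet.univ, univ_inter] at h1
    have h2 := pow_le_pow_left₀ bot_le h1 2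
    rw [mul_pow, ← ENNReal.rpow_natCast, ← ENNReal.rpow_natCast, ← ENNReal.rpow_natCast,
      ← ENNReal.rpow_mul, ← ENNReal.rpow_mul] at h2
    simp only [Nat.cast_ofNat, one_div, isUnit_iff_ne_zero, ne_eq, OfNat.ofNat_ne_zero,
      not_false_eq_true, IsUnit.inv_mul_cancel, ENNReal.rpow_one] at h2
    rw [← enorm_sq_eq_ofReal]
    have h3 : ‖tailInt T h τ z‖ₑ ^ 2 ≤ volume (Ioo 0 T) * ∫⁻ σ in Ioo 0 T,
        ENNReal.ofReal ((Ioi τ).indicator (fun σ => h τ σ z) σ ^ 2) := by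
      unfold tailInt
      simpa using h2
    refine h3.trans (mul_le_mul_right (setLIntegral_mono' measurableSet_Ioo fun σ hσ => ?_) _)
    refine ENNReal.ofReal_le_ofReal ?_
    by_cases hτσ : σ ∈ Ioi τ
    · rw [indicator_of_mem hτσ]
      exact sq_le_sq.2 (hb τ hτ σ hσ z)
    · rw [indicator_of_notMem hτσ]
      simp [sq_nonneg]
  rw [lintegral_prod_symm _ (hm.pow_const 2).ennreal_ofReal.aemeasurable]
  calc ∫⁻ z, (∫⁻ τ in Ioo 0 T, ENNReal.ofReal (tailInt T h τ z ^ 2)) ∂μ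
      ≤ ∫⁻ z, volume (Ioo 0 T) * ((∫⁻ σ in Ioo 0 T, ENNReal.ofReal (H σ z ^ 2)) *
          volume (Ioo 0 T)) ∂μ := by
        refine lintegral_mono fun z => ?_
        refine (setLIntegral_mono' measurableSet_Ioo fun τ hτ => hbound τ hτ z).trans ?_
        rw [setLIntegral_const, mul_assoc]
    _ = volume (Ioo 0 T) * ((∫⁻ z, (∫⁻ σ in Ioo 0 T, ENNReal.ofReal (H σ z ^ 2)) ∂μ) *
          volume (Ioo 0 T)) := by
        rw [lintegral_const_mul' _ _ (by simp), lintegral_mul_const' _ _ (by simp)]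
    _ < ⊤ := ENNReal.mul_lt_top (by simp) (ENNReal.mul_lt_top hHl (by simp))

end Tail

end NPME

/-! ### Nonpositivity of the weighted pairing. -/

namespace NPME

variable {n : ℕ} {Ω : Set (Space n)} {T s l L A : ℝ} {K : Space n → Space n → ℝ}
  {a : Space n → ℝ} {w V : ℝ → Space n → ℝ}

theorem ae_integrableOn_slice {Z : Type*} [MeasurableSpace Z] {μ : Measure Z} [SFinite μ]
    {g : ℝ → Z → ℝ} (hm : Measurable fun q : ℝ × Z => g q.1 q.2)
    (hg : MemLp (fun q : ℝ × Z => g q.1 q.2) 2 ((volume.restrict (Ioo 0 T)).prod μ)) :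
    ∀ᵐ z ∂μ, IntegrableOn (fun t => g t z) (Ioo 0 T) := by
  have h := (memLp_two_iff hg.1).1 hg
  have hm2 := (hm.pow_const 2).ennreal_ofReal
  rw [lintegral_prod_symm _ hm2.aemeasurable] at h
  filter_upwards [ae_lt_top hm2.lintegral_prod_left' h.ne] with z hz
  have hmz : Measurable fun t => g t z := hm.comp measurable_prodMk_right
  exact ((memLp_two_iff hmz.aestronglyMeasurable).2 hz).integrable one_le_two

/-- The weight integrates to its radial mass times the squared `L²` norm, and the Poincaré bound
converts this into the Gagliardo seminorm. It makes the error from the variation of `a` absorbable.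
-/
theorem integral_weight_le (hn : 1 ≤ n) (hs : 0 < s) (hs1 : s < 1) {C : ℝ} (hC : 0 ≤ C)
    {u : Space n → ℝ} (hm : Measurable u) (hi : MemLp (incr u) 2 (nu n s))
    (hC' : ∫⁻ x, ENNReal.ofReal (u x ^ 2) ≤
      ENNReal.ofReal C * ∫⁻ p, ENNReal.ofReal (incr u p ^ 2) ∂(nu n s)) :
    Integrable (fun p : Space n × Space n => min 1 ‖p.1 - p.2‖ ^ 2 * u p.2 ^ 2) (nu n s) ∧
    ∫ p : Space n × Space n, min 1 ‖p.1 - p.2‖ ^ 2 * u p.2 ^ 2 ∂(nu n s) ≤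
      (radialMass n s fun r => min 1 r ^ 2).toReal * C * ∫ p, incr u p ^ 2 ∂(nu n s) := by
  have h1 := lintegral_radial_mul_sq (s := s) hm.aestronglyMeasurable
  have hM := (radialMass_min_lt_top hn hs hs1).ne
  have hX := hi.integrable_sq
  have h2 : ∫⁻ p, ENNReal.ofReal (min 1 ‖p.1 - p.2‖ ^ 2 * u p.2 ^ 2) ∂(nu n s) ≤
      ENNReal.ofReal ((radialMass n s fun r => min 1 r ^ 2).toReal * C *
        ∫ p, incr u p ^ 2 ∂(nu n s)) := by
    rw [h1, ENNReal.ofReal_mul (by positivity), ENNReal.ofReal_mul (by positivity),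
      ENNReal.ofReal_toReal hM, ofReal_integral_eq_lintegral_ofReal hX
      (ae_of_all _ fun _ => sq_nonneg _), mul_assoc]
    exact mul_le_mul_right hC' _
  have hmm : Measurable fun p : Space n × Space n => min 1 ‖p.1 - p.2‖ ^ 2 * u p.2 ^ 2 := by
    fun_prop
  have h3 : Integrable (fun p : Space n × Space n => min 1 ‖p.1 - p.2‖ ^ 2 * u p.2 ^ 2)
      (nu n s) :=
    (lintegral_ofReal_ne_top_iff_integrable hmm.aestronglyMeasurable
      (ae_of_all _ fun _ => by positivity)).1 (h2.trans_lt ENNReal.ofReal_lt_top).ne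
  refine ⟨h3, ?_⟩
  rw [← ofReal_integral_eq_lintegral_ofReal h3 (ae_of_all _ fun _ => by positivity)] at h2
  refine (ENNReal.ofReal_le_ofReal_iff ?_).1 h2
  exact mul_nonneg (by positivity) (integral_nonneg fun _ => sq_nonneg _)

set_option maxHeartbeats 2000000 in
theorem IsLinearPair.exists_integral_nonpos (h : IsLinearPair Ω T s K a w V) (hT : 0 < T)
    (hn : 1 ≤ n) (hs : 0 < s) (hs1 : s < 1) (hΩ : IsOpen Ω) (hΩb : Bornology.IsBounded Ω)
    (hK : IsEllipticKernel l L K) (ha : IsBddLip A a) (ha0 : ∀ x, 0 ≤ a x) :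
    ∃ μ : ℝ, ∫ t in Ioo 0 T, ∫ x, V t x * (Real.exp (-μ * t) * w t x) ≤ 0 := by
  obtain ⟨C₀, hC₀, hpoinc⟩ := exists_poincare (n := n) hn hs hΩb
  set M := (radialMass n s fun r => min 1 r ^ 2).toReal with hM
  have hl := hK.pos
  have hL : 0 ≤ L := hl.le.trans ((hK.bounds 0 0).1.trans (hK.bounds 0 0).2)
  -- Chosen so that `(μ-1) l = L A² M C₀`: the coercive term, bounded below using `K ≥ l`, balances
  -- the error term, bounded above using `K ≤ L`.
  set μ := 1 + L * A ^ 2 * (M * C₀) / l with hμ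
  have hμ1 : 1 ≤ μ := by
    have : 0 ≤ L * A ^ 2 * (M * C₀) / l := by positivity
    linarith
  have hwm := h.measurable_w
  have ham : Measurable a := ha.continuous.measurable
  have hexp : ∀ σ ∈ Ioo 0 T, |Real.exp (-μ * σ)| ≤ 1 := fun σ hσ => by
    rw [Real.abs_exp, Real.exp_le_one_iff]
    nlinarith [hσ.1]
  set C := Real.exp (A * T) * (1 + A * T) with hC
  set k : ℝ → ℝ → Space n → ℝ := fun τ σ x =>
    Real.exp (-a x * (σ - τ)) * (Real.exp (-μ * σ) * w σ x) with hk
  set ψ := tailInt T k with hψ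
  have hlip : ∀ τ ∈ Ioo 0 T, ∀ σ ∈ Ioo 0 T, IsBddLip C fun x =>
      Real.exp (-μ * σ) * Real.exp (-a x * (σ - τ)) := fun τ hτ σ hσ =>
    (ha.exp (by rw [abs_le]; constructor <;> linarith [hτ.1, hτ.2, hσ.1, hσ.2])).const_mul
      (hexp σ hσ)
  have hkeq : ∀ τ σ x, k τ σ x = Real.exp (-μ * σ) * Real.exp (-a x * (σ - τ)) * w σ x :=
    fun τ σ x => by simp only [hk]; ring
  have hkm : Measurable fun q : (ℝ × ℝ) × Space n => k q.1.1 q.1.2 q.2 := by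
    have e1 : Measurable fun q : (ℝ × ℝ) × Space n => w q.1.2 q.2 :=
      hwm.comp (f := fun q : (ℝ × ℝ) × Space n => (q.1.2, q.2)) (by fun_prop)
    simp only [hk]; fun_prop
  have hkim : Measurable fun q : (ℝ × ℝ) × Space n × Space n => incr (k q.1.1 q.1.2) q.2 :=
    (hkm.comp (f := fun q : (ℝ × ℝ) × Space n × Space n => (q.1, q.2.1)) (by fun_prop)).sub
      (hkm.comp (f := fun q : (ℝ × ℝ) × Space n × Space n => (q.1, q.2.2)) (by fun_prop))
  have hψm : Measurable (Function.uncurry ψ) := measurable_tailInt hkm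
  have hψτ : ∀ τ, Measurable (ψ τ) := fun τ => hψm.comp measurable_prodMk_left
  -- Pointwise vanishing of `w` off `Ω` passes to its time integral, so the Poincaré inequality
  -- applies to `ψ(τ)`.
  have hψ0 : ∀ τ, ∀ x ∉ Ω, ψ τ x = 0 := fun τ x hx => by
    simp [hψ, tailInt, hk, h.w_eq_zero _ x hx]
  have hψ2 : MemLp (fun q : ℝ × Space n => ψ q.1 q.2) 2
      ((volume.restrict (Ioo 0 T)).prod volume) := by
    refine memLp_tailInt (H := fun σ x => C * w σ x) (h.memLp_w.const_mul C) hkm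
      fun τ hτ σ hσ x => ?_
    rw [hkeq, abs_mul, abs_mul C]
    exact mul_le_mul_of_nonneg_right (((hlip τ hτ σ hσ).bound x).trans (le_abs_self C))
      (abs_nonneg _)
  have hD2 : MemLp (fun q : ℝ × Space n × Space n =>
      tailInt T (fun τ σ => incr (k τ σ)) q.1 q.2) 2
      ((volume.restrict (Ioo 0 T)).prod (nu n s)) := by
    refine memLp_tailInt (H := fun σ p => C * incrBound (w σ) p)
      ((memLp_incrBound hn hs hs1 hwm h.memLp_w h.memLp_incr).const_mul C) hkim
      fun τ hτ σ hσ p => ?_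
    refine le_trans (le_of_eq ?_) (((hlip τ hτ σ hσ).abs_incr_mul_le (w σ) p).trans
      (le_abs_self _))
    simp only [incr, hkeq]
  have hslice : ∀ᵐ x : Space n, IntegrableOn (fun t => w t x) (Ioo 0 T) :=
    ae_integrableOn_slice hwm h.memLp_w
  have hslice2 : ∀ᵐ p ∂(nu n s), IntegrableOn (fun t => w t p.1) (Ioo 0 T) ∧
      IntegrableOn (fun t => w t p.2) (Ioo 0 T) :=
    (ae_fst_of_ae hslice).and (ae_snd_of_ae hslice)
  have hkint : ∀ x, IntegrableOn (fun t => w t x) (Ioo 0 T) → ∀ τ ∈ Ioo 0 T,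
      IntegrableOn (fun σ => k τ σ x) (Ioo τ T) := fun x hx τ hτ => by
    have h1 : IntegrableOn (fun σ => Real.exp (-μ * σ) * Real.exp (-a x * (σ - τ)) * w σ x)
        (Ioo 0 T) := by
      refine Integrable.bdd_mul (c := C) hx (by fun_prop) ?_
      filter_upwards [ae_restrict_mem measurableSet_Ioo] with σ hσ
      exact (hlip τ hτ σ hσ).bound x
    simp only [hkeq]
    exact h1.mono_set (Ioo_subset_Ioo_left hτ.1.le)
  -- Splitting the integral of an increment requires both time slices to be integrable, which holds
  -- for almost every pair of points.
  have hDψ : ∀ᵐ p ∂(nu n s), ∀ τ ∈ Ioo 0 T,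
      ∫ σ in Ioo τ T, incr (k τ σ) p = incr (ψ τ) p := by
    filter_upwards [hslice2] with p hp τ hτ
    simp only [incr, hψ]
    rw [tailInt_eq hτ.1.le, tailInt_eq hτ.1.le]
    exact integral_sub (hkint _ hp.1 τ hτ) (hkint _ hp.2 τ hτ)
  have hI : ∀ᵐ q : ℝ × Space n × Space n ∂((volume.restrict (Ioo 0 T)).prod (nu n s)),
      q.1 ∈ Ioo 0 T :=
    Measure.quasiMeasurePreserving_fst.ae (ae_restrict_mem measurableSet_Ioo)
  have hiψ : MemLp (fun q : ℝ × Space n × Space n => incr (ψ q.1) q.2) 2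
      ((volume.restrict (Ioo 0 T)).prod (nu n s)) := by
    refine (memLp_congr_ae ?_).1 hD2
    filter_upwards [hI, Measure.quasiMeasurePreserving_snd.ae hDψ] with q hq hq2
    rw [tailInt_eq hq.1.le]
    exact hq2 _ hq
  have hwψ := memLp_weight hn hs hs1 hψm hψ2
  have hgK := h.memLp_K hK
  refine ⟨μ, ?_⟩
  rw [h.integral_pairing_eq hT hn hs hs1 hΩ hK ha (by linarith : 0 ≤ μ), neg_nonpos]
  have e1 : ∫ τ in Ioo 0 T, ∫ p, K p.1 p.2 * incr (w τ) p *
      (∫ σ in Ioo τ T, incr (k τ σ) p) ∂(nu n s) =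
      ∫ p, ∫ τ in Ioo 0 T, K p.1 p.2 * incr (w τ) p * incr (ψ τ) p ∂volume ∂(nu n s) := by
    rw [← integral_integral_swap (f := fun τ p => K p.1 p.2 * incr (w τ) p * incr (ψ τ) p)
      (hgK.integrable_mul hiψ)]
    refine setIntegral_congr_fun measurableSet_Ioo fun τ hτ => integral_congr_ae ?_
    filter_upwards [hDψ] with p hp
    rw [hp τ hτ]
  -- The lower bound of `energy_inequality` times `K`, with `κ = A² min(1,|x-y|)²`. The energy
  -- estimate integrates in time first, for fixed points; the Poincaré bound integrates in space
  -- first, for fixed time.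
  set G : ℝ → Space n × Space n → ℝ := fun τ p => K p.1 p.2 * (Real.exp (μ * τ) *
    ((μ - 1) / 2 * incr (ψ τ) p ^ 2 - A ^ 2 * min 1 ‖p.1 - p.2‖ ^ 2 / 2 * ψ τ p.2 ^ 2)) with hG
  have hGint : Integrable (Function.uncurry G) ((volume.restrict (Ioo 0 T)).prod (nu n s)) := by
    have h1 := (hiψ.integrable_sq.const_mul ((μ - 1) / 2)).sub
      (hwψ.integrable_sq.const_mul (A ^ 2 / 2))
    have h2 := h1.bdd_mul (c := Real.exp (μ * T)) (f := fun q : ℝ × Space n × Space n =>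
      Real.exp (μ * q.1)) (by fun_prop) (by
        filter_upwards [hI] with q hq
        rw [Real.norm_eq_abs, Real.abs_exp]
        exact Real.exp_le_exp.2 (mul_le_mul_of_nonneg_left hq.2.le (by linarith)))
    have h3 := h2.bdd_mul (c := L) (f := fun q : ℝ × Space n × Space n => K q.2.1 q.2.2)
      hK.aestronglyMeasurable.comp_snd (ae_of_all _ fun q => hK.abs_le q.2)
    refine h3.congr (ae_of_all _ fun q => ?_)
    simp only [Function.uncurry, hG, Pi.sub_apply]
    ring
  have e2 : ∫ p, ∫ τ in Ioo 0 T, G τ p ∂volume ∂(nu n s) ≤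
      ∫ p, ∫ τ in Ioo 0 T, K p.1 p.2 * incr (w τ) p * incr (ψ τ) p ∂volume ∂(nu n s) := by
    refine integral_mono_ae hGint.integral_prod_right
      (hgK.integrable_mul hiψ).integral_prod_right ?_
    filter_upwards [hslice2] with p hp
    have h1 := energy_inequality (μ := μ) (κ := A ^ 2 * min 1 ‖p.1 - p.2‖ ^ 2) hT (ha0 p.1)
      (ha.incr_sq_le p) hp.1 hp.2 (P := fun τ => ψ τ p.1) (R := fun τ => ψ τ p.2)
      (fun τ hτ => tailInt_eq hτ.1.le _) (fun τ hτ => tailInt_eq hτ.1.le _)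
    have h2 := mul_le_mul_of_nonneg_left h1 (hl.le.trans (hK.bounds p.1 p.2).1)
    rw [← integral_const_mul, ← integral_const_mul] at h2
    simp only [hG, incr]
    simpa only [mul_assoc] using h2
  have e3 : 0 ≤ ∫ p, ∫ τ in Ioo 0 T, G τ p ∂volume ∂(nu n s) := by
    rw [← integral_integral_swap hGint]
    refine integral_nonneg_of_ae ?_
    filter_upwards [ae_memLp_slice (g := fun τ p => incr (ψ τ) p) hiψ,
      hGint.prod_right_ae] with τ hτ hGτ
    obtain ⟨i1, i2⟩ := integral_weight_le hn hs hs1 hC₀ (hψτ τ) hτ (hpoinc _ (hψτ τ) (hψ0 τ))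
    have hX := hτ.integrable_sq
    have hint : Integrable (fun p : Space n × Space n => Real.exp (μ * τ) *
        ((μ - 1) / 2 * l * incr (ψ τ) p ^ 2 -
          A ^ 2 / 2 * L * (min 1 ‖p.1 - p.2‖ ^ 2 * ψ τ p.2 ^ 2))) (nu n s) :=
      ((hX.const_mul _).sub (i1.const_mul _)).const_mul _
    have h0 : 0 ≤ ∫ p : Space n × Space n, Real.exp (μ * τ) *
        ((μ - 1) / 2 * l * incr (ψ τ) p ^ 2 -
          A ^ 2 / 2 * L * (min 1 ‖p.1 - p.2‖ ^ 2 * ψ τ p.2 ^ 2)) ∂(nu n s) := by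
      rw [integral_const_mul, integral_sub (hX.const_mul _) (i1.const_mul _),
        integral_const_mul, integral_const_mul]
      refine mul_nonneg (Real.exp_pos _).le ?_
      have h1 : (μ - 1) / 2 * l = A ^ 2 / 2 * L * (M * C₀) := by
        rw [hμ]
        field_simp
        ring
      rw [h1, mul_assoc (A ^ 2 / 2 * L), ← mul_sub]
      exact mul_nonneg (by positivity) (sub_nonneg.2 i2)
    refine h0.trans (integral_mono hint hGτ fun p => ?_)
    have k1 := (hK.bounds p.1 p.2).1
    have k2 := (hK.bounds p.1 p.2).2
    have k3 : (μ - 1) / 2 * l * incr (ψ τ) p ^ 2 ≤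
        K p.1 p.2 * ((μ - 1) / 2 * incr (ψ τ) p ^ 2) := by
      have : 0 ≤ (μ - 1) / 2 * incr (ψ τ) p ^ 2 := mul_nonneg (by linarith) (sq_nonneg _)
      nlinarith
    have k4 : K p.1 p.2 * (A ^ 2 * min 1 ‖p.1 - p.2‖ ^ 2 / 2 * ψ τ p.2 ^ 2) ≤
        A ^ 2 / 2 * L * (min 1 ‖p.1 - p.2‖ ^ 2 * ψ τ p.2 ^ 2) := by
      have : 0 ≤ A ^ 2 * min 1 ‖p.1 - p.2‖ ^ 2 / 2 * ψ τ p.2 ^ 2 := by positivity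
      nlinarith
    simp only [hG]
    rw [mul_left_comm (K p.1 p.2)]
    refine mul_le_mul_of_nonneg_left ?_ (Real.exp_pos _).le
    rw [mul_sub]
    linarith
  rw [e1]
  exact e3.trans e2

end NPME

/-! ### The nonlinearity, and integrability of weak solutions. -/

namespace NPME

variable {n : ℕ} {Ω : Set (Space n)} {T s m : ℝ} {K : Space n → Space n → ℝ}

theorem Phi_neg (m t : ℝ) : Phi m (-t) = -Phi m t := by simp [Phi]

theorem strictMono_Phi (hm : 1 < m) : StrictMono (Phi m) := by
  refine strictMono_of_odd_strictMonoOn_nonneg (Phi_neg m) fun x hx y hy hxy => ?_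
  have hx' : (0 : ℝ) ≤ x := hx
  have hy' : (0 : ℝ) ≤ y := hy
  simp only [Phi, abs_of_nonneg hx', abs_of_nonneg hy']
  have h1 : x ^ (m - 1) < y ^ (m - 1) := Real.rpow_lt_rpow hx' hxy (by linarith)
  have h2 : 0 ≤ x ^ (m - 1) := Real.rpow_nonneg hx' _
  nlinarith

theorem measurable_Phi (m : ℝ) : Measurable (Phi m) := by unfold Phi; fun_prop

theorem Phi_zero (m : ℝ) : Phi m 0 = 0 := by simp [Phi]

theorem Phi_eq_zero_iff (hm : 1 < m) {t : ℝ} : Phi m t = 0 ↔ t = 0 := by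
  rw [← (strictMono_Phi hm).injective.eq_iff (a := t), Phi_zero]

/-- Only `Φ^m(u)` is assumed measurable; the inverse power transfers this to `u`. -/
theorem Phi_inv_Phi (hm : 1 < m) (t : ℝ) : Phi m⁻¹ (Phi m t) = t := by
  rcases eq_or_ne t 0 with rfl | ht
  · simp [Phi]
  have h0 : 0 < |t| := abs_pos.2 ht
  have h1 : |Phi m t| = |t| ^ m := by
    rw [Phi, abs_mul, abs_of_nonneg (Real.rpow_nonneg (abs_nonneg t) _)]
    nth_rewrite 2 [← Real.rpow_one |t|]
    rw [← Real.rpow_add h0, sub_add_cancel]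
  rw [Phi, h1, ← Real.rpow_mul h0.le, Phi, ← mul_assoc, ← Real.rpow_add h0]
  have h2 : m * (m⁻¹ - 1) + (m - 1) = 0 := by field_simp; ring
  rw [h2, Real.rpow_zero, one_mul]

/-- On the bounded set `Ω` this makes `u` square integrable as soon as `Φ^m(u)` is. -/
theorem abs_le_one_add_abs_Phi (hm : 1 < m) (t : ℝ) : |t| ≤ 1 + |Phi m t| := by
  rcases le_total |t| 1 with h | h
  · linarith [abs_nonneg (Phi m t)]
  · have h1 : 1 ≤ |t| ^ (m - 1) := Real.one_le_rpow h (by linarith)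
    rw [Phi, abs_mul, abs_of_nonneg (Real.rpow_nonneg (abs_nonneg t) _)]
    nlinarith

theorem IsC1HolderNonneg.lipschitz {α : ℝ} {g : Space n → ℝ} (hg : IsC1HolderNonneg α g) :
    ∃ C, 0 ≤ C ∧ (∀ x, |g x| ≤ C) ∧ ∀ x y, |g x - g y| ≤ C * ‖x - y‖ := by
  obtain ⟨C, hC⟩ := hg.bounded
  refine ⟨C, (abs_nonneg _).trans (hC 0).1, fun x => (hC x).1, fun x y => ?_⟩
  exact Convex.norm_image_sub_le_of_norm_fderiv_le (𝕜 := ℝ) (s := univ)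
    (fun z _ => (hg.contDiff.differentiable (by simp)) z) (fun z _ => (hC z).2) convex_univ
    (mem_univ y) (mem_univ x)

theorem exists_isBddLip_div {α : ℝ} {ρ q : Space n → ℝ} (hρ : IsC1HolderNonneg α ρ)
    (hρ_ell : IsUniformlyElliptic ρ) (hq : IsC1HolderNonneg α q) :
    ∃ A, IsBddLip A fun x => q x * (ρ x)⁻¹ := by
  obtain ⟨C, hC, -, hρL⟩ := hρ.lipschitz
  obtain ⟨B, hB, hq1, hq2⟩ := hq.lipschitz
  obtain ⟨l, L, hl, -, hlL⟩ := hρ_ell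
  have hpos : ∀ x, 0 < ρ x := fun x => hl.trans_le (hlL x).1
  refine ⟨_, (IsBddLip.of_lipschitz hq1 hq2).mul (IsBddLip.of_lipschitz (M := l⁻¹)
    (L := C / l ^ 2) (fun x => ?_) fun x y => ?_)⟩
  · rw [abs_inv, abs_of_pos (hpos x)]
    exact inv_anti₀ hl (hlL x).1
  · rw [inv_sub_inv (hpos x).ne' (hpos y).ne', abs_div, abs_mul, abs_of_pos (hpos x),
      abs_of_pos (hpos y), abs_sub_comm, div_mul_eq_mul_div]
    have h1 : l ^ 2 ≤ ρ x * ρ y := by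
      rw [sq]; exact mul_le_mul (hlL x).1 (hlL y).1 hl.le (hpos x).le
    exact div_le_div₀ (by positivity) (hρL x y) (by positivity) h1

theorem quasiMeasurePreserving_id_prodMap {X Y Z : Type*} [MeasurableSpace X] [MeasurableSpace Y]
    [MeasurableSpace Z] {μ : Measure X} {ν : Measure Y} {ξ : Measure Z} [SFinite μ] [SFinite ν]
    [SFinite ξ] {f : X → Y} (hf : Measure.QuasiMeasurePreserving f μ ν) :
    Measure.QuasiMeasurePreserving (fun q : Z × X => (q.1, f q.2)) (ξ.prod μ) (ξ.prod ν) := by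
  refine ⟨measurable_fst.prodMk (hf.measurable.comp measurable_snd), ?_⟩
  have h := Measure.map_prod_map ξ μ measurable_id hf.measurable
  rw [Measure.map_id] at h
  change Measure.map (Prod.map id f) (ξ.prod μ) ≪ _
  rw [← h]
  exact Measure.AbsolutelyContinuous.rfl.prod hf.absolutelyContinuous

theorem quasiMeasurePreserving_fst_nu :
    Measure.QuasiMeasurePreserving Prod.fst (nu n s) volume :=
  (Measure.quasiMeasurePreserving_fst (μ := (volume : Measure (Space n)))
    (ν := (volume : Measure (Space n)))).mono_left nu_absolutelyContinuous

theorem quasiMeasurePreserving_snd_nu :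
    Measure.QuasiMeasurePreserving Prod.snd (nu n s) volume :=
  (Measure.quasiMeasurePreserving_snd (μ := (volume : Measure (Space n)))
    (ν := (volume : Measure (Space n)))).mono_left nu_absolutelyContinuous

theorem restrict_prod_univ_eq : (volume : Measure (ℝ × Space n)).restrict (Ioo 0 T ×ˢ univ) =
    (volume.restrict (Ioo 0 T)).prod volume := by
  rw [Measure.volume_eq_prod, ← Measure.prod_restrict, Measure.restrict_univ]

theorem MemL2Hs.aestronglyMeasurable {f : ℝ → Space n → ℝ} (hf : MemL2Hs T s f) :
    AEStronglyMeasurable (fun q : ℝ × Space n => f q.1 q.2)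
      ((volume.restrict (Ioo 0 T)).prod volume) := by
  rw [← restrict_prod_univ_eq]; exact hf.1

theorem MemL2Hs.memLp (hn : 1 ≤ n) (hs : 0 < s) {f : ℝ → Space n → ℝ} (hf : MemL2Hs T s f) :
    MemLp (fun q : ℝ × Space n => f q.1 q.2) 2 ((volume.restrict (Ioo 0 T)).prod volume) := by
  have hm := hf.aestronglyMeasurable
  rw [memLp_two_iff hm, lintegral_prod _ (hm.aemeasurable.pow_const 2).ennreal_ofReal]
  refine lt_of_le_of_lt (lintegral_mono fun t => ?_) hf.2
  rw [hsNormSq_eq hn hs]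
  exact le_self_add

theorem MemL2Hs.memLp_incr (hn : 1 ≤ n) (hs : 0 < s) {f : ℝ → Space n → ℝ}
    (hf : MemL2Hs T s f) : MemLp (fun q : ℝ × Space n × Space n => incr (f q.1) q.2) 2
      ((volume.restrict (Ioo 0 T)).prod (nu n s)) := by
  have hm := hf.aestronglyMeasurable
  have hm2 : AEStronglyMeasurable (fun q : ℝ × Space n × Space n => incr (f q.1) q.2)
      ((volume.restrict (Ioo 0 T)).prod (nu n s)) :=
    (hm.comp_quasiMeasurePreserving
      (quasiMeasurePreserving_id_prodMap quasiMeasurePreserving_fst_nu)).sub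
    (hm.comp_quasiMeasurePreserving
      (quasiMeasurePreserving_id_prodMap quasiMeasurePreserving_snd_nu))
  rw [memLp_two_iff hm2, lintegral_prod _ (hm2.aemeasurable.pow_const 2).ennreal_ofReal]
  refine lt_of_le_of_lt (lintegral_mono fun t => ?_) hf.2
  rw [hsNormSq_eq hn hs]
  exact le_add_self

theorem MemL2HsTilde.ae_eq_zero (hn : 1 ≤ n) (hs : 0 < s) (hΩ : MeasurableSet Ω)
    {f : ℝ → Space n → ℝ} (hf : MemL2HsTilde T s Ω f) :
    ∀ᵐ q : ℝ × Space n ∂((volume.restrict (Ioo 0 T)).prod volume), q.2 ∉ Ω → f q.1 q.2 = 0 := by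
  have hm := (hf.1.aestronglyMeasurable.indicator (measurable_snd hΩ.compl)).enorm
  have h0 : ∫⁻ q : ℝ × Space n, ‖(Prod.snd ⁻¹' Ωᶜ).indicator
      (fun q : ℝ × Space n => f q.1 q.2) q‖ₑ ∂((volume.restrict (Ioo 0 T)).prod volume) = 0 := by
    rw [lintegral_prod _ hm, lintegral_eq_zero_iff' hm.lintegral_prod_right']
    filter_upwards [hf.2] with t ht
    simp only [Pi.zero_apply]
    refine (lintegral_congr_ae ?_).trans lintegral_zero
    filter_upwards [ht.ae_eq_zero hn hs hΩ] with x hx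
    by_cases hxΩ : x ∈ Ω
    · simp [hxΩ]
    · simp [hxΩ, hx hxΩ]
  rw [lintegral_eq_zero_iff' hm] at h0
  filter_upwards [h0] with q hq hqΩ
  simpa [hqΩ] using hq

theorem IsExteriorDatum.eq_zero {φ : ℝ → Space n → ℝ} (hφ : IsExteriorDatum T Ω φ) {t : ℝ}
    (ht : t ∈ Ioo 0 T) {x : Space n} (hx : x ∈ Ω) : φ t x = 0 := by
  obtain ⟨C, -, hC, h0⟩ := hφ.compactSupport
  exact h0 t (Ioo_subset_Icc_self ht) x fun h => (hC h).2 (subset_closure hx)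

variable {ρ q u₀ : Space n → ℝ} {φ u : ℝ → Space n → ℝ}

theorem IsWeakSolution.aestronglyMeasurable (hu : IsWeakSolution Ω T s m K ρ q u₀ φ u)
    (hm : 1 < m) : AEStronglyMeasurable (fun p : ℝ × Space n => u p.1 p.2)
      ((volume.restrict (Ioo 0 T)).prod volume) := by
  have h := ((measurable_Phi m⁻¹).comp_aemeasurable
    hu.memL2Hs.aestronglyMeasurable.aemeasurable).aestronglyMeasurable
  refine h.congr (ae_of_all _ fun p => ?_)
  exact Phi_inv_Phi hm _

theorem IsWeakSolution.ae_eq_datum (hu : IsWeakSolution Ω T s m K ρ q u₀ φ u) (hm : 1 < m)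
    (hn : 1 ≤ n) (hs : 0 < s) (hΩ : MeasurableSet Ω) :
    ∀ᵐ p : ℝ × Space n ∂((volume.restrict (Ioo 0 T)).prod volume), p.2 ∉ Ω →
      u p.1 p.2 = φ p.1 p.2 := by
  filter_upwards [hu.memL2HsTilde.ae_eq_zero hn hs hΩ] with p hp hpΩ
  exact sub_eq_zero.1 ((Phi_eq_zero_iff hm).1 (hp hpΩ))

theorem memLp_indicator_one_snd (hΩ : MeasurableSet Ω) (hΩb : Bornology.IsBounded Ω) :
    MemLp (fun p : ℝ × Space n => Ω.indicator (fun _ => (1 : ℝ)) p.2) 2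
      ((volume.restrict (Ioo 0 T)).prod volume) :=
  memLp_comp_snd (MeasureTheory.memLp_indicator_const 2 hΩ 1 (Or.inr hΩb.measure_lt_top.ne))

theorem IsWeakSolution.memLp_indicator (hu : IsWeakSolution Ω T s m K ρ q u₀ φ u) (hm : 1 < m)
    (hn : 1 ≤ n) (hs : 0 < s) (hΩ : MeasurableSet Ω) (hΩb : Bornology.IsBounded Ω) :
    MemLp (fun p : ℝ × Space n => Ω.indicator (u p.1) p.2) 2
      ((volume.restrict (Ioo 0 T)).prod volume) := by
  have h1 := (memLp_indicator_one_snd (T := T) hΩ hΩb).add (hu.memL2Hs.memLp hn hs).norm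
  have h2 : AEStronglyMeasurable (fun p : ℝ × Space n => Ω.indicator (u p.1) p.2)
      ((volume.restrict (Ioo 0 T)).prod volume) :=
    (hu.aestronglyMeasurable hm).indicator (measurable_snd hΩ)
  refine h1.of_le h2 (ae_of_all _ fun p => ?_)
  by_cases hp : p.2 ∈ Ω
  · simp only [hp, indicator_of_mem, Pi.add_apply, Real.norm_eq_abs]
    exact (abs_le_one_add_abs_Phi hm _).trans (le_abs_self _)
  · simp only [hp, not_false_eq_true, indicator_of_notMem, norm_zero]
    exact norm_nonneg _

theorem isTestFunction_mul {η : ℝ → ℝ} (h1 : ContDiff ℝ ∞ η) (h2 : HasCompactSupport η)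
    (h3 : tsupport η ⊆ Iio T) {χ : Space n → ℝ} (hχ : IsSpaceTest Ω χ) :
    IsTestFunction T Ω fun t x => η t * χ x := by
  have hsub : tsupport (Function.uncurry fun t x => η t * χ x) ⊆ tsupport η ×ˢ tsupport χ := by
    refine closure_minimal (fun p hp => ?_)
      ((isClosed_tsupport η).prod (isClosed_tsupport χ))
    have hp' : η p.1 * χ p.2 ≠ 0 := hp
    exact ⟨subset_tsupport _ (left_ne_zero_of_mul hp'),
      subset_tsupport _ (right_ne_zero_of_mul hp')⟩
  refine ⟨?_, ?_, hsub.trans (prod_mono h3 hχ.tsupport_subset)⟩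
  · exact (h1.comp contDiff_fst).mul (hχ.contDiff.comp contDiff_snd)
  · exact IsCompact.of_isClosed_subset (IsCompact.prod h2 hχ.hasCompactSupport)
      (isClosed_tsupport _) hsub

/-- Space-time integrals over `Ω_T` against products of functions of time and space. -/
theorem integral_mul_time_space (hΩ : MeasurableSet Ω)
    (hu : MemLp (fun p : ℝ × Space n => Ω.indicator (u p.1) p.2) 2
      ((volume.restrict (Ioo 0 T)).prod volume)) {θ : ℝ → ℝ} (hθ : Continuous θ)
    (hc : HasCompactSupport θ) {d : Space n → ℝ} (hd : MemLp d 2 volume) :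
    ∫ p in Ioo 0 T ×ˢ Ω, u p.1 p.2 * d p.2 * θ p.1 =
      ∫ t in Ioo 0 T, θ t * ∫ x, Ω.indicator (u t) x * d x := by
  obtain ⟨C, hC⟩ := hc.exists_bound_of_continuous hθ
  have hint := hu.integrable_mul (memLp_comp_snd (ι := volume.restrict (Ioo 0 T)) hd)
  have hint2 : Integrable (fun p : ℝ × Space n => θ p.1 * (Ω.indicator (u p.1) p.2 * d p.2))
      ((volume.restrict (Ioo 0 T)).prod volume) :=
    hint.bdd_mul (c := C) (by fun_prop) (ae_of_all _ fun p => hC _)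
  have e1 : ∫ t in Ioo 0 T, θ t * ∫ x, Ω.indicator (u t) x * d x =
      ∫ p, θ p.1 * (Ω.indicator (u p.1) p.2 * d p.2)
        ∂((volume.restrict (Ioo 0 T)).prod volume) := by
    rw [integral_prod _ hint2]
    simp only [integral_const_mul]
  rw [e1, Measure.volume_eq_prod, ← Measure.prod_restrict, ← Measure.restrict_univ (μ := volume),
    Measure.restrict_univ]
  have e2 : (volume.restrict (Ioo 0 T)).prod (volume.restrict Ω) =
      ((volume.restrict (Ioo 0 T)).prod volume).restrict (Prod.snd ⁻¹' Ω) := by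
    rw [← univ_prod, ← Measure.prod_restrict, Measure.restrict_univ]
  rw [e2, ← integral_indicator (measurable_snd hΩ)]
  refine integral_congr_ae (ae_of_all _ fun p => ?_)
  by_cases hp : p.2 ∈ Ω
  · simp only [indicator, mem_preimage, hp, if_true]; ring
  · simp [indicator, hp]

/-- Separated tests `η(t) χ(x)` reduce the weak form to scalar functions of time. The indicator lets
spatial integrals run over all of space while using the square integrability of `u` on `Ω` only. -/
theorem IsWeakSolution.weak_separated (hu : IsWeakSolution Ω T s m K ρ q u₀ φ u) (hm : 1 < m)
    (hn : 1 ≤ n) (hs : 0 < s) (hΩ : MeasurableSet Ω) (hΩb : Bornology.IsBounded Ω)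
    {η : ℝ → ℝ} (h1 : ContDiff ℝ ∞ η) (h2 : HasCompactSupport η)
    (h3 : tsupport η ⊆ Iio T) {χ : Space n → ℝ} (hχ : IsSpaceTest Ω χ)
    (hρχ : MemLp (fun x => ρ x * χ x) 2 volume) (hqχ : MemLp (fun x => q x * χ x) 2 volume) :
    -(∫ t in Ioo 0 T, deriv η t * ∫ x, Ω.indicator (u t) x * (ρ x * χ x)) +
      (∫ t in Ioo 0 T, η t * bilinForm s K (fun x => Phi m (u t x)) χ) +
      (∫ t in Ioo 0 T, η t * ∫ x, Ω.indicator (u t) x * (q x * χ x)) =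
      ∫ x in Ω, ρ x * u₀ x * (η 0 * χ x) := by
  have h := hu.weakForm _ (isTestFunction_mul h1 h2 h3 hχ)
  have hind := hu.memLp_indicator hm hn hs hΩ hΩb
  have hd : ∀ p : ℝ × Space n, deriv (fun τ => η τ * χ p.2) p.1 = deriv η p.1 * χ p.2 := fun p =>
    deriv_mul_const (h1.differentiable (by simp) p.1) (χ p.2)
  have hbil : ∀ t, bilinForm s K (fun x => Phi m (u t x)) (fun x => η t * χ x) =
      η t * bilinForm s K (fun x => Phi m (u t x)) χ := fun t => by
    simp only [bilinForm_eq, ← integral_const_mul, incr]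
    exact integral_congr_ae (ae_of_all _ fun p => by ring)
  simp only [hd, hbil] at h
  rw [← integral_mul_time_space hΩ hind (h1.continuous_deriv (by simp)) h2.deriv hρχ,
    ← integral_mul_time_space hΩ hind h1.continuous h2 hqχ, ← h]
  have e1 : ∀ p : ℝ × Space n, u p.1 p.2 * (ρ p.2 * χ p.2) * deriv η p.1 =
      ρ p.2 * u p.1 p.2 * (deriv η p.1 * χ p.2) := fun p => by ring
  have e2 : ∀ p : ℝ × Space n, u p.1 p.2 * (q p.2 * χ p.2) * η p.1 =
      q p.2 * u p.1 p.2 * (η p.1 * χ p.2) := fun p => by ring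
  simp only [e1, e2]

end NPME

/-! ### From two weak solutions to a linear pair. -/

namespace NPME

variable {n : ℕ} {Ω : Set (Space n)} {T s m l L : ℝ} {K : Space n → Space n → ℝ}
  {ρ q u₀ : Space n → ℝ} {φ u u₁ u₂ : ℝ → Space n → ℝ}

theorem IsC1HolderNonneg.exists_isBddLip {α : ℝ} {g : Space n → ℝ} (hg : IsC1HolderNonneg α g) :
    ∃ A, IsBddLip A g := by
  obtain ⟨C, -, h1, h2⟩ := hg.lipschitz
  exact ⟨_, IsBddLip.of_lipschitz h1 h2⟩

theorem integrable_cutoff_mul {θ f : ℝ → ℝ} (hθ : Continuous θ) (hc : HasCompactSupport θ)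
    {ι : Measure ℝ} (hf : Integrable f ι) : Integrable (fun t => θ t * f t) ι := by
  obtain ⟨C, hC⟩ := hc.exists_bound_of_continuous hθ
  exact hf.bdd_mul (c := C) hθ.aestronglyMeasurable (ae_of_all _ hC)

theorem MemL2Hs.integrable_pairing_incr (hn : 1 ≤ n) (hs : 0 < s) (hK : IsEllipticKernel l L K)
    {f : ℝ → Space n → ℝ} (hf : MemL2Hs T s f) {χ : Space n → ℝ}
    (hχ : MemLp (incr χ) 2 (nu n s)) :
    Integrable (fun p : ℝ × Space n × Space n => K p.2.1 p.2.2 * (incr (f p.1) p.2 * incr χ p.2))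
      ((volume.restrict (Ioo 0 T)).prod (nu n s)) := by
  have h := (hK.memLp_mul (hf.memLp_incr hn hs)).integrable_mul
    (memLp_comp_snd (ι := volume.restrict (Ioo 0 T)) hχ)
  refine h.congr (ae_of_all _ fun p => ?_)
  simp only [Pi.mul_apply, mul_assoc]

/-- Slices and pointwise Poincaré arguments need a jointly measurable representative vanishing at
every point off `Ω`, not merely almost everywhere. -/
theorem exists_measurable_ae_eq_of_eq_zero (hΩ : MeasurableSet Ω) {f : ℝ × Space n → ℝ}
    {μ : Measure (ℝ × Space n)} (hf : AEStronglyMeasurable f μ)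
    (h0 : ∀ᵐ p ∂μ, p.2 ∉ Ω → f p = 0) :
    ∃ g : ℝ → Space n → ℝ, Measurable (Function.uncurry g) ∧ (∀ t, ∀ x ∉ Ω, g t x = 0) ∧
      (fun p : ℝ × Space n => g p.1 p.2) =ᵐ[μ] f := by
  refine ⟨fun t x => (Prod.snd ⁻¹' Ω).indicator (hf.mk f) (t, x), ?_, fun t x hx => ?_, ?_⟩
  · exact hf.stronglyMeasurable_mk.measurable.indicator (measurable_snd hΩ)
  · simp [hx]
  · filter_upwards [hf.ae_eq_mk, h0] with p h1 h2
    by_cases hp : p.2 ∈ Ω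
    · simp [indicator, hp, h1]
    · simp [indicator, hp, h2 hp]

/-- Two weak solutions with the same data give rise to a solution of a linear problem. -/
theorem IsWeakSolution.exists_isLinearPair {α : ℝ} (hn : 1 ≤ n) (hs : 0 < s) (hs1 : s < 1)
    (hm : 1 < m) (hΩ : MeasurableSet Ω) (hΩb : Bornology.IsBounded Ω)
    (hK : IsEllipticKernel l L K) (hρ : IsC1HolderNonneg α ρ) (hρ0 : ∀ x, 0 < ρ x)
    (hq : IsC1HolderNonneg α q) (hφ : IsExteriorDatum T Ω φ)
    (hu₁ : IsWeakSolution Ω T s m K ρ q u₀ φ u₁) (hu₂ : IsWeakSolution Ω T s m K ρ q u₀ φ u₂) :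
    ∃ w V, IsLinearPair Ω T s K (fun x => q x * (ρ x)⁻¹) w V ∧
      (fun p : ℝ × Space n => w p.1 p.2) =ᵐ[(volume.restrict (Ioo 0 T)).prod volume]
        (fun p => Phi m (u₁ p.1 p.2) - Phi m (u₂ p.1 p.2)) ∧
      (fun p : ℝ × Space n => V p.1 p.2) =ᵐ[(volume.restrict (Ioo 0 T)).prod volume]
        (fun p => ρ p.2 * (Ω.indicator (u₁ p.1) p.2 - Ω.indicator (u₂ p.1) p.2)) := by
  obtain ⟨A, hA⟩ := hρ.exists_isBddLip
  obtain ⟨B, hB⟩ := hq.exists_isBddLip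
  have i₁ := hu₁.memLp_indicator hm hn hs hΩ hΩb
  have i₂ := hu₂.memLp_indicator hm hn hs hΩ hΩb
  have m₁ := hu₁.memL2Hs.memLp hn hs
  have m₂ := hu₂.memL2Hs.memLp hn hs
  have hVm : MemLp (fun p : ℝ × Space n =>
      ρ p.2 * (Ω.indicator (u₁ p.1) p.2 - Ω.indicator (u₂ p.1) p.2)) 2
      ((volume.restrict (Ioo 0 T)).prod volume) :=
    memLp_bdd_mul (i₁.sub i₂)
      (hA.continuous.measurable.comp measurable_snd).aestronglyMeasurable fun p => hA.bound p.2
  obtain ⟨w, hw1, hw2, hw3⟩ := exists_measurable_ae_eq_of_eq_zero hΩ (m₁.sub m₂).1 (by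
    filter_upwards [hu₁.ae_eq_datum hm hn hs hΩ, hu₂.ae_eq_datum hm hn hs hΩ] with p h1 h2 hp
    simp [h1 hp, h2 hp])
  obtain ⟨V, hV1, -, hV3⟩ := exists_measurable_ae_eq_of_eq_zero hΩ hVm.1
    (ae_of_all _ fun p hp => by simp [hp])
  have hwt := Measure.ae_ae_of_ae_prod hw3
  have hVt := Measure.ae_ae_of_ae_prod hV3
  refine ⟨w, V, ⟨hw1, hV1, hw2, (memLp_congr_ae hw3).2 (m₁.sub m₂), (memLp_congr_ae hV3).2 hVm,
    ?_, ?_, ?_⟩, hw3, hV3⟩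
  · have hc := (quasiMeasurePreserving_id_prodMap (ξ := volume.restrict (Ioo 0 T))
      (quasiMeasurePreserving_fst_nu (n := n) (s := s))).ae_eq_comp hw3
    have hd := (quasiMeasurePreserving_id_prodMap (ξ := volume.restrict (Ioo 0 T))
      (quasiMeasurePreserving_snd_nu (n := n) (s := s))).ae_eq_comp hw3
    refine (memLp_congr_ae ?_).2
      ((hu₁.memL2Hs.memLp_incr hn hs).sub (hu₂.memL2Hs.memLp_incr hn hs))
    filter_upwards [hc, hd] with p h1 h2
    simp only [Function.comp_apply, Pi.sub_apply] at h1 h2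
    simp only [incr, Pi.sub_apply, h1, h2]
    ring
  -- Here `w = Φ^m(u₁-φ) - Φ^m(u₂-φ)`: inside `Ω` the datum vanishes, and outside both sides are 0.
  -- So `w(t)` is a difference of elements of `H̃^s(Ω)`.
  · filter_upwards [hu₁.memL2HsTilde.2, hu₂.memL2HsTilde.2, hwt,
      Measure.ae_ae_of_ae_prod (hu₁.ae_eq_datum hm hn hs hΩ),
      Measure.ae_ae_of_ae_prod (hu₂.ae_eq_datum hm hn hs hΩ),
      ae_restrict_mem measurableSet_Ioo] with t k1 k2 k3 k4 k5 ht
    refine (k1.sub hn hs k2).congr hn hs ?_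
    filter_upwards [k3, k4, k5] with x h3 h4 h5
    simp only [Pi.sub_apply] at h3 ⊢
    rw [h3]
    by_cases hx : x ∈ Ω
    · simp [hφ.eq_zero ht hx]
    · simp [h4 hx, h5 hx, Phi_zero]
  · intro η k1 k2 k3 χ hχ
    obtain ⟨c1, c2⟩ := (hsNormSq_lt_top_iff hn hs
      hχ.contDiff.continuous.aestronglyMeasurable).1 (hχ.hsNormSq_lt_top hn hs hs1)
    have hρχ := hA.memLp_mul c1
    have hqχ := hB.memLp_mul c1
    have w₁ := hu₁.weak_separated hm hn hs hΩ hΩb k1 k2 k3 hχ hρχ hqχ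
    have w₂ := hu₂.weak_separated hm hn hs hΩ hΩb k1 k2 k3 hχ hρχ hqχ
    have p₁ := hu₁.memL2Hs.integrable_pairing_incr hn hs hK c2
    have p₂ := hu₂.memL2Hs.integrable_pairing_incr hn hs hK c2
    have b₁ : Integrable (fun t => bilinForm s K (fun x => Phi m (u₁ t x)) χ)
        (volume.restrict (Ioo 0 T)) := by
      simp only [bilinForm_eq]; exact p₁.integral_prod_left
    have b₂ : Integrable (fun t => bilinForm s K (fun x => Phi m (u₂ t x)) χ)
        (volume.restrict (Ioo 0 T)) := by
      simp only [bilinForm_eq]; exact p₂.integral_prod_left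
    have eB : ∀ᵐ t ∂(volume.restrict (Ioo 0 T)), bilinForm s K (w t) χ =
        bilinForm s K (fun x => Phi m (u₁ t x)) χ -
          bilinForm s K (fun x => Phi m (u₂ t x)) χ := by
      filter_upwards [hwt, p₁.prod_right_ae, p₂.prod_right_ae] with t h1 h2 h3
      simp only [bilinForm_eq]
      rw [← integral_sub h2 h3]
      refine integral_congr_ae ?_
      filter_upwards [quasiMeasurePreserving_fst_nu.ae h1,
        quasiMeasurePreserving_snd_nu.ae h1] with p g1 g2
      simp only [Pi.sub_apply] at g1 g2
      simp only [incr, g1, g2]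
      ring
    have eV : ∀ (d d' : Space n → ℝ), MemLp d 2 volume → (∀ x, ρ x * d' x = d x) →
        ∀ᵐ t ∂(volume.restrict (Ioo 0 T)), ∫ x, V t x * d' x =
          (∫ x, Ω.indicator (u₁ t) x * d x) - ∫ x, Ω.indicator (u₂ t) x * d x := by
      intro d d' hd hdd
      filter_upwards [hVt, (i₁.integrable_mul (memLp_comp_snd hd)).prod_right_ae,
        (i₂.integrable_mul (memLp_comp_snd hd)).prod_right_ae] with t h1 h2 h3
      simp only [Pi.mul_apply] at h2 h3
      rw [← integral_sub h2 h3]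
      refine integral_congr_ae ?_
      filter_upwards [h1] with x hx
      simp only [hx, ← hdd]
      ring
    have eρ := eV _ χ hρχ fun x => rfl
    -- The factor `ρ` in `V` cancels the one in `a = q/ρ`, which recovers the term `q (u₁ - u₂)`.
    have eq := eV _ (fun x => q x * (ρ x)⁻¹ * χ x) hqχ fun x => by
      field_simp [(hρ0 x).ne']
    have hη := k1.continuous
    have hη' : Continuous (deriv η) := k1.continuous_deriv (by simp)
    have e1 : ∫ t in Ioo 0 T, deriv η t * ∫ x, V t x * χ x =
        (∫ t in Ioo 0 T, deriv η t * ∫ x, Ω.indicator (u₁ t) x * (ρ x * χ x)) -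
          ∫ t in Ioo 0 T, deriv η t * ∫ x, Ω.indicator (u₂ t) x * (ρ x * χ x) := by
      rw [← integral_sub (integrable_cutoff_mul hη' k2.deriv (integrable_pairing (g := fun t => Ω.indicator (u₁ t)) i₁ hρχ))
        (integrable_cutoff_mul hη' k2.deriv (integrable_pairing (g := fun t => Ω.indicator (u₂ t)) i₂ hρχ))]
      refine integral_congr_ae ?_
      filter_upwards [eρ] with t ht
      rw [ht, mul_sub]
    have j₁ := integrable_cutoff_mul hη k2 b₁
    have j₂ := integrable_cutoff_mul hη k2 b₂
    have g₁ := integrable_cutoff_mul hη k2 (integrable_pairing (g := fun t => Ω.indicator (u₁ t)) i₁ hqχ)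
    have g₂ := integrable_cutoff_mul hη k2 (integrable_pairing (g := fun t => Ω.indicator (u₂ t)) i₂ hqχ)
    have e2 : ∫ t in Ioo 0 T, η t * (bilinForm s K (w t) χ +
          ∫ x, V t x * (q x * (ρ x)⁻¹ * χ x)) =
        ((∫ t in Ioo 0 T, η t * bilinForm s K (fun x => Phi m (u₁ t x)) χ) -
          ∫ t in Ioo 0 T, η t * bilinForm s K (fun x => Phi m (u₂ t x)) χ) +
        ((∫ t in Ioo 0 T, η t * ∫ x, Ω.indicator (u₁ t) x * (q x * χ x)) -
          ∫ t in Ioo 0 T, η t * ∫ x, Ω.indicator (u₂ t) x * (q x * χ x)) := by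
      rw [← integral_sub j₁ j₂, ← integral_sub g₁ g₂]
      refine Eq.trans (integral_congr_ae ?_) (integral_add (j₁.sub j₂) (g₁.sub g₂))
      filter_upwards [eB, eq] with t h1 h2
      simp only [h1, h2]
      ring
    rw [e1, e2]
    -- Both solutions have the same initial term, so it cancels in the difference: this is `V(0) =
    -- 0`.
    linarith

end NPME
-- Uniqueness.
theorem mainTheorem3 {n : ℕ} (hn : 1 ≤ n) {Ω : Set (NPME.Space n)}
    (hΩ : NPME.IsBoundedLipschitzDomain Ω)
    {T s α m : ℝ} (hT : 0 < T) (hs : 0 < s) (hsα : s < α) (hα : α ≤ 1) (hm : 1 < m)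
    {K : NPME.Space n → NPME.Space n → ℝ} (hK : NPME.IsKernelL0 K)
    {ρ q : NPME.Space n → ℝ}
    (hρ : NPME.IsC1HolderNonneg α ρ) (hρ_ell : NPME.IsUniformlyElliptic ρ)
    (hq : NPME.IsC1HolderNonneg α q)
    {u₀ : NPME.Space n → ℝ}
    (hu₀_bdd : MemLp u₀ ⊤ (volume.restrict Ω)) (hu₀ : NPME.MemHsTilde s Ω u₀)
    {φ : ℝ → NPME.Space n → ℝ} (hφ : NPME.IsExteriorDatum T Ω φ)
    (hφ_hs : NPME.MemL2Hs T s (fun t x => NPME.Phi m (φ t x)))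
    {u₁ u₂ : ℝ → NPME.Space n → ℝ}
    (hu₁ : NPME.IsWeakSolution Ω T s m K ρ q u₀ φ u₁)
    (hu₂ : NPME.IsWeakSolution Ω T s m K ρ q u₀ φ u₂) :
    ∀ᵐ p ∂(volume.restrict (Ioo 0 T ×ˢ (univ : Set (NPME.Space n)))),
      u₁ p.1 p.2 = u₂ p.1 p.2 := by
  have hs1 : s < 1 := hsα.trans_le hα
  have hΩm := hΩ.isOpen.measurableSet
  obtain ⟨l, L, hl, -, hlL⟩ := hK.elliptic
  have hρ0 : ∀ x, 0 < ρ x := by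
    obtain ⟨c, C, hc, -, hcC⟩ := hρ_ell
    exact fun x => hc.trans_le (hcC x).1
  obtain ⟨A, hA⟩ := NPME.exists_isBddLip_div hρ hρ_ell hq
  have hK' : NPME.IsEllipticKernel l L K := ⟨hK.aemeasurable, hl, hlL⟩
  obtain ⟨w, V, hwV, hw, hV⟩ := hu₁.exists_isLinearPair hn hs hs1 hm hΩm hΩ.isBounded hK' hρ hρ0
    hq hφ hu₂
  obtain ⟨μ, hμ⟩ := hwV.exists_integral_nonpos hT hn hs hs1 hΩ.isOpen hΩ.isBounded hK' hA
    fun x => mul_nonneg (hq.nonneg x) (inv_nonneg.2 (hρ0 x).le)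
  rw [NPME.restrict_prod_univ_eq]
  set P := (volume.restrict (Ioo 0 T)).prod (volume : Measure (NPME.Space n)) with hP
  have hbdd : ∀ᵐ p ∂P, ‖Real.exp (-μ * p.1)‖ ≤ Real.exp (|μ| * T) := by
    have h : ∀ᵐ p ∂P, p.1 ∈ Ioo 0 T :=
      Measure.quasiMeasurePreserving_fst.ae (ae_restrict_mem measurableSet_Ioo)
    filter_upwards [h] with p hp
    rw [Real.norm_of_nonneg (Real.exp_nonneg _), Real.exp_le_exp]
    calc -μ * p.1 ≤ |μ| * p.1 := mul_le_mul_of_nonneg_right (neg_le_abs μ) hp.1.le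
      _ ≤ |μ| * T := mul_le_mul_of_nonneg_left hp.2.le (abs_nonneg μ)
  have hint : Integrable (fun p : ℝ × NPME.Space n =>
      V p.1 p.2 * (Real.exp (-μ * p.1) * w p.1 p.2)) P := by
    have h := (hwV.memLp_V.integrable_mul hwV.memLp_w).bdd_mul
      (f := fun p : ℝ × NPME.Space n => Real.exp (-μ * p.1)) (by fun_prop) hbdd
    refine h.congr (ae_of_all _ fun p => ?_)
    simp only [Pi.mul_apply]
    ring
  have hd₁ := hu₁.ae_eq_datum hm hn hs hΩm
  have hd₂ := hu₂.ae_eq_datum hm hn hs hΩm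
  have hmono := NPME.strictMono_Phi hm
  have hsign : ∀ a b : ℝ, 0 ≤ (a - b) * (NPME.Phi m a - NPME.Phi m b) := fun a b => by
    rcases le_total a b with h | h
    · exact mul_nonneg_of_nonpos_of_nonpos (sub_nonpos.2 h) (sub_nonpos.2 (hmono.monotone h))
    · exact mul_nonneg (sub_nonneg.2 h) (sub_nonneg.2 (hmono.monotone h))
  -- On `Ω` the integrand is `ρ e^{-μt} (u₁-u₂)(Φ^m(u₁)-Φ^m(u₂))`, nonnegative by monotonicity. Its
  -- integral is nonpositive by the choice of `μ`, so it vanishes almost everywhere.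
  have hnn : 0 ≤ᵐ[P] fun p => V p.1 p.2 * (Real.exp (-μ * p.1) * w p.1 p.2) := by
    filter_upwards [hw, hV, hd₁, hd₂] with p h1 h2 h3 h4
    simp only [h1, h2, Pi.zero_apply]
    by_cases hp : p.2 ∈ Ω
    · simp only [hp, indicator_of_mem]
      have h := mul_nonneg (mul_nonneg (hρ0 p.2).le (Real.exp_nonneg (-μ * p.1)))
        (hsign (u₁ p.1 p.2) (u₂ p.1 p.2))
      linarith
    · simp [hp]
  rw [← integral_prod _ hint] at hμ
  have hzero := (integral_eq_zero_iff_of_nonneg_ae hnn hint).1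
    (le_antisymm hμ (integral_nonneg_of_ae hnn))
  filter_upwards [hw, hV, hd₁, hd₂, hzero] with p h1 h2 h3 h4 h5
  by_cases hp : p.2 ∈ Ω
  · simp only [h1, h2, hp, indicator_of_mem, Pi.zero_apply, mul_eq_zero, (hρ0 p.2).ne',
      (Real.exp_pos _).ne', false_or, sub_eq_zero] at h5
    exact h5.elim id fun h => hmono.injective h
  · rw [h3 hp, h4 hp]
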